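/- **Setting.** Let $m=(m_1,\dots,m_n):\mathbb R^p\to\mathbb R^n$ ($n\ge1$) be $C^3$, $z\in\mathbb R^n$, $x_0\in\mathbb R^p$, and let $G$ be an invertible $p\times p$ matrix ($G^2$ means $G^\top G$). Put $$\ell(x)=-\tfrac12\|m(x)-z\|^2,\qquad f(x)=\ell(x)-\tfrac12\|G(x-x_0)\|^2 ,$$ so that the posterior $\mathbb P_f$ for the prior $\mathcal N(x_0,G^{-2})$ has density proportional to $e^{f}$. Let $\breve D^2(x)=\sum_{i=1}^n\nabla m_i(x)\nabla m_i(x)^\top$, and for $r_0\ge0$ let $\mathcal X_0=\{x:\|\breve D(x_0)(x-x_0)\|\le r_0\}$. Let $C_0,C_2,C_n,\rho_0\ge0$ be such that: * (LLS2) for all $x\in\mathcal X_0$, $u\in\mathbb R^p$ and $i\le n$: $|\langle\nabla m_i(x),u\rangle|\le C_n n^{-1/2}\|\breve D(x)u\|$ (that is, $\|\breve D(x)^{-1}\nabla m_i(x)\|\le C_n n^{-1/2}$ when $\breve D(x)$ is invertible) and $\sum_i|\langle\nabla^2m_i(x),u^{\otimes2}\rangle|\le C_2\|\breve D(x)u\|^2$;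 * $\breve D^2(x)\le C_0^2\,\breve D^2(x_0)$ for $x\in\mathcal X_0$, and $n^{-1}\breve D^2(x_0)\le G^2$; * (initial guess) there is $x_*\in\mathcal X_0$ with $\|m(x_*)-z\|_\infty\le\rho_0$, and $\delta:=C_2\bigl(\rho_0+2r_0C_nC_0/\sqrt n\bigr)\le 3/4$. **Theorem.** 1. *(Strong concavity.)* For all $x\in\mathcal X_0$, $-\nabla^2\ell(x)\ge(1-\delta)\breve D^2(x)$, and $f$ is strongly concave on $\mathcal X_0$ (with some $\mu>0$ satisfying $\mu I\le G^2$). 2. *(Penalized solution.)* If $m(x_*)=z$ and $\|G(x_*-x_0)\|\le r_0/\sqrt n$, or more generally if $n\bigl(\|G(x_*-x_0)\|^2+\|m(x_*)-z\|^2\bigr)\le r_0^2$, then $f$ has exactly one global maximizer $x_G^*$ on $\mathbb R^p$, and $x_G^*\in\mathcal X_0$. 3. *(Laplace approximation.)* Let $x_G^*$ be a global maximizer of $f$. Put $D^2=-\nabla^2\ell(x_G^*)$, $D_G^2=-\nabla^2f(x_G^*)=D^2+G^2$, $p_G=\operatorname{tr}(D^2D_G^{-2})$ and let $\gamma_G\sim\mathcal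 N(0,D_G^{-2})$. For $t>0$ and $\nu\in(0,1)$ let $r=\nu^{-1}\bigl(2\sqrt{p_G}+\sqrt{2t}\bigr)$ and $\mathcal U=\{x:\|D(x-x_G^*)\|\le r\}$. Assume $\mathcal U\subseteq\mathcal X_0$, $\rho_0+2r_0C_nC_0/\sqrt n\le1$, $\breve D^2(x)\le C_G D^2$ for $x\in\mathcal U$ (by 1, $C_G=C/(1-\delta)$ will do if $\breve D^2(x)\le C\,\breve D^2(x_G^*)$ there), and * (LLS3) for $x\in\mathcal U$ and $u\in\mathbb R^p$, $\bigl|\sum_i\langle\nabla m_i(x),u\rangle\langle\nabla^2m_i(x),u^{\otimes2}\rangle\bigr|$ and $\sum_i|\langle\nabla^3m_i(x),u^{\otimes3}\rangle|$ are both at most $C_3\sum_i|\langle\nabla m_i(x),u\rangle|^3$, with $C_G,C_3\ge0$. Let $c_3=4C_G^{3/2}C_3C_n$ and $\omega=\tfrac13c_3\,r\,n^{-1/2}$, and assume $\omega\le1/4$, $\omega\le1-\nu$ and $\omega\,p_G\le2/3$. Let $\mathbb P$ be the posterior conditioned on $\mathcal X_0$, $\mathbb P=\mathbb P_f(\,\cdot\mid\mathcal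 X_0)$. Then for every Borel set $A\subseteq\mathbb R^p$ $$\bigl|\mathbb P(X-x_G^*\in A)-\mathbb P(\gamma_G\in A)\bigr|\le 2c_3\sqrt{\frac{(p_G+1)^3}{n}}+4e^{-t}.$$ If moreover $m$ is $C^4$ and * (LLS4) for $x\in\mathcal U$ and $u\in\mathbb R^p$, $\sum_i\langle\nabla^2m_i(x),u^{\otimes2}\rangle^2$, $\bigl|\sum_i\langle\nabla m_i(x),u\rangle\langle\nabla^3m_i(x),u^{\otimes3}\rangle\bigr|$ and $\sum_i|\langle\nabla^4m_i(x),u^{\otimes4}\rangle|$ are all at most $C_4\sum_i\langle\nabla m_i(x),u\rangle^4$ (with $C_4\ge0$), then with $c_4=8C_G^2C_4C_n^2$, for every Borel set $A$ with $A=-A$, $$\bigl|\mathbb P(X-x_G^*\in A)-\mathbb P(\gamma_G\in A)\bigr|\le\frac{c_3^2(p_G+2)^3+2c_4(p_G+1)^2}{2n}+4e^{-t}.$$ Both bounds hold for the unconditional posterior $\mathbb P=\mathbb P_f$ as well, after adding $\mathbb P_f(\mathbb R^p\setminus\mathcal X_0)$ to the right-hand side; and without this term if $\ell$ is concave on all of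 $\mathbb R^p$. -/

import Mathlib

open MeasureTheory ProbabilityTheory

noncomputable section

namespace NonlinearLaplace

variable {p n : ℕ}

/-- The directional derivative `⟨∇ᵏ g(x), u^{⊗k}⟩` of order `k` of a scalar function. -/
def dirDeriv (k : ℕ) (g : EuclideanSpace ℝ (Fin p) → ℝ) (x u : EuclideanSpace ℝ (Fin p)) : ℝ :=
  iteratedFDeriv ℝ k g x (fun _ => u)

/-- The matrix `-∇² g(x)`, as a linear operator. -/
def negHess (g : EuclideanSpace ℝ (Fin p) → ℝ) (x : EuclideanSpace ℝ (Fin p)) :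
    EuclideanSpace ℝ (Fin p) →L[ℝ] EuclideanSpace ℝ (Fin p) :=
  -(fderiv ℝ (gradient g) x)

/-- The quadratic form `⟨-∇² g(x) u, u⟩`. -/
def negHessForm (g : EuclideanSpace ℝ (Fin p) → ℝ) (x u : EuclideanSpace ℝ (Fin p)) : ℝ :=
  inner ℝ (negHess g x u) u

/-- The log-likelihood `ℓ(x) = -‖m(x) - z‖² / 2`. -/
def logLik (m : EuclideanSpace ℝ (Fin p) → EuclideanSpace ℝ (Fin n))
    (z : EuclideanSpace ℝ (Fin n)) (x : EuclideanSpace ℝ (Fin p)) : ℝ :=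
  -(‖m x - z‖ ^ 2 / 2)

/-- The objective `f(x) = ℓ(x) - ‖G (x - x₀)‖² / 2`, the log-density of the posterior up to an
additive constant. -/
def objective (m : EuclideanSpace ℝ (Fin p) → EuclideanSpace ℝ (Fin n))
    (z : EuclideanSpace ℝ (Fin n)) (x₀ : EuclideanSpace ℝ (Fin p))
    (G : EuclideanSpace ℝ (Fin p) →L[ℝ] EuclideanSpace ℝ (Fin p))
    (x : EuclideanSpace ℝ (Fin p)) : ℝ :=
  logLik m z x - ‖G (x - x₀)‖ ^ 2 / 2

/-- `‖D̆(x) u‖²`, where `D̆(x)² = ∑ᵢ ∇mᵢ(x) ∇mᵢ(x)ᵀ`. -/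
def breveSq (m : EuclideanSpace ℝ (Fin p) → EuclideanSpace ℝ (Fin n))
    (x u : EuclideanSpace ℝ (Fin p)) : ℝ :=
  ∑ i, dirDeriv 1 (fun y => m y i) x u ^ 2

/-- The set `𝒳₀ = {x : ‖D̆(x₀)(x - x₀)‖ ≤ r₀}`. -/
def priorSet (m : EuclideanSpace ℝ (Fin p) → EuclideanSpace ℝ (Fin n))
    (x₀ : EuclideanSpace ℝ (Fin p)) (r₀ : ℝ) : Set (EuclideanSpace ℝ (Fin p)) :=
  {x | breveSq m x₀ (x - x₀) ≤ r₀ ^ 2}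

/-- The first and second order conditions on a set `X`:
`‖D̆(x)⁻¹ ∇mᵢ(x)‖ ≤ Cₙ / √n`, written in the form
`|⟨∇mᵢ(x), u⟩| ≤ (Cₙ / √n) ‖D̆(x) u‖` which makes sense for singular `D̆(x)`, and
`∑ᵢ |⟨∇²mᵢ(x), u^{⊗2}⟩| ≤ C₂ ‖D̆(x) u‖²`. -/
def Smooth2On (m : EuclideanSpace ℝ (Fin p) → EuclideanSpace ℝ (Fin n))
    (X : Set (EuclideanSpace ℝ (Fin p))) (C₂ Cn : ℝ) : Prop :=
  ∀ x ∈ X, ∀ u : EuclideanSpace ℝ (Fin p),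
    (∀ i, |dirDeriv 1 (fun y => m y i) x u| ≤ Cn / √n * √(breveSq m x u)) ∧
    ∑ i, |dirDeriv 2 (fun y => m y i) x u| ≤ C₂ * breveSq m x u

/-- The third order condition on a set `X`. -/
def Smooth3On (m : EuclideanSpace ℝ (Fin p) → EuclideanSpace ℝ (Fin n))
    (X : Set (EuclideanSpace ℝ (Fin p))) (C₃ : ℝ) : Prop :=
  ∀ x ∈ X, ∀ u : EuclideanSpace ℝ (Fin p),
    |∑ i, dirDeriv 1 (fun y => m y i) x u * dirDeriv 2 (fun y => m y i) x u|
        ≤ C₃ * ∑ i, |dirDeriv 1 (fun y => m y i) x u| ^ 3 ∧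
    ∑ i, |dirDeriv 3 (fun y => m y i) x u|
        ≤ C₃ * ∑ i, |dirDeriv 1 (fun y => m y i) x u| ^ 3

/-- The fourth order condition on a set `X`. -/
def Smooth4On (m : EuclideanSpace ℝ (Fin p) → EuclideanSpace ℝ (Fin n))
    (X : Set (EuclideanSpace ℝ (Fin p))) (C₄ : ℝ) : Prop :=
  ∀ x ∈ X, ∀ u : EuclideanSpace ℝ (Fin p),
    ∑ i, dirDeriv 2 (fun y => m y i) x u ^ 2
        ≤ C₄ * ∑ i, dirDeriv 1 (fun y => m y i) x u ^ 4 ∧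
    |∑ i, dirDeriv 1 (fun y => m y i) x u * dirDeriv 3 (fun y => m y i) x u|
        ≤ C₄ * ∑ i, dirDeriv 1 (fun y => m y i) x u ^ 4 ∧
    ∑ i, |dirDeriv 4 (fun y => m y i) x u|
        ≤ C₄ * ∑ i, dirDeriv 1 (fun y => m y i) x u ^ 4

/-- The effective dimension `tr(D² D_G⁻²)` with `D² = -∇²ℓ(x)` and `D_G² = -∇²f(x)`. -/
def effDim (l f : EuclideanSpace ℝ (Fin p) → ℝ) (x : EuclideanSpace ℝ (Fin p)) : ℝ :=
  LinearMap.trace ℝ (EuclideanSpace ℝ (Fin p))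
    (((negHess l x).comp (negHess f x).inverse :
      EuclideanSpace ℝ (Fin p) →L[ℝ] EuclideanSpace ℝ (Fin p)) :
      EuclideanSpace ℝ (Fin p) →ₗ[ℝ] EuclideanSpace ℝ (Fin p))

/-- The radius `r_G = 2 √p_G + √(2 t)`. -/
def effRadius (l f : EuclideanSpace ℝ (Fin p) → ℝ) (x : EuclideanSpace ℝ (Fin p)) (t : ℝ) : ℝ :=
  2 * √(effDim l f x) + √(2 * t)

/-- The ellipsoid `{y : ‖D (y - x)‖ ≤ r}` with `D² = -∇²ℓ(x)`. -/
def localSet (l : EuclideanSpace ℝ (Fin p) → ℝ) (x : EuclideanSpace ℝ (Fin p)) (r : ℝ) :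
    Set (EuclideanSpace ℝ (Fin p)) :=
  {y | negHessForm l x (y - x) ≤ r ^ 2}

/-- The probability measure on `ℝᵖ` with density proportional to `exp g`. -/
def gibbs (g : EuclideanSpace ℝ (Fin p) → ℝ) : Measure (EuclideanSpace ℝ (Fin p)) :=
  cond (volume.withDensity fun x => ENNReal.ofReal (Real.exp (g x))) Set.univ

/-- The centred Gaussian measure `𝒩(0, D_G⁻²)` with precision matrix `D_G² = -∇²f(x)`, that is,
the probability measure with density proportional to `exp(-‖D_G u‖² / 2)`. -/
def laplaceGaussian (f : EuclideanSpace ℝ (Fin p) → ℝ) (x : EuclideanSpace ℝ (Fin p)) :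
    Measure (EuclideanSpace ℝ (Fin p)) :=
  gibbs fun u => -(negHessForm f x u / 2)

/-- `|P(X - x ∈ A) - ℙ(γ ∈ A)|` with `X ∼ P` and `γ ∼ 𝒩(0, D_G⁻²)`, `D_G² = -∇²f(x)`. -/
def laplaceError (P : Measure (EuclideanSpace ℝ (Fin p))) (f : EuclideanSpace ℝ (Fin p) → ℝ)
    (x : EuclideanSpace ℝ (Fin p)) (A : Set (EuclideanSpace ℝ (Fin p))) : ℝ :=
  |P.real ((fun y => y - x) ⁻¹' A) - (laplaceGaussian f x).real A|

end NonlinearLaplace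

end

open NonlinearLaplace

namespace NonlinearLaplace

open scoped Topology ENNReal

variable {p n : ℕ}

/-! ### Derivatives along lines -/

section Lines

variable {g : EuclideanSpace ℝ (Fin p) → ℝ} {N k : ℕ}

/-! On `priorSet` everything follows from `-∇²ℓ = D̆² + ∑ᵢ (mᵢ - zᵢ) ∇²mᵢ`. The mean value theorem
along the segment from the initial guess bounds every residual by `K = ρ₀ + 2 r₀ Cₙ C₀ / √n`, so the
second sum costs at most `C₂ K ≤ 3/4` times `D̆²`. Hence `ℓ` is concave and `f` strongly concave
there. A point where `f` is at least its value at the guess satisfies `n ‖G (x - x₀)‖² ≤ r₀²`, so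
every global maximizer lies in `priorSet`, and strong concavity makes it unique.

For the Laplace approximation, let `δ(u) = f(xG + u) - f(xG) + ‖D_G u‖² / 2`. Since `∇f(xG) = 0` and
the penalty is quadratic, `δ` is the third order Taylor remainder of `ℓ`, and the centred posterior
has density proportional to `w = e^δ`, cut off outside the set conditioned on, relative to the
Gaussian `γ_G`. With `Y = ‖D u‖²` and `τ = c₃ / √n` one has `|δ| ≤ τ Y^{3/2} / 6` on the ellipsoid
`Y ≤ r²`, hence also `|δ| ≤ ω Y / 2`. Under `γ_G`, diagonalising `D²` and `D_G²` simultaneously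
(`exists_simultaneous_diagonalization`) turns `Y` into a sum of squared independent normals with
weights in `[0, 1]` adding up to `p_G`. All that is used of it is the moment generating function,
recorded in `IsWeightedChiSq`.

Inside the ellipsoid, `|e^δ - 1| ≤ |δ| e^{|δ|}` reduces the error to moments of `Y` tilted by
`e^{ωY/2}`, which are derivatives of the moment generating function (`integral_pow_eq`). For
symmetric sets `δ(u)` may be replaced by the mean of `δ(u)` and `δ(-u)`; this cancels the third
order, leaving a fourth order term and a term quadratic in `δ`.

Outside, concavity along rays only gives `w ≤ exp(Y/2 - a √Y + const)`, and `e^{Y/2}` alone need not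
be integrable. Writing `e^{-a√Y}` as a mixture of `e^{-Y/(2w²)}` over `w`
(`exp_neg_mul_le_lintegral`) brings the integral back to the generating function at `1 - 1/w² < 1`.

`IsLaplaceDensity` collects these facts for an abstract density, and `abs_sub_le` and
`abs_sub_le_of_symm` draw the conclusions. -/

lemma dirDeriv_zero (g : EuclideanSpace ℝ (Fin p) → ℝ) (x u : EuclideanSpace ℝ (Fin p)) :
    dirDeriv 0 g x u = g x := rfl

lemma dirDeriv_one (g : EuclideanSpace ℝ (Fin p) → ℝ) (x u : EuclideanSpace ℝ (Fin p)) :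
    dirDeriv 1 g x u = fderiv ℝ g x u := by
  simp [dirDeriv, iteratedFDeriv_one_apply]

lemma dirDeriv_smul (g : EuclideanSpace ℝ (Fin p) → ℝ) (k : ℕ) (x u : EuclideanSpace ℝ (Fin p))
    (c : ℝ) : dirDeriv k g x (c • u) = c ^ k * dirDeriv k g x u := by
  have := (iteratedFDeriv ℝ k g x).map_smul_univ (fun _ => c) (fun _ => u)
  simpa [dirDeriv] using this

lemma hasDerivAt_line (x u : EuclideanSpace ℝ (Fin p)) (s : ℝ) :
    HasDerivAt (fun s : ℝ => x + s • u) u s := by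
  simpa using ((hasDerivAt_id s).smul_const u).const_add x

lemma hasDerivAt_dirDeriv (hg : ContDiff ℝ N g) (hk : k < N) (x u : EuclideanSpace ℝ (Fin p))
    (s : ℝ) :
    HasDerivAt (fun s : ℝ => dirDeriv k g (x + s • u) u) (dirDeriv (k + 1) g (x + s • u) u) s := by
  have hd : DifferentiableAt ℝ (iteratedFDeriv ℝ k g) (x + s • u) :=
    (hg.differentiable_iteratedFDeriv (by exact_mod_cast hk)) _
  have h1 := hd.hasFDerivAt.comp_hasDerivAt s (hasDerivAt_line x u s)
  have h2 := (ContinuousMultilinearMap.apply ℝ (fun _ : Fin k => EuclideanSpace ℝ (Fin p)) ℝ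
    (fun _ => u)).hasFDerivAt.comp_hasDerivAt s h1
  refine h2.congr_deriv ?_
  simp only [dirDeriv, iteratedFDeriv_succ_apply_left]
  rfl

/-- Induction step for explicit derivative formulas: a formula for order `k` valid at every point is
differentiated once along the line, and uniqueness of derivatives gives order `k + 1`. -/
lemma dirDeriv_eq_of_hasDerivAt (hg : ContDiff ℝ N g) (hk : k < N)
    {x u : EuclideanSpace ℝ (Fin p)} {F : EuclideanSpace ℝ (Fin p) → ℝ} {c : ℝ}
    (hF : ∀ y, dirDeriv k g y u = F y)
    (hd : HasDerivAt (fun s : ℝ => F (x + s • u)) c 0) :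
    dirDeriv (k + 1) g x u = c := by
  have h := hasDerivAt_dirDeriv hg hk x u 0
  simp only [hF] at h
  simpa using h.unique hd

lemma negHessForm_eq (hg : ContDiff ℝ N g) (hN : 2 ≤ N) (x u : EuclideanSpace ℝ (Fin p)) :
    negHessForm g x u = -dirDeriv 2 g x u := by
  have hg2 : ContDiff ℝ 2 g := hg.of_le (by exact_mod_cast hN)
  have hgrad : ContDiff ℝ 1 (gradient g) :=
    (InnerProductSpace.toDual ℝ (EuclideanSpace ℝ (Fin p))).symm.contDiff.comp
      (hg2.fderiv_right (m := 1) (by norm_num))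
  have hd : DifferentiableAt ℝ (gradient g) (x + (0 : ℝ) • u) :=
    (hgrad.differentiable (by norm_num)) _
  have h1 := hd.hasFDerivAt.comp_hasDerivAt (0 : ℝ) (hasDerivAt_line x u 0)
  have h2 := h1.inner ℝ (hasDerivAt_const (0 : ℝ) u)
  have h3 : dirDeriv 2 g x u = _ :=
    dirDeriv_eq_of_hasDerivAt (k := 1) (F := fun y => inner ℝ (gradient g y) u) hg2 (by norm_num)
      (fun y => by rw [dirDeriv_one]; simp [gradient]) h2
  rw [h3]
  simp [negHessForm, negHess]

lemma negHess_symm (hg : ContDiff ℝ N g) (hN : 2 ≤ N) (x u v : EuclideanSpace ℝ (Fin p)) :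
    inner ℝ (negHess g x u) v = inner ℝ u (negHess g x v) := by
  have hg2 : ContDiff ℝ 2 g := hg.of_le (by exact_mod_cast hN)
  have hgr : ContDiff ℝ 1 (gradient g) :=
    (InnerProductSpace.toDual ℝ (EuclideanSpace ℝ (Fin p))).symm.contDiff.comp
      (hg2.fderiv_right (m := 1) (by norm_num))
  have hsymm : IsSymmSndFDerivAt ℝ g x := hg2.contDiffAt.isSymmSndFDerivAt (by simp)
  have key : ∀ a b, inner ℝ (negHess g x a) b = -(fderiv ℝ (fderiv ℝ g) x a b) := by
    intro a b
    have hgrad : DifferentiableAt ℝ (gradient g) (x + (0 : ℝ) • a) :=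
      hgr.differentiable (by norm_num) _
    have hfd' : DifferentiableAt ℝ (fderiv ℝ g) (x + (0 : ℝ) • a) :=
      ((hg2.fderiv_right (m := 1) (by norm_num)).differentiable (by norm_num)) _
    have h1 := hgrad.hasFDerivAt.comp_hasDerivAt (0 : ℝ) (hasDerivAt_line x a 0)
    have h2 := h1.inner ℝ (hasDerivAt_const (0 : ℝ) b)
    have h3 := (ContinuousLinearMap.apply ℝ ℝ b).hasFDerivAt.comp_hasDerivAt (0 : ℝ)
      (hfd'.hasFDerivAt.comp_hasDerivAt (0 : ℝ) (hasDerivAt_line x a 0))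
    have h4 : HasDerivAt (fun s : ℝ => inner ℝ (gradient g (x + s • a)) b)
        (inner ℝ (fderiv ℝ (gradient g) x a) b) 0 := by
      refine h2.congr_deriv ?_
      simp
    have h5 : HasDerivAt (fun s : ℝ => fderiv ℝ g (x + s • a) b)
        (fderiv ℝ (fderiv ℝ g) x a b) 0 := by
      refine h3.congr_deriv ?_
      simp
    have h6 : (fun s : ℝ => inner ℝ (gradient g (x + s • a)) b) =
        fun s : ℝ => fderiv ℝ g (x + s • a) b := by
      funext s; simp [gradient]
    rw [h6] at h4
    simp [negHess, h4.unique h5]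
  rw [key, real_inner_comm, key, hsymm u v]

end Lines

/-! ### Concavity from second derivatives along lines -/

lemma concaveOn_of_line {S : Set (EuclideanSpace ℝ (Fin p))} (hS : Convex ℝ S)
    {F : EuclideanSpace ℝ (Fin p) → ℝ}
    {F₁ F₂ : EuclideanSpace ℝ (Fin p) → EuclideanSpace ℝ (Fin p) → ℝ}
    (h1 : ∀ x u s, HasDerivAt (fun s : ℝ => F (x + s • u)) (F₁ (x + s • u) u) s)
    (h2 : ∀ x u s, HasDerivAt (fun s : ℝ => F₁ (x + s • u) u) (F₂ (x + s • u) u) s)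
    (hneg : ∀ x ∈ S, ∀ u, F₂ x u ≤ 0) : ConcaveOn ℝ S F := by
  refine ⟨hS, fun x hx y hy a b ha hb hab => ?_⟩
  have hseg : ∀ s ∈ Set.Icc (0 : ℝ) 1, x + s • (y - x) ∈ S := fun s hs =>
    hS.add_smul_sub_mem hx hy hs
  have hc : ConcaveOn ℝ (Set.Icc (0 : ℝ) 1) (fun s : ℝ => F (x + s • (y - x))) := by
    refine concaveOn_of_hasDerivWithinAt2_nonpos (convex_Icc 0 1)
      (fun s _ => (h1 x (y - x) s).continuousAt.continuousWithinAt)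
      (fun s _ => (h1 x (y - x) s).hasDerivWithinAt)
      (fun s _ => (h2 x (y - x) s).hasDerivWithinAt) fun s hs => hneg _ (hseg s ?_) _
    exact interior_subset hs
  have := hc.2 (Set.left_mem_Icc.2 zero_le_one) (Set.right_mem_Icc.2 zero_le_one) ha hb hab
  have e1 : x + (a • (0 : ℝ) + b • (1 : ℝ)) • (y - x) = a • x + b • y := by
    simp only [smul_eq_mul, mul_zero, mul_one, zero_add, smul_sub]
    rw [← eq_sub_iff_add_eq] at hab
    rw [hab, sub_smul, one_smul]; abel
  simp only [e1] at this
  simpa using this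

/-! ### The log-likelihood -/

section LogLik

variable {m : EuclideanSpace ℝ (Fin p) → EuclideanSpace ℝ (Fin n)} {N : ℕ}

lemma contDiff_coord (hm : ContDiff ℝ N m) (i : Fin n) : ContDiff ℝ N (fun y => m y i) :=
  contDiff_euclidean.1 hm i

lemma logLik_eq (m : EuclideanSpace ℝ (Fin p) → EuclideanSpace ℝ (Fin n))
    (z : EuclideanSpace ℝ (Fin n)) (x : EuclideanSpace ℝ (Fin p)) :
    logLik m z x = -(∑ i, (m x i - z i) ^ 2) / 2 := by
  rw [logLik, EuclideanSpace.real_norm_sq_eq]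
  simp [neg_div]

lemma contDiff_logLik (hm : ContDiff ℝ N m) (z : EuclideanSpace ℝ (Fin n)) :
    ContDiff ℝ N (logLik m z) :=
  (((hm.sub contDiff_const).norm_sq ℝ).div_const 2).neg

variable (z : EuclideanSpace ℝ (Fin n)) (x u : EuclideanSpace ℝ (Fin p))

lemma hasDerivAt_coord (hm : ContDiff ℝ N m) {k : ℕ} (hk : k < N) (i : Fin n) :
    HasDerivAt (fun s : ℝ => dirDeriv k (fun y => m y i) (x + s • u) u)
      (dirDeriv (k + 1) (fun y => m y i) x u) 0 := by
  simpa using hasDerivAt_dirDeriv (contDiff_coord hm i) hk x u 0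

lemma dirDeriv_logLik_one (hm : ContDiff ℝ N m) (hN : 1 ≤ N) :
    dirDeriv 1 (logLik m z) x u = -∑ i, (m x i - z i) * dirDeriv 1 (fun y => m y i) x u := by
  refine dirDeriv_eq_of_hasDerivAt (k := 0) (F := fun y => -(∑ i, (m y i - z i) ^ 2) / 2)
    (contDiff_logLik hm z) (by omega) (fun y => logLik_eq m z y) ?_
  have h := ((HasDerivAt.fun_sum fun i (_ : i ∈ Finset.univ) =>
    ((hasDerivAt_coord x u hm (k := 0) (by omega) i).sub_const (z i)).pow 2).neg).div_const 2
  simp only [dirDeriv_zero, zero_smul, add_zero] at h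
  refine h.congr_deriv ?_
  rw [neg_div, Finset.sum_div]
  congr 1
  refine Finset.sum_congr rfl fun i _ => ?_
  push_cast; ring

lemma dirDeriv_logLik_two (hm : ContDiff ℝ N m) (hN : 2 ≤ N) :
    dirDeriv 2 (logLik m z) x u = -∑ i, (dirDeriv 1 (fun y => m y i) x u ^ 2 +
      (m x i - z i) * dirDeriv 2 (fun y => m y i) x u) := by
  refine dirDeriv_eq_of_hasDerivAt (k := 1) (contDiff_logLik hm z) (by omega)
    (fun y => dirDeriv_logLik_one z y u hm (by omega)) ?_
  have h := (HasDerivAt.fun_sum fun i (_ : i ∈ Finset.univ) =>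
    ((hasDerivAt_coord x u hm (k := 0) (by omega) i).sub_const (z i)).mul
      (hasDerivAt_coord x u hm (k := 1) (by omega) i)).neg
  simp only [dirDeriv_zero, zero_smul, add_zero] at h
  refine h.congr_deriv ?_
  congr 1
  refine Finset.sum_congr rfl fun i _ => ?_
  ring

lemma dirDeriv_logLik_three (hm : ContDiff ℝ N m) (hN : 3 ≤ N) :
    dirDeriv 3 (logLik m z) x u = -∑ i,
      (3 * (dirDeriv 1 (fun y => m y i) x u * dirDeriv 2 (fun y => m y i) x u) +
      (m x i - z i) * dirDeriv 3 (fun y => m y i) x u) := by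
  refine dirDeriv_eq_of_hasDerivAt (k := 2) (contDiff_logLik hm z) (by omega)
    (fun y => dirDeriv_logLik_two z y u hm (by omega)) ?_
  have h := (HasDerivAt.fun_sum fun i (_ : i ∈ Finset.univ) =>
    ((hasDerivAt_coord x u hm (k := 1) (by omega) i).pow 2).add
    (((hasDerivAt_coord x u hm (k := 0) (by omega) i).sub_const (z i)).mul
      (hasDerivAt_coord x u hm (k := 2) (by omega) i))).neg
  simp only [dirDeriv_zero, zero_smul, add_zero] at h
  refine h.congr_deriv ?_
  congr 1
  refine Finset.sum_congr rfl fun i _ => ?_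
  push_cast; ring

lemma dirDeriv_logLik_four (hm : ContDiff ℝ N m) (hN : 4 ≤ N) :
    dirDeriv 4 (logLik m z) x u = -∑ i,
      (3 * dirDeriv 2 (fun y => m y i) x u ^ 2 +
      4 * (dirDeriv 1 (fun y => m y i) x u * dirDeriv 3 (fun y => m y i) x u) +
      (m x i - z i) * dirDeriv 4 (fun y => m y i) x u) := by
  refine dirDeriv_eq_of_hasDerivAt (k := 3) (contDiff_logLik hm z) (by omega)
    (fun y => dirDeriv_logLik_three z y u hm (by omega)) ?_
  have h := (HasDerivAt.fun_sum fun i (_ : i ∈ Finset.univ) =>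
    (((hasDerivAt_coord x u hm (k := 1) (by omega) i).mul
      (hasDerivAt_coord x u hm (k := 2) (by omega) i)).const_mul 3).add
    (((hasDerivAt_coord x u hm (k := 0) (by omega) i).sub_const (z i)).mul
      (hasDerivAt_coord x u hm (k := 3) (by omega) i))).neg
  simp only [dirDeriv_zero, zero_smul, add_zero] at h
  refine h.congr_deriv ?_
  congr 1
  refine Finset.sum_congr rfl fun i _ => ?_
  ring

end LogLik

/-! ### One-dimensional Taylor bounds -/

/-- One integration of a power bound. Iterating it gives Taylor bounds without an integral
remainder. -/
lemma abs_le_of_hasDerivAt_abs_le {F F' : ℝ → ℝ} {K b : ℝ} {k : ℕ} (h0 : F 0 = 0)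
    (hd : ∀ s, HasDerivAt F (F' s) s) (hK : ∀ s ∈ Set.Icc 0 b, |F' s| ≤ K * s ^ k) :
    ∀ s ∈ Set.Icc 0 b, |F s| ≤ K / (k + 1) * s ^ (k + 1) := by
  have hk : (k + 1 : ℝ) ≠ 0 := by positivity
  intro s hs
  have hB : ∀ t : ℝ, HasDerivAt (fun t => K / (k + 1) * t ^ (k + 1)) (K * t ^ k) t := by
    intro t
    refine ((hasDerivAt_pow (k + 1) t).const_mul (K / (k + 1))).congr_deriv ?_
    push_cast
    field_simp
  have := image_norm_le_of_norm_deriv_right_le_deriv_boundary (a := 0) (b := b) (f := F) (f' := F')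
    (fun t _ => (hd t).continuousAt.continuousWithinAt) (fun t _ => (hd t).hasDerivWithinAt)
    (B := fun t => K / (k + 1) * t ^ (k + 1)) (B' := fun t => K * t ^ k) (by simp [h0])
    hB (fun t ht => hK t ⟨ht.1, ht.2.le⟩) hs
  simpa using this

lemma taylor_two_bounds {g g₁ g₂ g₃ : ℝ → ℝ} {K b : ℝ} (hb : 0 ≤ b)
    (h0 : ∀ s, HasDerivAt g (g₁ s) s) (h1 : ∀ s, HasDerivAt g₁ (g₂ s) s)
    (h2 : ∀ s, HasDerivAt g₂ (g₃ s) s) (hK : ∀ s ∈ Set.Icc 0 b, |g₃ s| ≤ K) :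
    |g b - g 0 - b * g₁ 0 - b ^ 2 / 2 * g₂ 0| ≤ K / 6 * b ^ 3 ∧
      |g₁ b - g₁ 0 - b * g₂ 0| ≤ K / 2 * b ^ 2 := by
  have k2 : ∀ s ∈ Set.Icc 0 b, |g₂ s - g₂ 0| ≤ K * s ^ 1 := by
    have := abs_le_of_hasDerivAt_abs_le (F := fun s => g₂ s - g₂ 0) (F' := g₃) (k := 0) (K := K)
      (b := b) (by simp) (fun s => (h2 s).sub_const _) (by simpa using hK)
    simpa using this
  have k1 := abs_le_of_hasDerivAt_abs_le (F := fun s => g₁ s - g₁ 0 - s * g₂ 0)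
    (F' := fun s => g₂ s - g₂ 0) (by simp)
    (fun s => by simpa using ((h1 s).sub_const (g₁ 0)).fun_sub ((hasDerivAt_id s).mul_const (g₂ 0))) k2
  have k0 := abs_le_of_hasDerivAt_abs_le (F := fun s => g s - g 0 - s * g₁ 0 - s ^ 2 / 2 * g₂ 0)
    (F' := fun s => g₁ s - g₁ 0 - s * g₂ 0) (by simp)
    (fun s => by
      have := (((h0 s).sub_const (g 0)).fun_sub ((hasDerivAt_id s).mul_const (g₁ 0))).fun_sub
        ((((hasDerivAt_pow 2 s).div_const 2)).mul_const (g₂ 0))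
      simpa using this) k1
  have m := Set.right_mem_Icc.2 hb
  refine ⟨(k0 b m).trans_eq ?_, (k1 b m).trans_eq ?_⟩ <;> push_cast <;> ring

/-- Odd orders cancel in `g b + g (-b)`, so only the fourth derivative enters; the bound is
integrated up from `g₃ s - g₃ (-s)`, whose derivative is at most `2 K` in absolute value. -/
lemma taylor_even_bound {g g₁ g₂ g₃ g₄ : ℝ → ℝ} {K b : ℝ} (hb : 0 ≤ b)
    (h0 : ∀ s, HasDerivAt g (g₁ s) s) (h1 : ∀ s, HasDerivAt g₁ (g₂ s) s)
    (h2 : ∀ s, HasDerivAt g₂ (g₃ s) s) (h3 : ∀ s, HasDerivAt g₃ (g₄ s) s)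
    (hK : ∀ s ∈ Set.Icc (-b) b, |g₄ s| ≤ K) :
    |g b + g (-b) - 2 * g 0 - b ^ 2 * g₂ 0| ≤ K / 12 * b ^ 4 := by
  have neg : ∀ {f f' : ℝ → ℝ}, (∀ s, HasDerivAt f (f' s) s) →
      ∀ s, HasDerivAt (fun s => f (-s)) (-f' (-s)) s := fun h s =>
    ((h (-s)).comp s (hasDerivAt_neg s)).congr_deriv (by simp)
  have k3 : ∀ s ∈ Set.Icc 0 b, |g₃ s - g₃ (-s)| ≤ 2 * K * s ^ 1 := by
    have := abs_le_of_hasDerivAt_abs_le (F := fun s => g₃ s - g₃ (-s))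
      (F' := fun s => g₄ s + g₄ (-s)) (k := 0) (K := 2 * K) (b := b) (by simp)
      (fun s => by simpa using (h3 s).fun_sub (neg h3 s)) (fun s hs => by
        have e1 := hK s ⟨by linarith [hs.1], hs.2⟩
        have e2 := hK (-s) ⟨by linarith [hs.2], by linarith [hs.1]⟩
        have := abs_add_le (g₄ s) (g₄ (-s))
        simp only [pow_zero, mul_one]; linarith)
    simpa using this
  have k2 := abs_le_of_hasDerivAt_abs_le (F := fun s => g₂ s + g₂ (-s) - 2 * g₂ 0)
    (F' := fun s => g₃ s - g₃ (-s)) (by simp; ring)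
    (fun s => by simpa [sub_eq_add_neg] using ((h2 s).fun_add (neg h2 s)).sub_const (2 * g₂ 0)) k3
  have k1 := abs_le_of_hasDerivAt_abs_le (F := fun s => g₁ s - g₁ (-s) - s * (2 * g₂ 0))
    (F' := fun s => g₂ s + g₂ (-s) - 2 * g₂ 0) (by simp)
    (fun s => by
      simpa using ((h1 s).fun_sub (neg h1 s)).fun_sub ((hasDerivAt_id s).mul_const (2 * g₂ 0))) k2
  have k0 := abs_le_of_hasDerivAt_abs_le
    (F := fun s => g s + g (-s) - 2 * g 0 - s ^ 2 / 2 * (2 * g₂ 0))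
    (F' := fun s => g₁ s - g₁ (-s) - s * (2 * g₂ 0)) (by simp; ring)
    (fun s => by
      have := (((h0 s).fun_add (neg h0 s)).sub_const (2 * g 0)).fun_sub
        ((((hasDerivAt_pow 2 s).div_const 2)).mul_const (2 * g₂ 0))
      simpa [sub_eq_add_neg] using this) k1
  have := k0 b (Set.right_mem_Icc.2 hb)
  have e : g b + g (-b) - 2 * g 0 - b ^ 2 * g₂ 0
      = g b + g (-b) - 2 * g 0 - b ^ 2 / 2 * (2 * g₂ 0) := by ring
  rw [e]
  refine this.trans_eq ?_
  push_cast; ring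

/-! ### The quadratic penalty -/

section Penalty

variable (G : EuclideanSpace ℝ (Fin p) →L[ℝ] EuclideanSpace ℝ (Fin p))
  (x₀ x u : EuclideanSpace ℝ (Fin p)) (s : ℝ)

lemma hasDerivAt_penalty :
    HasDerivAt (fun s : ℝ => ‖G (x + s • u - x₀)‖ ^ 2 / 2)
      (inner ℝ (G (x + s • u - x₀)) (G u)) s := by
  have h := (G.hasFDerivAt.comp_hasDerivAt s ((hasDerivAt_line x u s).sub_const x₀)).norm_sq
  exact (h.div_const 2).congr_deriv (by simp)

lemma hasDerivAt_inner_penalty :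
    HasDerivAt (fun s : ℝ => inner ℝ (G (x + s • u - x₀)) (G u)) (‖G u‖ ^ 2) s := by
  have h := (G.hasFDerivAt.comp_hasDerivAt s
    ((hasDerivAt_line x u s).sub_const x₀)).inner ℝ (hasDerivAt_const s (G u))
  exact h.congr_deriv (by simp)

variable {G}

lemma exists_pos_mul_norm_sq_le (hG : Function.Injective G) :
    ∃ μ : ℝ, 0 < μ ∧ ∀ u, μ * ‖u‖ ^ 2 ≤ ‖G u‖ ^ 2 := by
  obtain ⟨K, hK, hA⟩ := (G : EuclideanSpace ℝ (Fin p) →ₗ[ℝ] EuclideanSpace ℝ (Fin p)).exists_antilipschitzWith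
    (LinearMap.ker_eq_bot.2 hG)
  have hK' : (0 : ℝ) < K := by exact_mod_cast hK
  refine ⟨1 / (K : ℝ) ^ 2, by positivity, fun u => ?_⟩
  have h : ‖u‖ ≤ K * ‖G u‖ := by simpa using hA.le_mul_dist u 0
  rw [one_div, inv_mul_le_iff₀ (by positivity), ← mul_pow]
  gcongr

end Penalty

/-! ### Residuals and curvature on the prior set -/

section Prior

variable {m : EuclideanSpace ℝ (Fin p) → EuclideanSpace ℝ (Fin n)}
  {z : EuclideanSpace ℝ (Fin n)} {x₀ : EuclideanSpace ℝ (Fin p)} {r₀ : ℝ}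

lemma breveSq_nonneg (m : EuclideanSpace ℝ (Fin p) → EuclideanSpace ℝ (Fin n))
    (x u : EuclideanSpace ℝ (Fin p)) : 0 ≤ breveSq m x u :=
  Finset.sum_nonneg fun _ _ => sq_nonneg _

lemma breveSq_eq (hm : Differentiable ℝ m) (x u : EuclideanSpace ℝ (Fin p)) :
    breveSq m x u = ‖fderiv ℝ m x u‖ ^ 2 := by
  rw [EuclideanSpace.real_norm_sq_eq, breveSq]
  refine Finset.sum_congr rfl fun i _ => ?_
  have h := ((EuclideanSpace.proj (𝕜 := ℝ) i).hasFDerivAt.comp x (hm x).hasFDerivAt).fderiv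
  rw [dirDeriv_one]
  exact congrArg (fun L : EuclideanSpace ℝ (Fin p) →L[ℝ] ℝ => L u ^ 2) h

lemma mem_priorSet_iff (hm : Differentiable ℝ m) (hr₀ : 0 ≤ r₀) {x : EuclideanSpace ℝ (Fin p)} :
    x ∈ priorSet m x₀ r₀ ↔ ‖fderiv ℝ m x₀ (x - x₀)‖ ≤ r₀ := by
  rw [priorSet, Set.mem_ofPred_eq, breveSq_eq hm, sq_le_sq₀ (norm_nonneg _) hr₀]

lemma priorSet_eq (hm : Differentiable ℝ m) (hr₀ : 0 ≤ r₀) :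
    priorSet m x₀ r₀ = fderiv ℝ m x₀ ⁻¹' Metric.closedBall (fderiv ℝ m x₀ x₀) r₀ := by
  ext x
  rw [mem_priorSet_iff hm hr₀]
  simp [dist_eq_norm]

lemma convex_priorSet (hm : Differentiable ℝ m) (hr₀ : 0 ≤ r₀) : Convex ℝ (priorSet m x₀ r₀) := by
  rw [priorSet_eq hm hr₀]
  exact (convex_closedBall _ _).is_linear_preimage (fderiv ℝ m x₀).isLinear

lemma measurableSet_priorSet (hm : Differentiable ℝ m) (hr₀ : 0 ≤ r₀) :
    MeasurableSet (priorSet m x₀ r₀) := by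
  rw [priorSet_eq hm hr₀]
  exact (Metric.isClosed_closedBall.preimage (fderiv ℝ m x₀).continuous).measurableSet

lemma abs_residual_le (hm : ContDiff ℝ 3 m) {ρ₀ C₀ C₂ Cn : ℝ} (hr₀ : 0 ≤ r₀) (hC₀ : 0 ≤ C₀)
    (hCn : 0 ≤ Cn) (hS2 : Smooth2On m (priorSet m x₀ r₀) C₂ Cn)
    (hD₀ : ∀ x ∈ priorSet m x₀ r₀, ∀ u, breveSq m x u ≤ C₀ ^ 2 * breveSq m x₀ u)
    {xs : EuclideanSpace ℝ (Fin p)} (hxs : xs ∈ priorSet m x₀ r₀)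
    (hxsz : ∀ i, |m xs i - z i| ≤ ρ₀) {x : EuclideanSpace ℝ (Fin p)}
    (hx : x ∈ priorSet m x₀ r₀) (i : Fin n) :
    |m x i - z i| ≤ ρ₀ + 2 * r₀ * Cn * C₀ / √n := by
  have hmd : Differentiable ℝ m := hm.differentiable (by norm_num)
  have hn : 0 ≤ Cn / √n := by positivity
  -- Both points are within `r₀` of `x₀` in the seminorm of `D̆(x₀)`; this is the factor `2 r₀`.
  have hdiff : ‖fderiv ℝ m x₀ (x - xs)‖ ≤ 2 * r₀ := by
    have e : x - xs = (x - x₀) - (xs - x₀) := by abel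
    rw [e, map_sub]
    have := norm_sub_le (fderiv ℝ m x₀ (x - x₀)) (fderiv ℝ m x₀ (xs - x₀))
    have h1 := (mem_priorSet_iff hmd hr₀).1 hx
    have h2 := (mem_priorSet_iff hmd hr₀).1 hxs
    linarith
  have hbound : ∀ y ∈ priorSet m x₀ r₀,
      |dirDeriv 1 (fun y => m y i) y (x - xs)| ≤ 2 * r₀ * Cn * C₀ / √n := by
    intro y hy
    refine ((hS2 y hy (x - xs)).1 i).trans ?_
    have : √(breveSq m y (x - xs)) ≤ C₀ * (2 * r₀) := by
      refine Real.sqrt_le_iff.2 ⟨by positivity, (hD₀ y hy _).trans ?_⟩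
      rw [breveSq_eq hmd, ← mul_pow]
      gcongr
    calc Cn / √n * √(breveSq m y (x - xs)) ≤ Cn / √n * (C₀ * (2 * r₀)) := by gcongr
      _ = _ := by ring
  have hmv := (convex_Icc (0 : ℝ) 1).norm_image_sub_le_of_norm_hasDerivWithin_le
    (f := fun s : ℝ => m (xs + s • (x - xs)) i) (C := 2 * r₀ * Cn * C₀ / √n)
    (fun s _ => (hasDerivAt_dirDeriv (k := 0) (contDiff_coord (N := 3) hm i) (by norm_num)
      xs (x - xs) s).hasDerivWithinAt)
    (fun s hs => hbound _ ((convex_priorSet hmd hr₀).add_smul_sub_mem hxs hx hs))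
    (Set.left_mem_Icc.2 zero_le_one) (Set.right_mem_Icc.2 zero_le_one)
  simp only [one_smul, zero_smul, add_zero, add_sub_cancel, sub_zero, norm_one, mul_one,
    Real.norm_eq_abs] at hmv
  have := abs_sub_le (m x i) (m xs i) (z i)
  linarith [hxsz i]

/-- In `-∇²ℓ = D̆² + ∑ᵢ (mᵢ - zᵢ) ∇²mᵢ`, residuals bounded by `K` make the last sum at least `-C₂ K
D̆²`. -/
lemma breveSq_le_negHessForm (hm : ContDiff ℝ 3 m) {K C₂ Cn : ℝ} {S : Set (EuclideanSpace ℝ (Fin p))}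
    (hS2 : Smooth2On m S C₂ Cn) {x : EuclideanSpace ℝ (Fin p)} (hx : x ∈ S)
    (hK0 : 0 ≤ K) (hK : ∀ i, |m x i - z i| ≤ K) (u : EuclideanSpace ℝ (Fin p)) :
    (1 - C₂ * K) * breveSq m x u ≤ negHessForm (logLik m z) x u := by
  rw [negHessForm_eq (contDiff_logLik (N := 3) hm z) (by norm_num),
    dirDeriv_logLik_two (N := 3) z x u hm (by norm_num), neg_neg, Finset.sum_add_distrib]
  have h1 : -(K * ∑ i, |dirDeriv 2 (fun y => m y i) x u|)
      ≤ ∑ i, (m x i - z i) * dirDeriv 2 (fun y => m y i) x u := by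
    rw [Finset.mul_sum, ← Finset.sum_neg_distrib]
    refine Finset.sum_le_sum fun i _ => ?_
    have h := neg_abs_le ((m x i - z i) * dirDeriv 2 (fun y => m y i) x u)
    rw [abs_mul] at h
    have := mul_le_mul_of_nonneg_right (hK i) (abs_nonneg (dirDeriv 2 (fun y => m y i) x u))
    linarith
  have h2 := mul_le_mul_of_nonneg_left (hS2 x hx u).2 hK0
  have h3 : breveSq m x u = ∑ i, dirDeriv 1 (fun y => m y i) x u ^ 2 := rfl
  rw [← h3]
  linarith

lemma concaveOn_logLik (hm : ContDiff ℝ 3 m) {S : Set (EuclideanSpace ℝ (Fin p))}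
    (hS : Convex ℝ S) (h : ∀ x ∈ S, ∀ u, 0 ≤ negHessForm (logLik m z) x u) :
    ConcaveOn ℝ S (logLik m z) := by
  have hl := contDiff_logLik (N := 3) hm z
  refine concaveOn_of_line hS (fun x u s => hasDerivAt_dirDeriv (k := 0) hl (by norm_num) x u s)
    (fun x u s => hasDerivAt_dirDeriv (k := 1) hl (by norm_num) x u s) fun x hx u => ?_
  have := h x hx u
  rw [negHessForm_eq hl (by norm_num)] at this
  linarith

lemma strongConcaveOn_objective (hm : ContDiff ℝ 3 m) {S : Set (EuclideanSpace ℝ (Fin p))}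
    (hS : Convex ℝ S) (h : ∀ x ∈ S, ∀ u, 0 ≤ negHessForm (logLik m z) x u)
    {G : EuclideanSpace ℝ (Fin p) →L[ℝ] EuclideanSpace ℝ (Fin p)} {μ : ℝ}
    (hμ : ∀ u, μ * ‖u‖ ^ 2 ≤ ‖G u‖ ^ 2) : StrongConcaveOn S μ (objective m z x₀ G) := by
  have hl := contDiff_logLik (N := 3) hm z
  rw [strongConcaveOn_iff_convex]
  -- The added square is written as a penalty with the identity operator and centre `0`, so that the
  -- derivative lemmas for the penalty apply to it too.
  have hF : (fun x => objective m z x₀ G x + μ / 2 * ‖x‖ ^ 2) = fun x =>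
      logLik m z x - ‖G (x - x₀)‖ ^ 2 / 2 +
        μ * (‖ContinuousLinearMap.id ℝ (EuclideanSpace ℝ (Fin p)) (x - 0)‖ ^ 2 / 2) := by
    funext x; simp [objective]; ring
  rw [hF]
  refine concaveOn_of_line hS
    (F₁ := fun x u => dirDeriv 1 (logLik m z) x u - inner ℝ (G (x - x₀)) (G u) + μ *
      inner ℝ (ContinuousLinearMap.id ℝ _ (x - 0)) (ContinuousLinearMap.id ℝ _ u))
    (F₂ := fun x u => dirDeriv 2 (logLik m z) x u - ‖G u‖ ^ 2 +
      μ * ‖ContinuousLinearMap.id ℝ _ u‖ ^ 2)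
    (fun x u s => ((hasDerivAt_dirDeriv (k := 0) hl (by norm_num) x u s).sub
      (hasDerivAt_penalty G x₀ x u s)).add ((hasDerivAt_penalty _ 0 x u s).const_mul μ))
    (fun x u s => ((hasDerivAt_dirDeriv (k := 1) hl (by norm_num) x u s).sub
      (hasDerivAt_inner_penalty G x₀ x u s)).add
      ((hasDerivAt_inner_penalty _ 0 x u s).const_mul μ)) fun x hx u => ?_
  have h1 := h x hx u
  rw [negHessForm_eq hl (by norm_num)] at h1
  have := hμ u
  simp only [ContinuousLinearMap.id_apply]
  linarith

lemma continuous_objective (hm : Continuous m) (z : EuclideanSpace ℝ (Fin n))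
    (x₀ : EuclideanSpace ℝ (Fin p)) (G : EuclideanSpace ℝ (Fin p) →L[ℝ] EuclideanSpace ℝ (Fin p)) :
    Continuous (objective m z x₀ G) := by
  unfold objective logLik
  fun_prop

lemma norm_sq_le_neg_objective (m : EuclideanSpace ℝ (Fin p) → EuclideanSpace ℝ (Fin n))
    (z : EuclideanSpace ℝ (Fin n)) (x₀ : EuclideanSpace ℝ (Fin p))
    (G : EuclideanSpace ℝ (Fin p) →L[ℝ] EuclideanSpace ℝ (Fin p)) (x : EuclideanSpace ℝ (Fin p)) :
    ‖G (x - x₀)‖ ^ 2 ≤ -2 * objective m z x₀ G x := by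
  unfold objective logLik
  nlinarith [sq_nonneg ‖m x - z‖]

lemma exists_isMaxOn_objective (hm : Continuous m)
    {G : EuclideanSpace ℝ (Fin p) →L[ℝ] EuclideanSpace ℝ (Fin p)} (hG : Function.Injective G) :
    ∃ xG, IsMaxOn (objective m z x₀ G) Set.univ xG := by
  obtain ⟨μ, hμ0, hμ⟩ := exists_pos_mul_norm_sq_le hG
  have hc := continuous_objective hm z x₀ G
  -- Coercivity: `‖G (x - x₀)‖² ≤ -2 f(x)` confines the superlevel set of `f(x₀)` to a compact ball.
  have hB : ∀ x, objective m z x₀ G x₀ ≤ objective m z x₀ G x →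
      x ∈ Metric.closedBall x₀ √(-2 * objective m z x₀ G x₀ / μ) := by
    intro x hx
    rw [Metric.mem_closedBall, dist_eq_norm]
    refine Real.le_sqrt_of_sq_le ?_
    rw [le_div_iff₀ hμ0]
    have := hμ (x - x₀)
    have := norm_sq_le_neg_objective m z x₀ G x
    linarith
  obtain ⟨xG, -, hmax⟩ := (isCompact_closedBall x₀ √(-2 * objective m z x₀ G x₀ / μ)).exists_isMaxOn
    ⟨x₀, hB x₀ le_rfl⟩ hc.continuousOn
  refine ⟨xG, fun x _ => ?_⟩
  by_cases h : objective m z x₀ G x₀ ≤ objective m z x₀ G x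
  · exact hmax (hB x h)
  · exact (not_le.1 h).le.trans (hmax (hB x₀ le_rfl))

lemma mem_priorSet_of_le_objective
    {G : EuclideanSpace ℝ (Fin p) →L[ℝ] EuclideanSpace ℝ (Fin p)}
    (hG₀ : ∀ u, breveSq m x₀ u ≤ n * ‖G u‖ ^ 2) {xs x : EuclideanSpace ℝ (Fin p)}
    (hxs : n * (‖G (xs - x₀)‖ ^ 2 + ‖m xs - z‖ ^ 2) ≤ r₀ ^ 2)
    (hx : objective m z x₀ G xs ≤ objective m z x₀ G x) : x ∈ priorSet m x₀ r₀ := by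
  have h1 := norm_sq_le_neg_objective m z x₀ G x
  have h2 : -2 * objective m z x₀ G xs = ‖G (xs - x₀)‖ ^ 2 + ‖m xs - z‖ ^ 2 := by
    unfold objective logLik; ring
  have h3 : (n : ℝ) * ‖G (x - x₀)‖ ^ 2 ≤ n * (‖G (xs - x₀)‖ ^ 2 + ‖m xs - z‖ ^ 2) := by
    gcongr; linarith
  exact (hG₀ _).trans (h3.trans hxs)

/-! ### Third and fourth directional derivatives of the log-likelihood -/

lemma abs_sum_mul_le {a b : Fin n → ℝ} (ha : ∀ i, |a i| ≤ 1) : |∑ i, a i * b i| ≤ ∑ i, |b i| := by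
  refine (Finset.abs_sum_le_sum_abs _ _).trans (Finset.sum_le_sum fun i _ => ?_)
  rw [abs_mul]
  exact mul_le_of_le_one_left (abs_nonneg _) (ha i)

/-- One of the three factors is bounded by `Cn / √n · ‖D̆(x) u‖`, and the remaining squares sum to
`‖D̆(x) u‖²`. This is the source of the rate `n^{-1/2}`. -/
lemma sum_abs_pow_three_le {S : Set (EuclideanSpace ℝ (Fin p))}
    {x u : EuclideanSpace ℝ (Fin p)} {C₂ Cn CG Y : ℝ} (hCn : 0 ≤ Cn)
    (hCG : 0 ≤ CG) (hx : x ∈ S) (hS2 : Smooth2On m S C₂ Cn)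
    (hb : breveSq m x u ≤ CG * Y) :
    ∑ i, |dirDeriv 1 (fun y => m y i) x u| ^ 3 ≤ CG ^ (3 / 2 : ℝ) * Cn / √n * (Y * √Y) := by
  have h32 : CG ^ (3 / 2 : ℝ) = CG * √CG := by
    rw [Real.sqrt_eq_rpow, show (3 / 2 : ℝ) = 1 + 1 / 2 by norm_num,
      Real.rpow_add_of_nonneg hCG (by norm_num) (by norm_num), Real.rpow_one]
  have hn : 0 ≤ Cn / √n := by positivity
  calc ∑ i, |dirDeriv 1 (fun y => m y i) x u| ^ 3
      ≤ ∑ i, Cn / √n * √(breveSq m x u) * dirDeriv 1 (fun y => m y i) x u ^ 2 := by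
        refine Finset.sum_le_sum fun i _ => ?_
        rw [pow_succ', sq_abs]
        exact mul_le_mul_of_nonneg_right ((hS2 x hx u).1 i) (sq_nonneg _)
    _ = Cn / √n * (√(breveSq m x u) * breveSq m x u) := by
        rw [← Finset.mul_sum, breveSq]; ring
    _ ≤ Cn / √n * (√(CG * Y) * (CG * Y)) := by
        have := breveSq_nonneg m x u
        gcongr
    _ = _ := by rw [Real.sqrt_mul hCG, h32]; ring

lemma sum_pow_four_le {S : Set (EuclideanSpace ℝ (Fin p))}
    {x u : EuclideanSpace ℝ (Fin p)} {C₂ Cn CG Y : ℝ}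
    (hx : x ∈ S) (hS2 : Smooth2On m S C₂ Cn) (hb : breveSq m x u ≤ CG * Y) :
    ∑ i, dirDeriv 1 (fun y => m y i) x u ^ 4 ≤ CG ^ 2 * Cn ^ 2 / n * Y ^ 2 := by
  have hβ := breveSq_nonneg m x u
  calc ∑ i, dirDeriv 1 (fun y => m y i) x u ^ 4
      ≤ ∑ i, (Cn / √n * √(breveSq m x u)) ^ 2 * dirDeriv 1 (fun y => m y i) x u ^ 2 := by
        refine Finset.sum_le_sum fun i _ => ?_
        rw [show dirDeriv 1 (fun y => m y i) x u ^ 4 = |dirDeriv 1 (fun y => m y i) x u| ^ 2 *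
          dirDeriv 1 (fun y => m y i) x u ^ 2 by rw [sq_abs]; ring]
        have := (hS2 x hx u).1 i
        gcongr
    _ = Cn ^ 2 / n * (breveSq m x u * breveSq m x u) := by
        rw [← Finset.mul_sum, mul_pow, Real.sq_sqrt hβ, div_pow, Real.sq_sqrt (Nat.cast_nonneg n),
          breveSq]
        ring
    _ ≤ Cn ^ 2 / n * ((CG * Y) * (CG * Y)) := by gcongr; exact hβ.trans hb
    _ = _ := by ring

lemma abs_dirDeriv_three_logLik_le (hm : ContDiff ℝ 3 m) {S V : Set (EuclideanSpace ℝ (Fin p))}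
    {x u : EuclideanSpace ℝ (Fin p)} {C₂ C₃ Cn CG Y : ℝ} (hCn : 0 ≤ Cn) (hC₃ : 0 ≤ C₃)
    (hCG : 0 ≤ CG) (hx : x ∈ S) (hxV : x ∈ V) (hz : ∀ i, |m x i - z i| ≤ 1)
    (hS2 : Smooth2On m S C₂ Cn) (hS3 : Smooth3On m V C₃) (hb : breveSq m x u ≤ CG * Y) :
    |dirDeriv 3 (logLik m z) x u| ≤ 4 * CG ^ (3 / 2 : ℝ) * C₃ * Cn / √n * (Y * √Y) := by
  rw [dirDeriv_logLik_three (N := 3) z x u hm le_rfl, abs_neg, Finset.sum_add_distrib,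
    ← Finset.mul_sum]
  have h1 := (hS3 x hxV u).1
  have h2 := (abs_sum_mul_le (b := fun i => dirDeriv 3 (fun y => m y i) x u) hz).trans
    (hS3 x hxV u).2
  have h3 := mul_le_mul_of_nonneg_left (sum_abs_pow_three_le hCn hCG hx hS2 hb) hC₃
  refine (abs_add_le _ _).trans ?_
  rw [abs_mul, abs_of_pos (by norm_num : (0 : ℝ) < 3)]
  -- `4 = 3 + 1`: three from the product term of the third derivative, one from the residual term.
  calc _ ≤ 4 * (C₃ * ∑ i, |dirDeriv 1 (fun y => m y i) x u| ^ 3) := by linarith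
    _ ≤ 4 * (C₃ * (CG ^ (3 / 2 : ℝ) * Cn / √n * (Y * √Y))) := by gcongr
    _ = _ := by ring

lemma abs_dirDeriv_four_logLik_le (hm : ContDiff ℝ 4 m) {S V : Set (EuclideanSpace ℝ (Fin p))}
    {x u : EuclideanSpace ℝ (Fin p)} {C₂ C₄ Cn CG Y : ℝ} (hC₄ : 0 ≤ C₄)
    (hx : x ∈ S) (hxV : x ∈ V) (hz : ∀ i, |m x i - z i| ≤ 1)
    (hS2 : Smooth2On m S C₂ Cn) (hS4 : Smooth4On m V C₄) (hb : breveSq m x u ≤ CG * Y) :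
    |dirDeriv 4 (logLik m z) x u| ≤ 8 * CG ^ 2 * C₄ * Cn ^ 2 / n * Y ^ 2 := by
  rw [dirDeriv_logLik_four (N := 4) z x u hm le_rfl, abs_neg, Finset.sum_add_distrib,
    Finset.sum_add_distrib, ← Finset.mul_sum, ← Finset.mul_sum]
  obtain ⟨h1, h2, h4⟩ := hS4 x hxV u
  have h4' := (abs_sum_mul_le (b := fun i => dirDeriv 4 (fun y => m y i) x u) hz).trans h4
  have h3 := mul_le_mul_of_nonneg_left (sum_pow_four_le hx hS2 hb) hC₄
  have h0 : 0 ≤ ∑ i, dirDeriv 2 (fun y => m y i) x u ^ 2 :=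
    Finset.sum_nonneg fun _ _ => sq_nonneg _
  refine (abs_add_le _ _).trans ((add_le_add_left (abs_add_le _ _) _).trans ?_)
  rw [abs_mul, abs_mul, abs_of_pos (by norm_num : (0 : ℝ) < 3),
    abs_of_pos (by norm_num : (0 : ℝ) < 4), abs_of_nonneg h0]
  -- `8 = 3 + 4 + 1`, from the three terms of the fourth derivative.
  calc _ ≤ 8 * (C₄ * ∑ i, dirDeriv 1 (fun y => m y i) x u ^ 4) := by linarith
    _ ≤ 8 * (C₄ * (CG ^ 2 * Cn ^ 2 / n * Y ^ 2)) := by gcongr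
    _ = _ := by ring

end Prior

/-! ### Simultaneous diagonalisation -/

section Diag

open Module

/-- `S = H^{-1/2}`, built as `h⁻¹ᐟ²` on an orthonormal eigenbasis of `H`. -/
lemma exists_inv_sqrt {H : EuclideanSpace ℝ (Fin p) →L[ℝ] EuclideanSpace ℝ (Fin p)}
    (hH : ∀ u v, inner ℝ (H u) v = inner ℝ u (H v)) (hpos : ∀ u, u ≠ 0 → 0 < inner ℝ (H u) u) :
    ∃ S : EuclideanSpace ℝ (Fin p) →L[ℝ] EuclideanSpace ℝ (Fin p),
      (∀ u v, inner ℝ (S u) v = inner ℝ u (S v)) ∧ (∀ u, S (H (S u)) = u) ∧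
      H.inverse = S.comp S := by
  have hsym : (H : EuclideanSpace ℝ (Fin p) →ₗ[ℝ] EuclideanSpace ℝ (Fin p)).IsSymmetric := hH
  have hfin : finrank ℝ (EuclideanSpace ℝ (Fin p)) = p := by simp
  set e := hsym.eigenvectorBasis hfin
  set h := hsym.eigenvalues hfin
  have he : ∀ i, H (e i) = h i • e i := fun i => hsym.apply_eigenvectorBasis hfin i
  have hpos' : ∀ i, 0 < h i := by
    intro i
    have := hpos (e i) (e.orthonormal.ne_zero i)
    rw [he, inner_smul_left, real_inner_self_eq_norm_sq, e.orthonormal.norm_eq_one] at this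
    simpa using this
  set S : EuclideanSpace ℝ (Fin p) →L[ℝ] EuclideanSpace ℝ (Fin p) :=
    ∑ i, (√(h i))⁻¹ • (innerSL ℝ (e i)).smulRight (e i) with hS
  have hSe : ∀ i, S (e i) = (√(h i))⁻¹ • e i := by
    intro i
    simp [hS, e.inner_eq_ite]
  have hc : ∀ i, (√(h i))⁻¹ * ((√(h i))⁻¹ * h i) = 1 := by
    intro i
    have h1 := Real.mul_self_sqrt (hpos' i).le
    have h2 := (Real.sqrt_pos.2 (hpos' i)).ne'
    field_simp
    rw [Real.sq_sqrt (hpos' i).le]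
  have hext : ∀ A : EuclideanSpace ℝ (Fin p) →L[ℝ] EuclideanSpace ℝ (Fin p),
      (∀ i, A (e i) = e i) → A = ContinuousLinearMap.id ℝ _ := by
    intro A hA
    refine ContinuousLinearMap.coe_injective (e.toBasis.ext fun i => ?_)
    simp [hA]
  refine ⟨S, fun u v => ?_, fun u => ?_, ?_⟩
  · simp only [hS, sum_apply, sum_inner, inner_sum]
    refine Finset.sum_congr rfl fun i _ => ?_
    simp only [smul_apply, ContinuousLinearMap.smulRight_apply, innerSL_apply_apply,
      inner_smul_left, inner_smul_right, RCLike.conj_to_real]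
    rw [real_inner_comm (e i) u]
    ring
  · have := hext (S.comp (H.comp S)) fun i => by
      simp only [ContinuousLinearMap.comp_apply, hSe, map_smul, he, smul_smul]
      rw [mul_right_comm, mul_assoc, hc, one_smul]
    exact congrArg (fun A : EuclideanSpace ℝ (Fin p) →L[ℝ] EuclideanSpace ℝ (Fin p) => A u) this
  · refine ContinuousLinearMap.inverse_eq (hext _ fun i => ?_) (hext _ fun i => ?_)
    · simp only [ContinuousLinearMap.comp_apply, hSe, map_smul, he, smul_smul]
      rw [mul_assoc, hc, one_smul]
    · simp only [ContinuousLinearMap.comp_apply, hSe, map_smul, he, smul_smul]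
      rw [mul_comm (h i), mul_assoc, hc, one_smul]

/-- With `S = H^{-1/2}`, the operator `S D S` is symmetric; composing `S` with coordinates in its
eigenbasis makes `H` the identity and `D` diagonal. The eigenvalues lie in `[0, 1]` because `0 ≤ D ≤
H`, and their sum is the trace of `D S S` by cyclicity. -/
lemma exists_simultaneous_diagonalization
    {D H : EuclideanSpace ℝ (Fin p) →L[ℝ] EuclideanSpace ℝ (Fin p)}
    (hD : ∀ u v, inner ℝ (D u) v = inner ℝ u (D v)) (hH : ∀ u v, inner ℝ (H u) v = inner ℝ u (H v))
    (hD0 : ∀ u, 0 ≤ inner ℝ (D u) u) (hDH : ∀ u, inner ℝ (D u) u ≤ inner ℝ (H u) u)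
    (hpos : ∀ u, u ≠ 0 → 0 < inner ℝ (H u) u) :
    ∃ (Φ : EuclideanSpace ℝ (Fin p) →ₗ[ℝ] EuclideanSpace ℝ (Fin p)) (lam : Fin p → ℝ),
      (∀ v, inner ℝ (H (Φ v)) (Φ v) = ∑ i, v i ^ 2) ∧
      (∀ v, inner ℝ (D (Φ v)) (Φ v) = ∑ i, lam i * v i ^ 2) ∧
      (∀ i, 0 ≤ lam i) ∧ (∀ i, lam i ≤ 1) ∧
      ∑ i, lam i = LinearMap.trace ℝ (EuclideanSpace ℝ (Fin p))
        ((D.comp H.inverse : EuclideanSpace ℝ (Fin p) →L[ℝ] EuclideanSpace ℝ (Fin p)) :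
          EuclideanSpace ℝ (Fin p) →ₗ[ℝ] EuclideanSpace ℝ (Fin p)) := by
  obtain ⟨S, hS, hSHS, hinv⟩ := exists_inv_sqrt hH hpos
  set T : EuclideanSpace ℝ (Fin p) →ₗ[ℝ] EuclideanSpace ℝ (Fin p) :=
    (S : EuclideanSpace ℝ (Fin p) →ₗ[ℝ] EuclideanSpace ℝ (Fin p)) * (D.comp S :
      EuclideanSpace ℝ (Fin p) →L[ℝ] EuclideanSpace ℝ (Fin p)) with hT
  have hTapp : ∀ u, T u = S (D (S u)) := fun u => rfl
  have hsym : T.IsSymmetric := by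
    intro u v
    rw [hTapp, hTapp, hS, hD, hS]
  have hfin : finrank ℝ (EuclideanSpace ℝ (Fin p)) = p := by simp
  set w := hsym.eigenvectorBasis hfin
  set lam := hsym.eigenvalues hfin
  have hw : ∀ i, T (w i) = lam i • w i := fun i => hsym.apply_eigenvectorBasis hfin i
  have hlam : ∀ i, lam i = inner ℝ (D (S (w i))) (S (w i)) := by
    intro i
    rw [← hS, ← hTapp, hw, inner_smul_left, real_inner_self_eq_norm_sq,
      w.orthonormal.norm_eq_one]
    simp
  refine ⟨(S : EuclideanSpace ℝ (Fin p) →ₗ[ℝ] EuclideanSpace ℝ (Fin p)) ∘ₗ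
    (w.repr.symm.toLinearEquiv : EuclideanSpace ℝ (Fin p) →ₗ[ℝ] EuclideanSpace ℝ (Fin p)), lam,
    fun v => ?_, fun v => ?_, fun i => ?_, fun i => ?_, ?_⟩
  · change inner ℝ (H (S (w.repr.symm v))) (S (w.repr.symm v)) = _
    rw [← hS, hSHS, real_inner_self_eq_norm_sq, LinearIsometryEquiv.norm_map,
      EuclideanSpace.real_norm_sq_eq]
  · change inner ℝ (D (S (w.repr.symm v))) (S (w.repr.symm v)) = _
    rw [← hS, ← hTapp, ← w.repr.inner_map_map, PiLp.inner_apply]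
    refine Finset.sum_congr rfl fun i _ => ?_
    rw [hsym.eigenvectorBasis_apply_self_apply hfin]
    simp [w, lam]
    ring
  · rw [hlam]; exact hD0 _
  · rw [hlam]
    refine (hDH _).trans_eq ?_
    rw [← hS, hSHS, real_inner_self_eq_norm_sq, w.orthonormal.norm_eq_one, one_pow]
  · rw [hinv]
    have h1 : ((D.comp (S.comp S) : EuclideanSpace ℝ (Fin p) →L[ℝ] EuclideanSpace ℝ (Fin p)) :
        EuclideanSpace ℝ (Fin p) →ₗ[ℝ] EuclideanSpace ℝ (Fin p)) =
        ((D.comp S : EuclideanSpace ℝ (Fin p) →L[ℝ] EuclideanSpace ℝ (Fin p)) :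
          EuclideanSpace ℝ (Fin p) →ₗ[ℝ] EuclideanSpace ℝ (Fin p)) *
        (S : EuclideanSpace ℝ (Fin p) →ₗ[ℝ] EuclideanSpace ℝ (Fin p)) := rfl
    rw [h1, LinearMap.trace_mul_comm, ← hT, hsym.trace_eq_sum_eigenvalues hfin]
    simp [lam]

end Diag

/-! ### Gaussian integrals -/

section Gauss

lemma gaussian_integral_diag {a : Fin p → ℝ} (ha : ∀ i, 0 < a i) :
    Integrable (fun v : EuclideanSpace ℝ (Fin p) => Real.exp (-(∑ i, a i * v i ^ 2) / 2)) ∧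
    ∫ v : EuclideanSpace ℝ (Fin p), Real.exp (-(∑ i, a i * v i ^ 2) / 2) =
      ∏ i, √(2 * Real.pi / a i) := by
  have hmp := PiLp.volume_preserving_toLp (Fin p)
  have hemb : MeasurableEmbedding (WithLp.toLp 2 : (Fin p → ℝ) → EuclideanSpace ℝ (Fin p)) :=
    (MeasurableEquiv.toLp 2 (Fin p → ℝ)).measurableEmbedding
  have hprod : ∀ v : Fin p → ℝ, Real.exp (-(∑ i, a i * (WithLp.toLp 2 v : EuclideanSpace ℝ (Fin p)) i ^ 2) / 2) =
      ∏ i, Real.exp (-(a i / 2) * v i ^ 2) := by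
    intro v
    rw [← Real.exp_sum]
    congr 1
    rw [neg_div, Finset.sum_div, ← Finset.sum_neg_distrib]
    refine Finset.sum_congr rfl fun i _ => ?_
    simp; ring
  constructor
  · rw [← hmp.integrable_comp_emb hemb]
    simp only [Function.comp_def, hprod]
    exact Integrable.fintype_prod (f := fun i (t : ℝ) => Real.exp (-(a i / 2) * t ^ 2))
      fun i => integrable_exp_neg_mul_sq (half_pos (ha i))
  · rw [← hmp.integral_comp hemb]
    simp only [hprod]
    rw [integral_fintype_prod_volume_eq_prod (fun i (t : ℝ) => Real.exp (-(a i / 2) * t ^ 2))]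
    refine Finset.prod_congr rfl fun i _ => ?_
    rw [integral_gaussian]
    congr 1
    have := (ha i).ne'
    field_simp

/-- The value of `c` is left unspecified because it cancels in every normalised integral. -/
lemma integral_comp_linearMap {Φ : EuclideanSpace ℝ (Fin p) →ₗ[ℝ] EuclideanSpace ℝ (Fin p)}
    (hΦ : Function.Injective Φ) : ∃ c : ℝ, 0 < c ∧ ∀ F : EuclideanSpace ℝ (Fin p) → ℝ,
      (Integrable (fun v => F (Φ v)) ↔ Integrable F) ∧ ∫ v, F (Φ v) = c * ∫ u, F u := by
  have hdet : LinearMap.det Φ ≠ 0 := by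
    have := (LinearEquiv.ofInjectiveEndo Φ hΦ).isUnit_det'
    exact this.ne_zero
  have hmap := Measure.map_linearMap_addHaar_eq_smul_addHaar
    (volume : Measure (EuclideanSpace ℝ (Fin p))) hdet
  have hemb : MeasurableEmbedding Φ :=
    ((LinearEquiv.ofInjectiveEndo Φ hΦ).toContinuousLinearEquiv.toHomeomorph).measurableEmbedding
  have hc : 0 < |(LinearMap.det Φ)⁻¹| := abs_pos.2 (inv_ne_zero hdet)
  refine ⟨|(LinearMap.det Φ)⁻¹|, hc, fun F => ⟨?_, ?_⟩⟩
  · have := hemb.integrable_map_iff (μ := (volume : Measure (EuclideanSpace ℝ (Fin p)))) (g := F)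
    rw [hmap, integrable_smul_measure (by simpa using hdet) ENNReal.ofReal_ne_top] at this
    exact this.symm
  · have := hemb.integral_map (μ := (volume : Measure (EuclideanSpace ℝ (Fin p)))) F
    rw [hmap, integral_smul_measure, ENNReal.toReal_ofReal hc.le] at this
    exact this.symm

/-- `Y` has the moment generating function of `∑ᵢ lamᵢ ξᵢ²` with independent standard normal
`ξᵢ` and weights `lamᵢ ∈ [0, 1]`. -/
structure IsWeightedChiSq {Ω : Type*} [MeasurableSpace Ω] (μ : Measure Ω) (Y : Ω → ℝ)
    (lam : Fin p → ℝ) : Prop where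
  measurable : Measurable Y
  nonneg : ∀ ω, 0 ≤ Y ω
  lam_nonneg : ∀ i, 0 ≤ lam i
  lam_le_one : ∀ i, lam i ≤ 1
  integrable : ∀ s < 1, Integrable (fun ω => Real.exp (s * (Y ω / 2))) μ
  integral_eq : ∀ s < 1, ∫ ω, Real.exp (s * (Y ω / 2)) ∂μ = ∏ i, (√(1 - s * lam i))⁻¹

lemma gibbs_eq (g : EuclideanSpace ℝ (Fin p) → ℝ) :
    gibbs g = (∫⁻ x, ENNReal.ofReal (Real.exp (g x)))⁻¹ •
      volume.withDensity fun x => ENNReal.ofReal (Real.exp (g x)) := by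
  rw [gibbs, ProbabilityTheory.cond, Measure.restrict_univ, withDensity_apply _ MeasurableSet.univ,
    Measure.restrict_univ]

variable {g : EuclideanSpace ℝ (Fin p) → ℝ}

lemma lintegral_exp_eq (hg : Integrable fun x => Real.exp (g x)) :
    ∫⁻ x, ENNReal.ofReal (Real.exp (g x)) = ENNReal.ofReal (∫ x, Real.exp (g x)) :=
  (ofReal_integral_eq_lintegral_ofReal hg (.of_forall fun _ => (Real.exp_pos _).le)).symm

lemma isProbabilityMeasure_gibbs (hg : Integrable fun x => Real.exp (g x)) :
    IsProbabilityMeasure (gibbs g) := by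
  have h := lintegral_exp_eq hg
  have hp := integral_exp_pos hg
  constructor
  rw [gibbs_eq, Measure.smul_apply, withDensity_apply _ MeasurableSet.univ, Measure.restrict_univ,
    smul_eq_mul]
  refine ENNReal.inv_mul_cancel ?_ ?_ <;> rw [h]
  · simpa using hp
  · exact ENNReal.ofReal_ne_top

lemma integrable_gibbs_iff (hgm : Measurable g) (hg : Integrable fun x => Real.exp (g x))
    (F : EuclideanSpace ℝ (Fin p) → ℝ) :
    Integrable F (gibbs g) ↔ Integrable fun x => Real.exp (g x) * F x := by
  have h := lintegral_exp_eq hg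
  have hp := integral_exp_pos hg
  rw [gibbs_eq, integrable_smul_measure (by rw [h]; simp) (by rw [h]; simpa using hp),
    integrable_withDensity_iff_integrable_smul' (by fun_prop) (by simp)]
  simp [ENNReal.toReal_ofReal (Real.exp_pos _).le]

lemma integral_gibbs (hgm : Measurable g) (hg : Integrable fun x => Real.exp (g x))
    (F : EuclideanSpace ℝ (Fin p) → ℝ) :
    ∫ x, F x ∂(gibbs g) = (∫ x, Real.exp (g x))⁻¹ * ∫ x, Real.exp (g x) * F x := by
  have h := lintegral_exp_eq hg
  have hp := integral_exp_pos hg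
  rw [gibbs_eq, integral_smul_measure, h, ENNReal.toReal_inv, ENNReal.toReal_ofReal hp.le,
    integral_withDensity_eq_integral_toReal_smul (by fun_prop) (by simp)]
  simp [ENNReal.toReal_ofReal (Real.exp_pos _).le]

lemma isWeightedChiSq_gibbs
    {D H : EuclideanSpace ℝ (Fin p) →L[ℝ] EuclideanSpace ℝ (Fin p)}
    (hD : ∀ u v, inner ℝ (D u) v = inner ℝ u (D v)) (hH : ∀ u v, inner ℝ (H u) v = inner ℝ u (H v))
    (hD0 : ∀ u, 0 ≤ inner ℝ (D u) u) (hDH : ∀ u, inner ℝ (D u) u ≤ inner ℝ (H u) u)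
    (hpos : ∀ u, u ≠ 0 → 0 < inner ℝ (H u) u) :
    Integrable (fun u => Real.exp (-(inner ℝ (H u) u / 2))) ∧
    ∃ lam : Fin p → ℝ, ∑ i, lam i = LinearMap.trace ℝ (EuclideanSpace ℝ (Fin p))
        ((D.comp H.inverse : EuclideanSpace ℝ (Fin p) →L[ℝ] EuclideanSpace ℝ (Fin p)) :
          EuclideanSpace ℝ (Fin p) →ₗ[ℝ] EuclideanSpace ℝ (Fin p)) ∧
      IsWeightedChiSq (gibbs fun u => -(inner ℝ (H u) u / 2)) (fun u => inner ℝ (D u) u) lam := by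
  obtain ⟨Φ, lam, hΦH, hΦD, hl0, hl1, htr⟩ :=
    exists_simultaneous_diagonalization hD hH hD0 hDH hpos
  have hinj : Function.Injective Φ := by
    rw [← LinearMap.ker_eq_bot, LinearMap.ker_eq_bot']
    intro v hv
    have h := hΦH v
    rw [hv, map_zero, inner_zero_left, ← EuclideanSpace.real_norm_sq_eq] at h
    simpa using h.symm
  obtain ⟨c, hc, hcv⟩ := integral_comp_linearMap hinj
  have key : ∀ s < 1, ∀ v, Real.exp (-(inner ℝ (H (Φ v)) (Φ v) / 2)) *
      Real.exp (s * (inner ℝ (D (Φ v)) (Φ v) / 2)) =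
      Real.exp (-(∑ i, (1 - s * lam i) * v i ^ 2) / 2) := by
    intro s _ v
    rw [← Real.exp_add, hΦH, hΦD]
    congr 1
    simp only [sub_mul, one_mul, Finset.sum_sub_distrib, mul_assoc, ← Finset.mul_sum]
    ring
  -- Weights in `[0, 1]` keep the tilted Gaussian integrable for every `s < 1`; the case `s = 0`
  -- supplies the normalising constant.
  have hspos : ∀ s < 1, ∀ i, 0 < 1 - s * lam i := by
    intro s hs i
    have := hl0 i; have := hl1 i
    rcases le_or_gt s 0 with h | h
    · nlinarith
    · nlinarith
  have hint : ∀ s < 1, Integrable fun u => Real.exp (-(inner ℝ (H u) u / 2)) *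
      Real.exp (s * (inner ℝ (D u) u / 2)) := by
    intro s hs
    rw [← (hcv _).1]
    simp only [key s hs]
    exact (gaussian_integral_diag (hspos s hs)).1
  have hval : ∀ s < 1, c * ∫ u, Real.exp (-(inner ℝ (H u) u / 2)) *
      Real.exp (s * (inner ℝ (D u) u / 2)) = ∏ i, √(2 * Real.pi / (1 - s * lam i)) := by
    intro s hs
    rw [← (hcv _).2]
    simp only [key s hs]
    exact (gaussian_integral_diag (hspos s hs)).2
  have h0 : Integrable (fun u => Real.exp (-(inner ℝ (H u) u / 2))) := by
    simpa using hint 0 one_pos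
  have hv0 := hval 0 one_pos
  simp only [zero_mul, Real.exp_zero, mul_one, sub_zero, div_one] at hv0
  refine ⟨h0, lam, htr, ⟨by fun_prop, hD0, hl0, hl1, fun s hs => ?_, fun s hs => ?_⟩⟩
  · rw [integrable_gibbs_iff (by fun_prop) h0]
    exact hint s hs
  · rw [integral_gibbs (by fun_prop) h0]
    have hp := integral_exp_pos h0
    have hs := hval s hs
    have e : ∀ i, √(2 * Real.pi / (1 - s * lam i)) = √(2 * Real.pi) * (√(1 - s * lam i))⁻¹ := by
      intro i
      rw [Real.sqrt_div (by positivity), div_eq_mul_inv]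
    simp only [e, Finset.prod_mul_distrib, ← hv0] at hs
    rw [inv_mul_eq_iff_eq_mul₀ hp.ne']
    refine mul_left_cancel₀ hc.ne' ?_
    rw [hs]; ring

end Gauss

/-! ### Moments and exponential moments of weighted chi-square variables -/

section ChiSq

variable {Ω : Type*} [MeasurableSpace Ω] {μ : Measure Ω} {Y : Ω → ℝ} {lam : Fin p → ℝ}

lemma one_sub_mul_pos {s l : ℝ} (hs : s < 1) (h0 : 0 ≤ l) (h1 : l ≤ 1) : 0 < 1 - s * l := by
  rcases le_or_gt s 0 with h | h <;> nlinarith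

/-- From `v ≤ exp (v - 1)` at `v = (1 - s l)⁻¹`; replacing `1 - s l` by `1 - s` then costs `l s² (1
- l) ≥ 0`. The sign of `s` is free, as negative `s` occurs in the Gaussian mixture below. -/
lemma inv_sqrt_one_sub_le {s l : ℝ} (hs : s < 1) (h0 : 0 ≤ l) (h1 : l ≤ 1) :
    (√(1 - s * l))⁻¹ ≤ Real.exp (l * s / (2 * (1 - s))) := by
  have hp := one_sub_mul_pos hs h0 h1
  have hs' : 0 < 1 - s := by linarith
  have h2 : (1 - s * l)⁻¹ ≤ Real.exp (l * s / (1 - s)) := by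
    have e1 := Real.add_one_le_exp ((1 - s * l)⁻¹ - 1)
    refine (by linarith : (1 - s * l)⁻¹ ≤ _).trans (e1.trans (Real.exp_le_exp.2 ?_))
    have e2 : (1 - s * l)⁻¹ - 1 = l * s / (1 - s * l) := by field_simp; ring
    rw [e2, div_le_div_iff₀ hp hs']
    nlinarith [mul_nonneg (mul_nonneg h0 (sq_nonneg s)) (sub_nonneg.2 h1)]
  rw [← Real.sqrt_inv, show l * s / (2 * (1 - s)) = l * s / (1 - s) / 2 by
    field_simp, Real.exp_half]
  exact Real.sqrt_le_sqrt h2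

lemma IsWeightedChiSq.integral_exp_le (h : IsWeightedChiSq μ Y lam) {s : ℝ} (hs : s < 1) :
    ∫ ω, Real.exp (s * (Y ω / 2)) ∂μ ≤ Real.exp ((∑ i, lam i) * s / (2 * (1 - s))) := by
  rw [h.integral_eq s hs, Finset.sum_mul, Finset.sum_div, Real.exp_sum]
  exact Finset.prod_le_prod (fun i _ => by positivity)
    fun i _ => inv_sqrt_one_sub_le hs (h.lam_nonneg i) (h.lam_le_one i)

lemma IsWeightedChiSq.mem_interior (h : IsWeightedChiSq μ Y lam) {s : ℝ} (hs : s < 1) :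
    s ∈ interior (integrableExpSet (fun ω => Y ω / 2) μ) :=
  interior_maximal (s := integrableExpSet (fun ω => Y ω / 2) μ) (fun s hs => h.integrable s hs)
    isOpen_Iio hs

lemma IsWeightedChiSq.integrable_pow (h : IsWeightedChiSq μ Y lam) {s : ℝ} (hs : s < 1) (k : ℕ) :
    Integrable (fun ω => Y ω ^ k * Real.exp (s * (Y ω / 2))) μ := by
  have := (integrable_pow_mul_exp_of_mem_interior_integrableExpSet (h.mem_interior hs) k).const_mul
    (2 ^ k)
  refine this.congr (.of_forall fun ω => ?_)
  simp only [div_pow]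
  field_simp

/-- The power sums `∑ᵢ (lamᵢ / (1 - s lamᵢ))ᵏ`. -/
noncomputable def tiltedSum (lam : Fin p → ℝ) (k : ℕ) (s : ℝ) : ℝ := ∑ i, (lam i / (1 - s * lam i)) ^ k

lemma hasDerivAt_tiltedSum {s : ℝ} (hs : ∀ i, 1 - s * lam i ≠ 0) (k : ℕ) :
    HasDerivAt (tiltedSum lam k) (k * tiltedSum lam (k + 1) s) s := by
  have h : ∀ i ∈ Finset.univ, HasDerivAt (fun s => (lam i / (1 - s * lam i)) ^ k)
      (k * (lam i / (1 - s * lam i)) ^ (k + 1)) s := by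
    intro i _
    have h1 := (((hasDerivAt_const s (lam i)).fun_div
      (((hasDerivAt_id s).mul_const (lam i)).const_sub 1) (hs i))).fun_pow k
    refine h1.congr_deriv ?_
    have := hs i
    rcases k with _ | k
    · simp
    · simp only [id, Nat.add_sub_cancel]
      simp only [div_pow]
      field_simp
      ring
  refine (HasDerivAt.fun_sum h).congr_deriv ?_
  rw [tiltedSum, Finset.mul_sum]

lemma hasDerivAt_prod_inv_sqrt {s : ℝ} (hs : ∀ i, 0 < 1 - s * lam i) :
    HasDerivAt (fun s => ∏ i, (√(1 - s * lam i))⁻¹)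
      (tiltedSum lam 1 s / 2 * ∏ i, (√(1 - s * lam i))⁻¹) s := by
  have h : ∀ i ∈ Finset.univ, HasDerivAt (fun s => (√(1 - s * lam i))⁻¹)
      (lam i / (1 - s * lam i) / 2 * (√(1 - s * lam i))⁻¹) s := by
    intro i _
    have hi := Real.sqrt_pos.2 (hs i)
    have h1 := ((((hasDerivAt_id s).mul_const (lam i)).const_sub 1).sqrt (hs i).ne').fun_inv hi.ne'
    refine h1.congr_deriv ?_
    have h2 := Real.sq_sqrt (hs i).le
    simp only [id]
    rw [h2]
    have := (hs i).ne'
    field_simp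
  refine (HasDerivAt.fun_finsetProd h).congr_deriv ?_
  rw [tiltedSum, Finset.sum_div, Finset.sum_mul]
  refine Finset.sum_congr rfl fun i _ => ?_
  rw [smul_eq_mul, ← Finset.prod_erase_mul _ _ (Finset.mem_univ i)]
  simp only [pow_one]
  ring

/-- Tilted moments are derivatives in `s` of the moment generating function `M`. Since `M' = T₁ M /
2` and `Tₖ' = k Tₖ₊₁` for the power sums `Tₖ` of `tiltedSum`, each is a polynomial in the `Tₖ` times
`M`. -/
lemma IsWeightedChiSq.integral_pow_eq (h : IsWeightedChiSq μ Y lam) {s : ℝ} (hs : s < 1) :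
    (∫ ω, Y ω * Real.exp (s * (Y ω / 2)) ∂μ
      = tiltedSum lam 1 s * ∏ i, (√(1 - s * lam i))⁻¹) ∧
    (∫ ω, Y ω ^ 2 * Real.exp (s * (Y ω / 2)) ∂μ
      = (tiltedSum lam 1 s ^ 2 + 2 * tiltedSum lam 2 s) * ∏ i, (√(1 - s * lam i))⁻¹) ∧
    (∫ ω, Y ω ^ 3 * Real.exp (s * (Y ω / 2)) ∂μ
      = (tiltedSum lam 1 s ^ 3 + 6 * (tiltedSum lam 1 s * tiltedSum lam 2 s)
        + 8 * tiltedSum lam 3 s) * ∏ i, (√(1 - s * lam i))⁻¹) := by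
  set M : ℝ → ℝ := fun s => ∏ i, (√(1 - s * lam i))⁻¹ with hM
  have hpos : ∀ s < 1, ∀ i, 0 < 1 - s * lam i := fun s hs i =>
    one_sub_mul_pos hs (h.lam_nonneg i) (h.lam_le_one i)
  have step : ∀ (k : ℕ) (F : ℝ → ℝ) (c : ℝ) (s : ℝ), s < 1 →
      (∀ s < 1, ∫ ω, (Y ω / 2) ^ k * Real.exp (s * (Y ω / 2)) ∂μ = F s) → HasDerivAt F c s →
      ∫ ω, (Y ω / 2) ^ (k + 1) * Real.exp (s * (Y ω / 2)) ∂μ = c := by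
    intro k F c s hs hF hd
    refine (hasDerivAt_integral_pow_mul_exp_real (h.mem_interior hs) k).unique
      (hd.congr_of_eventuallyEq ?_)
    filter_upwards [Iio_mem_nhds hs] with t ht using hF t ht
  have hne : ∀ s < 1, ∀ i, 1 - s * lam i ≠ 0 := fun s hs i => (hpos s hs i).ne'
  have e0 : ∀ s < 1, ∫ ω, (Y ω / 2) ^ 0 * Real.exp (s * (Y ω / 2)) ∂μ = M s := fun s hs => by
    simp only [pow_zero, one_mul]
    exact h.integral_eq s hs
  have dM : ∀ s < 1, HasDerivAt M (tiltedSum lam 1 s / 2 * M s) s := fun s hs =>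
    hasDerivAt_prod_inv_sqrt (hpos s hs)
  have e1 := fun s hs => step 0 M _ s hs e0 (dM s hs)
  have d1 := fun s hs => ((hasDerivAt_tiltedSum (hne s hs) 1).div_const 2).fun_mul (dM s hs)
  have e2 := fun s hs => step 1 _ _ s hs e1 (d1 s hs)
  have d2 := fun s hs => ((((hasDerivAt_tiltedSum (hne s hs) 2).const_mul (1 / 2)).fun_add
    (((hasDerivAt_tiltedSum (hne s hs) 1).fun_pow 2).const_mul (1 / 4)))).fun_mul (dM s hs)
  have e2' : ∀ s < 1, ∫ ω, (Y ω / 2) ^ 2 * Real.exp (s * (Y ω / 2)) ∂μ =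
      (1 / 2 * tiltedSum lam 2 s + 1 / 4 * tiltedSum lam 1 s ^ 2) * M s := fun s hs => by
    rw [e2 s hs]; push_cast; ring
  have e3 := fun s hs => step 2 _ _ s hs e2' (d2 s hs)
  have conv : ∀ k : ℕ, ∫ ω, Y ω ^ k * Real.exp (s * (Y ω / 2)) ∂μ =
      2 ^ k * ∫ ω, (Y ω / 2) ^ k * Real.exp (s * (Y ω / 2)) ∂μ := by
    intro k
    rw [← integral_const_mul]
    congr 1; funext ω
    rw [div_pow]; field_simp
  refine ⟨?_, ?_, ?_⟩
  · have := conv 1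
    simp only [pow_one] at this
    have e := e1 s hs
    simp only [zero_add, pow_one] at e
    rw [this, e]; ring
  · rw [conv, e2' s hs]; ring
  · rw [conv, e3 s hs]; push_cast; ring

lemma exp_four_ninths_le : Real.exp (4 / 9) ≤ 8 / 5 := by
  have h1 : Real.exp (4 / 9) ^ 9 = Real.exp 1 ^ 4 := by
    rw [← Real.exp_nat_mul, ← Real.exp_nat_mul]; norm_num
  have h2 : Real.exp 1 ^ 4 ≤ 2.7182818286 ^ 4 := by
    gcongr; exact Real.exp_one_lt_d9.le
  refine le_of_pow_le_pow_left₀ (n := 9) (by norm_num) (by norm_num) ?_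
  rw [h1]
  exact h2.trans (by norm_num)

/-- For `s ≤ 1/4` and `s P ≤ 2/3` the tilt costs a factor `4/3` per power of `Y`, since `1 - s lamᵢ
≥ 3/4`, and `M ≤ exp (4/9) ≤ 8/5`. What remains are the chi-square moments `P`, `P (P + 2)`, `P (P +
2) (P + 4)`. -/
lemma IsWeightedChiSq.integral_pow_le (h : IsWeightedChiSq μ Y lam) {s : ℝ}
    (hs : s ≤ 1 / 4) (hsP : s * ∑ i, lam i ≤ 2 / 3) :
    (∫ ω, Y ω * Real.exp (s * (Y ω / 2)) ∂μ ≤ 32 / 15 * ∑ i, lam i) ∧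
    (∫ ω, Y ω ^ 2 * Real.exp (s * (Y ω / 2)) ∂μ
      ≤ 128 / 45 * ((∑ i, lam i) * (∑ i, lam i + 2))) ∧
    (∫ ω, Y ω ^ 3 * Real.exp (s * (Y ω / 2)) ∂μ
      ≤ 512 / 135 * ((∑ i, lam i) * (∑ i, lam i + 2) * (∑ i, lam i + 4))) := by
  have hs1 : s < 1 := by linarith
  obtain ⟨e1, e2, e3⟩ := h.integral_pow_eq hs1
  set P := ∑ i, lam i with hP
  have hP0 : 0 ≤ P := Finset.sum_nonneg fun i _ => h.lam_nonneg i
  set M := ∏ i, (√(1 - s * lam i))⁻¹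
  have hM0 : 0 ≤ M := Finset.prod_nonneg fun i _ => by positivity
  have hM : M ≤ 8 / 5 := by
    have h1 := h.integral_exp_le hs1
    rw [h.integral_eq s hs1] at h1
    refine h1.trans ((Real.exp_le_exp.2 ?_).trans exp_four_ninths_le)
    rw [div_le_div_iff₀ (by linarith) (by norm_num)]
    nlinarith
  have hq0 : ∀ i, 0 ≤ lam i / (1 - s * lam i) := fun i =>
    div_nonneg (h.lam_nonneg i) (one_sub_mul_pos hs1 (h.lam_nonneg i) (h.lam_le_one i)).le
  have hq : ∀ i, lam i / (1 - s * lam i) ≤ 4 / 3 * lam i := by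
    intro i
    have h0 := h.lam_nonneg i
    have h1 := h.lam_le_one i
    rw [div_le_iff₀ (one_sub_mul_pos hs1 h0 h1)]
    nlinarith [mul_nonneg h0 h0]
  have hq1 : ∀ i, lam i / (1 - s * lam i) ≤ 4 / 3 := fun i =>
    (hq i).trans (by linarith [h.lam_le_one i])
  have t1 : tiltedSum lam 1 s ≤ 4 / 3 * P := by
    rw [tiltedSum, hP, Finset.mul_sum]
    exact Finset.sum_le_sum fun i _ => by simpa using hq i
  have t10 : 0 ≤ tiltedSum lam 1 s := Finset.sum_nonneg fun i _ => pow_nonneg (hq0 i) _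
  have t20 : 0 ≤ tiltedSum lam 2 s := Finset.sum_nonneg fun i _ => pow_nonneg (hq0 i) _
  have tsucc : ∀ k, tiltedSum lam (k + 1) s ≤ 4 / 3 * tiltedSum lam k s := by
    intro k
    rw [tiltedSum, tiltedSum, Finset.mul_sum]
    refine Finset.sum_le_sum fun i _ => ?_
    rw [pow_succ']
    exact mul_le_mul_of_nonneg_right (hq1 i) (pow_nonneg (hq0 i) _)
  have t2 : tiltedSum lam 2 s ≤ 16 / 9 * P := by linarith [tsucc 1]
  have t3 : tiltedSum lam 3 s ≤ 64 / 27 * P := by linarith [tsucc 2]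
  refine ⟨?_, ?_, ?_⟩
  · rw [e1]
    calc _ ≤ 4 / 3 * P * (8 / 5) := by gcongr
      _ = _ := by ring
  · rw [e2]
    calc _ ≤ ((4 / 3 * P) ^ 2 + 2 * (16 / 9 * P)) * (8 / 5) := by gcongr
      _ = _ := by ring
  · rw [e3]
    calc _ ≤ ((4 / 3 * P) ^ 3 + 6 * ((4 / 3 * P) * (16 / 9 * P)) + 8 * (64 / 27 * P)) * (8 / 5) := by
          gcongr
      _ = _ := by ring

lemma IsWeightedChiSq.integral_sq_le (h : IsWeightedChiSq μ Y lam) {s : ℝ}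
    (hs : s ≤ 1 / 4) (hsP : s * ∑ i, lam i ≤ 2 / 3) :
    ∫ ω, Y ω ^ 2 * Real.exp (s * (Y ω / 2)) ∂μ ≤ 3 * (∑ i, lam i + 1) ^ 2 := by
  have hP0 : 0 ≤ ∑ i, lam i := Finset.sum_nonneg fun i _ => h.lam_nonneg i
  refine (h.integral_pow_le hs hsP).2.1.trans ?_
  nlinarith

lemma IsWeightedChiSq.integral_cube_le (h : IsWeightedChiSq μ Y lam) {s : ℝ}
    (hs : s ≤ 1 / 4) (hsP : s * ∑ i, lam i ≤ 2 / 3) :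
    ∫ ω, Y ω ^ 3 * Real.exp (s * (Y ω / 2)) ∂μ ≤ 4 * (∑ i, lam i + 2) ^ 3 := by
  have hP0 : 0 ≤ ∑ i, lam i := Finset.sum_nonneg fun i _ => h.lam_nonneg i
  refine (h.integral_pow_le hs hsP).2.2.trans ?_
  nlinarith [mul_nonneg hP0 hP0, mul_nonneg (mul_nonneg hP0 hP0) hP0]

lemma IsWeightedChiSq.integral_mul_sqrt_le (h : IsWeightedChiSq μ Y lam) {s : ℝ}
    (hs : s ≤ 1 / 4) (hsP : s * ∑ i, lam i ≤ 2 / 3) :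
    Integrable (fun ω => Y ω * √(Y ω) * Real.exp (s * (Y ω / 2))) μ ∧
    ∫ ω, Y ω * √(Y ω) * Real.exp (s * (Y ω / 2)) ∂μ ≤ 3 * √((∑ i, lam i + 1) ^ 3) := by
  obtain ⟨e1, e2, -⟩ := h.integral_pow_le hs hsP
  have hP0 : 0 ≤ ∑ i, lam i := Finset.sum_nonneg fun i _ => h.lam_nonneg i
  set P := ∑ i, lam i
  have hs1 : s < 1 := by linarith
  set q := √(P + 1) with hq
  have hq0 : 0 < q := Real.sqrt_pos.2 (by linarith)
  have hq2 : q ^ 2 = P + 1 := Real.sq_sqrt (by linarith)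
  have hq3 : √((P + 1) ^ 3) = q ^ 3 := by
    rw [← hq2, ← pow_mul, mul_comm, pow_mul, Real.sqrt_sq (by positivity)]
  have i1 := h.integrable_pow hs1 1
  have i2 := h.integrable_pow hs1 2
  simp only [pow_one] at i1
  -- The arithmetic-geometric mean inequality interpolates `Y^{3/2}` between `Y` and `Y²`; the
  -- weight `q = √(P + 1)` balances the two moments.
  have hle : ∀ ω, Y ω * √(Y ω) * Real.exp (s * (Y ω / 2)) ≤
      1 / (2 * q) * (Y ω ^ 2 * Real.exp (s * (Y ω / 2))) +
        q / 2 * (Y ω * Real.exp (s * (Y ω / 2))) := by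
    intro ω
    have hy := h.nonneg ω
    have hy2 := Real.sq_sqrt hy
    have : Y ω * √(Y ω) ≤ 1 / (2 * q) * Y ω ^ 2 + q / 2 * Y ω := by
      have e : 1 / (2 * q) * Y ω ^ 2 + q / 2 * Y ω - Y ω * √(Y ω)
          = Y ω * (√(Y ω) - q) ^ 2 / (2 * q) := by
        rw [sub_sq, hy2]; field_simp; ring
      have : 0 ≤ Y ω * (√(Y ω) - q) ^ 2 / (2 * q) := by positivity
      linarith
    calc _ ≤ (1 / (2 * q) * Y ω ^ 2 + q / 2 * Y ω) * Real.exp (s * (Y ω / 2)) := by gcongr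
      _ = _ := by ring
  have hI : Integrable (fun ω => Y ω * √(Y ω) * Real.exp (s * (Y ω / 2))) μ := by
    refine ((i2.const_mul (1 / (2 * q))).add (i1.const_mul (q / 2))).mono' ?_ ?_
    · have := h.measurable
      fun_prop
    · refine .of_forall fun ω => ?_
      have hy := h.nonneg ω
      rw [Real.norm_of_nonneg (by positivity)]
      exact hle ω
  refine ⟨hI, ?_⟩
  refine (integral_mono hI ((i2.const_mul (1 / (2 * q))).add (i1.const_mul (q / 2))) hle).trans ?_
  simp only [Pi.add_apply]
  rw [integral_add (i2.const_mul _) (i1.const_mul _), integral_const_mul, integral_const_mul, hq3]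
  calc _ ≤ 1 / (2 * q) * (128 / 45 * (P * (P + 2))) + q / 2 * (32 / 15 * P) := by gcongr
    _ ≤ 1 / (2 * q) * (128 / 45 * (q ^ 2 * q ^ 2)) + q / 2 * (32 / 15 * q ^ 2) := by
        have h1 : P * (P + 2) ≤ q ^ 2 * q ^ 2 := by rw [hq2]; nlinarith
        have h2 : P ≤ q ^ 2 := by linarith
        gcongr
    _ = (64 / 45 + 16 / 15) * q ^ 3 := by field_simp; norm_num
    _ ≤ _ := by
        have : 0 < q ^ 3 := by positivity
        linarith

/-- Needed for the degenerate case `P = 0`, where the tail arguments below, which require `√P > 0`,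
do not apply. -/
lemma IsWeightedChiSq.ae_eq_zero (h : IsWeightedChiSq μ Y lam)
    (h0 : ∑ i, lam i = 0) : ∀ᵐ ω ∂μ, Y ω = 0 := by
  have e := (h.integral_pow_le (s := 0) (by norm_num) (by norm_num)).1
  have i1 := h.integrable_pow zero_lt_one 1
  simp only [pow_one, zero_mul, Real.exp_zero, mul_one, h0, mul_zero] at i1 e
  exact (integral_eq_zero_iff_of_nonneg h.nonneg i1).1 (le_antisymm e (integral_nonneg h.nonneg))

lemma IsWeightedChiSq.measure_gt_le [IsProbabilityMeasure μ] (h : IsWeightedChiSq μ Y lam)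
    {r t : ℝ} (ht : 0 < t) (hr : 2 * √(∑ i, lam i) + √(2 * t) ≤ r) :
    μ.real {ω | r ^ 2 < Y ω} ≤ Real.exp (-t) := by
  have hP0 : 0 ≤ ∑ i, lam i := Finset.sum_nonneg fun i _ => h.lam_nonneg i
  have hθ : 0 < √(2 * t) := Real.sqrt_pos.2 (by linarith)
  rcases hP0.eq_or_lt with hP | hP
  · have : μ {ω | r ^ 2 < Y ω} = 0 := by
      refine measure_mono_null (fun ω hω => ?_) (ae_iff.1 (h.ae_eq_zero hP.symm))
      have hω : r ^ 2 < Y ω := hω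
      exact (lt_of_le_of_lt (sq_nonneg r) hω).ne'
    rw [measureReal_def, this]
    exact (Real.exp_pos _).le
  set P := ∑ i, lam i with hPdef
  set q := √P with hq
  have hq0 : 0 < q := Real.sqrt_pos.2 hP
  have hq2 : q ^ 2 = P := Real.sq_sqrt hP.le
  have hr0 : 0 < r := by linarith
  have hs : 1 - q / r < 1 := by
    have : 0 < q / r := by positivity
    linarith
  have hs0 : 0 ≤ 1 - q / r := by
    rw [sub_nonneg, div_le_one hr0]; linarith
  -- Chernoff bound at `s = 1 - q / r`, the minimizer of the exponent `-s r² / 2 + q² s / (2 (1 -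
  -- s))`, with minimum `-(r - q)² / 2`.
  have h1 : μ.real {ω | r ^ 2 / 2 ≤ Y ω / 2} ≤ _ :=
    measure_ge_le_exp_mul_mgf (X := fun ω => Y ω / 2) (r ^ 2 / 2) hs0 (h.integrable _ hs)
  have h2 : mgf (fun ω => Y ω / 2) μ (1 - q / r) ≤ _ := h.integral_exp_le hs
  calc μ.real {ω | r ^ 2 < Y ω} ≤ μ.real {ω | r ^ 2 / 2 ≤ Y ω / 2} := by
        refine measureReal_mono fun ω hω => ?_
        have hω : r ^ 2 < Y ω := hω
        change r ^ 2 / 2 ≤ Y ω / 2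
        linarith
    _ ≤ _ := h1
    _ ≤ Real.exp (-(1 - q / r) * (r ^ 2 / 2)) *
        Real.exp (P * (1 - q / r) / (2 * (1 - (1 - q / r)))) := by gcongr
    _ = Real.exp (-((r - q) ^ 2 / 2)) := by
        rw [← Real.exp_add, ← hq2, sub_sub_cancel]
        congr 1
        have := hq0.ne'
        field_simp
        ring
    _ ≤ Real.exp (-t) := by
        rw [Real.exp_le_exp, neg_le_neg_iff]
        have h3 : √(2 * t) ^ 2 = 2 * t := Real.sq_sqrt (by linarith)
        have h4 : √(2 * t) ^ 2 ≤ (r - q) ^ 2 := by gcongr; linarith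
        linarith

end ChiSq

/-! ### The exponential of a square root as a Gaussian mixture -/

lemma integral_gaussian_one_add_odd {a : ℝ} {h : ℝ → ℝ} (hc : Continuous h)
    (hodd : ∀ y, h (-y) = -h y) (hb : ∀ y, |h y| ≤ 1) :
    Integrable (fun y => a * ((1 + h y) * Real.exp (-(1 / 2) * y ^ 2))) ∧
    ∫ y, a * ((1 + h y) * Real.exp (-(1 / 2) * y ^ 2)) = a * √(2 * Real.pi) := by
  have hg : Integrable fun y : ℝ => Real.exp (-(1 / 2) * y ^ 2) :=
    integrable_exp_neg_mul_sq (by norm_num)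
  have hi : Integrable fun y : ℝ => h y * Real.exp (-(1 / 2) * y ^ 2) :=
    hg.bdd_mul (c := 1) hc.aestronglyMeasurable (.of_forall hb)
  have h0 : ∫ y, h y * Real.exp (-(1 / 2) * y ^ 2) = 0 := by
    have := integral_neg_eq_self (fun y => h y * Real.exp (-(1 / 2) * y ^ 2)) volume
    simp only [hodd, neg_sq, neg_mul, integral_neg] at this ⊢
    linarith
  have e : (fun y => a * ((1 + h y) * Real.exp (-(1 / 2) * y ^ 2))) = fun y =>
      a * (Real.exp (-(1 / 2) * y ^ 2) + h y * Real.exp (-(1 / 2) * y ^ 2)) := by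
    funext y; ring
  rw [e]
  refine ⟨(hg.add hi).const_mul a, ?_⟩
  rw [integral_const_mul, integral_add hg hi, h0, integral_gaussian, add_zero]
  congr 2
  ring

/-- The exponent is `-(a w - R / w)² / 2 - a R`, so substitute `y = a w - R / w`, that is `w = g y`.
The Jacobian is a constant times `1 + y / q y`, and its odd part integrates to zero. Equality is not
needed: restricting to the image of `g` gives the required direction without surjectivity. -/
lemma exp_neg_mul_le_lintegral {a R : ℝ} (ha : 0 < a) (hR : 0 < R) :
    ENNReal.ofReal (Real.exp (-(a * R))) ≤ ∫⁻ w in Set.Ioi (0 : ℝ), ENNReal.ofReal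
      (a * (2 / √(2 * Real.pi)) * Real.exp (-(a ^ 2 * w ^ 2 / 2) - R ^ 2 / (2 * w ^ 2))) := by
  set q : ℝ → ℝ := fun y => √(y ^ 2 + 4 * a * R) with hq
  have hpos : ∀ y : ℝ, 0 < y ^ 2 + 4 * a * R := fun y => by positivity
  have hq0 : ∀ y, 0 < q y := fun y => Real.sqrt_pos.2 (hpos y)
  have hq2 : ∀ y, q y ^ 2 = y ^ 2 + 4 * a * R := fun y => Real.sq_sqrt (hpos y).le
  have hqy : ∀ y, |y| < q y := fun y => by
    rw [← Real.sqrt_sq_eq_abs]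
    exact Real.sqrt_lt_sqrt (sq_nonneg y) (by nlinarith [mul_pos ha hR])
  set g : ℝ → ℝ := fun y => (y + q y) / (2 * a) with hg
  have hg0 : ∀ y, 0 < g y := fun y => by
    have := (abs_lt.1 (hqy y)).1
    exact div_pos (by linarith) (by positivity)
  have hinv : ∀ y, a * g y - R / g y = y := fun y => by
    have h1 : g y * (a * g y) - R = y * g y := by
      have := hq2 y
      simp only [hg]
      field_simp
      nlinarith
    have h2 := (hg0 y).ne'
    field_simp
    linarith
  have hder : ∀ y ∈ Set.univ, HasDerivWithinAt g ((1 + y / q y) / (2 * a)) Set.univ y := by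
    intro y _
    have h1 : HasDerivAt q _ y := ((hasDerivAt_pow 2 y).add_const (4 * a * R)).sqrt (hpos y).ne'
    refine (((hasDerivAt_id y).add h1).div_const (2 * a)).hasDerivWithinAt.congr_deriv ?_
    have := (hq0 y).ne'
    simp only [hq] at this ⊢
    norm_num
    field_simp
  have hinj : Set.InjOn g Set.univ := by
    intro x _ y _ hxy
    rw [← hinv x, ← hinv y, hxy]
  have hsub : g '' Set.univ ⊆ Set.Ioi 0 := by
    rintro _ ⟨y, -, rfl⟩
    exact hg0 y
  have hhb : ∀ y, |y / q y| ≤ 1 := fun y => by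
    rw [abs_div, abs_of_pos (hq0 y), div_le_one (hq0 y)]
    exact (hqy y).le
  obtain ⟨hI, hIv⟩ := integral_gaussian_one_add_odd (a := Real.exp (-(a * R)) / √(2 * Real.pi))
    (h := fun y => y / q y)
    (continuous_id.div (by fun_prop) fun y => (hq0 y).ne') (fun y => by simp [hq, neg_div]) hhb
  have hπ : 0 < √(2 * Real.pi) := Real.sqrt_pos.2 (by positivity)
  refine le_trans (le_of_eq ?_) (lintegral_mono_set hsub)
  rw [lintegral_image_eq_lintegral_abs_deriv_mul MeasurableSet.univ hder hinj,
    Measure.restrict_univ]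
  have hrw : ∀ y, ENNReal.ofReal |(1 + y / q y) / (2 * a)| * ENNReal.ofReal
      (a * (2 / √(2 * Real.pi)) * Real.exp (-(a ^ 2 * g y ^ 2 / 2) - R ^ 2 / (2 * g y ^ 2))) =
      ENNReal.ofReal (Real.exp (-(a * R)) / √(2 * Real.pi) *
        ((1 + y / q y) * Real.exp (-(1 / 2) * y ^ 2))) := by
    intro y
    have h1 : 0 ≤ 1 + y / q y := by linarith [(abs_le.1 (hhb y)).1]
    rw [← ENNReal.ofReal_mul (abs_nonneg _), abs_of_nonneg (by positivity)]
    congr 1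
    have h2 : Real.exp (-(a ^ 2 * g y ^ 2 / 2) - R ^ 2 / (2 * g y ^ 2)) =
        Real.exp (-(a * R)) * Real.exp (-(1 / 2) * y ^ 2) := by
      rw [← Real.exp_add]
      congr 1
      have h3 := (hg0 y).ne'
      conv_rhs => rw [← hinv y]
      field_simp
      ring
    rw [h2]
    field_simp
  simp only [hrw]
  rw [← ofReal_integral_eq_lintegral_ofReal hI (.of_forall fun y => ?_), hIv]
  · congr 1
    field_simp
  · have h1 : 0 ≤ 1 + y / q y := by linarith [(abs_le.1 (hhb y)).1]
    simp only [Pi.zero_apply]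
    positivity

section Tail

variable {Ω : Type*} [MeasurableSpace Ω] {μ : Measure Ω} {Y : Ω → ℝ} {lam : Fin p → ℝ}

/-- After inserting the mixture and exchanging integrals, the generating function bound at `s = 1 -
1 / w²` is `exp (P (w² - 1) / 2)`. Together with `exp (-a² w² / 2)` this is a Gaussian in `w`,
integrable because `P < a²`. Lower integrals allow the exchange with no integrability known in
advance. -/
lemma IsWeightedChiSq.lintegral_exp_sub_sqrt_le [SFinite μ] (h : IsWeightedChiSq μ Y lam) {a : ℝ}
    (ha : 0 < a) (haP : ∑ i, lam i < a ^ 2) :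
    ∫⁻ ω in {ω | 0 < Y ω}, ENNReal.ofReal (Real.exp (Y ω / 2 - a * √(Y ω))) ∂μ ≤
      ENNReal.ofReal (Real.exp (-((∑ i, lam i) / 2)) * (a / √(a ^ 2 - ∑ i, lam i))) := by
  set P := ∑ i, lam i
  have hYm := h.measurable
  have hπ : 0 < √(2 * Real.pi) := Real.sqrt_pos.2 (by positivity)
  obtain ⟨κ, hκ⟩ : ∃ κ, κ = a * (2 / √(2 * Real.pi)) := ⟨_, rfl⟩
  have hκ0 : 0 < κ := hκ ▸ by positivity
  have hb : 0 < (a ^ 2 - P) / 2 := by linarith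
  calc ∫⁻ ω in {ω | 0 < Y ω}, ENNReal.ofReal (Real.exp (Y ω / 2 - a * √(Y ω))) ∂μ
      ≤ ∫⁻ ω in {ω | 0 < Y ω}, ∫⁻ w in Set.Ioi (0 : ℝ), ENNReal.ofReal
          (κ * Real.exp (-(a ^ 2 * w ^ 2 / 2)) *
            Real.exp ((1 - 1 / w ^ 2) * (Y ω / 2))) ∂volume ∂μ := by
        refine setLIntegral_mono' (measurableSet_lt measurable_const hYm) fun ω hω => ?_
        have hR : 0 < √(Y ω) := Real.sqrt_pos.2 hω
        have e1 := exp_neg_mul_le_lintegral ha hR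
        rw [← hκ] at e1
        rw [sub_eq_add_neg, Real.exp_add, ENNReal.ofReal_mul (Real.exp_pos _).le]
        refine (mul_le_mul_right e1 _).trans_eq ?_
        rw [← lintegral_const_mul' _ _ ENNReal.ofReal_ne_top]
        refine setLIntegral_congr_fun measurableSet_Ioi fun w hw => ?_
        have hw0 : (w : ℝ) ≠ 0 := (ne_of_gt hw)
        rw [← ENNReal.ofReal_mul (Real.exp_pos _).le]
        congr 1
        rw [mul_left_comm, mul_assoc, ← Real.exp_add, ← Real.exp_add, Real.sq_sqrt (h.nonneg ω)]
        congr 2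
        field_simp
        ring
    _ ≤ ∫⁻ ω, ∫⁻ w in Set.Ioi (0 : ℝ), ENNReal.ofReal
          (κ * Real.exp (-(a ^ 2 * w ^ 2 / 2)) *
            Real.exp ((1 - 1 / w ^ 2) * (Y ω / 2))) ∂volume ∂μ := setLIntegral_le_lintegral _ _
    _ = ∫⁻ w in Set.Ioi (0 : ℝ), ∫⁻ ω, ENNReal.ofReal
          (κ * Real.exp (-(a ^ 2 * w ^ 2 / 2)) *
            Real.exp ((1 - 1 / w ^ 2) * (Y ω / 2))) ∂μ := by
        refine lintegral_lintegral_swap ?_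
        refine Measurable.aemeasurable ?_
        unfold Function.uncurry
        have : Measurable fun x : Ω × ℝ => Y x.1 := hYm.comp measurable_fst
        fun_prop
    _ ≤ ∫⁻ w in Set.Ioi (0 : ℝ), ENNReal.ofReal
          (κ * Real.exp (-(P / 2)) * Real.exp (-((a ^ 2 - P) / 2) * w ^ 2)) := by
        refine setLIntegral_mono' measurableSet_Ioi fun w hw => ?_
        have hw0 : 0 < w := hw
        have hs : 1 - 1 / w ^ 2 < 1 := by
          have : 0 < 1 / w ^ 2 := by positivity
          linarith
        rw [← ofReal_integral_eq_lintegral_ofReal ((h.integrable _ hs).const_mul _)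
          (.of_forall fun ω => by simp only [Pi.zero_apply]; positivity), integral_const_mul]
        refine ENNReal.ofReal_le_ofReal ?_
        calc _ ≤ κ * Real.exp (-(a ^ 2 * w ^ 2 / 2)) *
              Real.exp (P * (1 - 1 / w ^ 2) / (2 * (1 - (1 - 1 / w ^ 2)))) := by
              gcongr; exact h.integral_exp_le hs
          _ = _ := by
              rw [mul_assoc, mul_assoc, ← Real.exp_add, ← Real.exp_add]
              congr 2
              field_simp
              ring
    _ = _ := by
        rw [← ofReal_integral_eq_lintegral_ofReal
          ((integrable_exp_neg_mul_sq hb).integrableOn.const_mul _)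
          (.of_forall fun ω => by simp only [Pi.zero_apply]; positivity), integral_const_mul,
          integral_gaussian_Ioi]
        congr 1
        rw [show Real.pi / ((a ^ 2 - P) / 2) = 2 * Real.pi / (a ^ 2 - P) by field_simp,
          Real.sqrt_div (by positivity), hκ]
        have : 0 < √(a ^ 2 - P) := Real.sqrt_pos.2 (by linarith)
        field_simp

/-- After multiplication by `1 - ω`, the left side has the part `5/4 q ρ - ρ² / 2` with `ρ = (1 - ω)
r`, which decreases for `ρ ≥ 5/4 q`. At `ρ = 2 q + θ` the total is `ω q² / 2 - 3/4 q θ - θ² / 2`,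
and `ω q² ≤ q θ` absorbs the positive term. -/
lemma tail_exponent_le {q θ ω r : ℝ} (hq : 0 ≤ q) (hθ : 1 ≤ θ) (hω0 : 0 ≤ ω) (hω : ω ≤ 1 / 4)
    (hωP : ω * q ^ 2 ≤ 2 / 3) (hr : 2 * q + θ ≤ (1 - ω) * r) :
    5 / 4 * q * r - (1 - ω) * r ^ 2 / 2 - q ^ 2 / 2 ≤ -(θ ^ 2 / 2) := by
  have h1 : ω * q ≤ 1 := by
    refine abs_le_of_sq_le_sq' (b := 1) ?_ zero_le_one |>.2
    nlinarith [mul_nonneg hω0 (sq_nonneg q)]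
  have h2 : ω * q ^ 2 ≤ q * θ := by nlinarith [mul_le_mul_of_nonneg_right h1 hq]
  have h3 : 5 / 4 * q * ((1 - ω) * r) - ((1 - ω) * r) ^ 2 / 2
      ≤ 5 / 4 * q * (2 * q + θ) - (2 * q + θ) ^ 2 / 2 := by
    nlinarith [mul_nonneg (sub_nonneg.2 hr) hq, mul_nonneg (sub_nonneg.2 hr) (sub_nonneg.2 hθ),
      sq_nonneg ((1 - ω) * r - (2 * q + θ))]
  have h4 : (1 - ω) * (5 / 4 * q * r - (1 - ω) * r ^ 2 / 2 - q ^ 2 / 2)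
      ≤ (1 - ω) * (-(θ ^ 2 / 2)) := by
    nlinarith [mul_nonneg hω0 (sq_nonneg θ)]
  exact le_of_mul_le_mul_left h4 (by linarith)

lemma IsWeightedChiSq.lintegral_tail_le [SFinite μ] (h : IsWeightedChiSq μ Y lam) {ω₀ r t : ℝ}
    (ht : 1 ≤ t) (hω0 : 0 ≤ ω₀) (hω : ω₀ ≤ 1 / 4) (hωP : ω₀ * ∑ i, lam i ≤ 2 / 3)
    (hr : 2 * √(∑ i, lam i) + √(2 * t) ≤ (1 - ω₀) * r) :
    ∫⁻ ω in {ω | r ^ 2 < Y ω}, ENNReal.ofReal (Real.exp (Y ω / 2 - (1 - ω₀) * r ^ 2 / 2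
      - (√(Y ω) - r) * (5 / 4 * √(∑ i, lam i)))) ∂μ ≤ ENNReal.ofReal (5 / 3 * Real.exp (-t)) := by
  have hP0 : 0 ≤ ∑ i, lam i := Finset.sum_nonneg fun i _ => h.lam_nonneg i
  rcases hP0.eq_or_lt with hP | hP
  · have : μ {ω | r ^ 2 < Y ω} = 0 := by
      refine measure_mono_null (fun ω hω => ?_) (ae_iff.1 (h.ae_eq_zero hP.symm))
      have hω : r ^ 2 < Y ω := hω
      exact (lt_of_le_of_lt (sq_nonneg r) hω).ne'
    rw [setLIntegral_measure_zero _ _ this]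
    exact zero_le
  set P := ∑ i, lam i with hPdef
  set q := √P with hq
  have hq0 : 0 < q := Real.sqrt_pos.2 hP
  have hq2 : q ^ 2 = P := Real.sq_sqrt hP.le
  -- The slope `a = 5/4 √P` exceeds `√P`, as integrability requires, and makes `a / √(a² - P)` equal
  -- to `5/3`.
  have hmain := h.lintegral_exp_sub_sqrt_le (a := 5 / 4 * q) (by positivity)
    (by rw [mul_pow, hq2]; linarith)
  have hval : 5 / 4 * q / √((5 / 4 * q) ^ 2 - P) = 5 / 3 := by
    rw [← hq2, show (5 / 4 * q) ^ 2 - q ^ 2 = (3 / 4 * q) ^ 2 by ring,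
      Real.sqrt_sq (by positivity)]
    field_simp
  rw [← hPdef, hval] at hmain
  have hθ : 1 ≤ √(2 * t) := Real.one_le_sqrt.2 (by linarith)
  have hexp := tail_exponent_le hq0.le hθ hω0 hω (by rwa [hq2]) hr
  rw [Real.sq_sqrt (by linarith : 0 ≤ 2 * t)] at hexp
  calc _ = ∫⁻ ω in {ω | r ^ 2 < Y ω}, ENNReal.ofReal
          (Real.exp (5 / 4 * q * r - (1 - ω₀) * r ^ 2 / 2)) *
          ENNReal.ofReal (Real.exp (Y ω / 2 - 5 / 4 * q * √(Y ω))) ∂μ := by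
        congr 1; funext ω
        rw [← ENNReal.ofReal_mul (Real.exp_pos _).le, ← Real.exp_add]
        congr 2; ring
    _ = ENNReal.ofReal (Real.exp (5 / 4 * q * r - (1 - ω₀) * r ^ 2 / 2)) *
          ∫⁻ ω in {ω | r ^ 2 < Y ω},
            ENNReal.ofReal (Real.exp (Y ω / 2 - 5 / 4 * q * √(Y ω))) ∂μ :=
        lintegral_const_mul' _ _ ENNReal.ofReal_ne_top
    _ ≤ ENNReal.ofReal (Real.exp (5 / 4 * q * r - (1 - ω₀) * r ^ 2 / 2)) *
          ENNReal.ofReal (Real.exp (-(P / 2)) * (5 / 3)) := by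
        gcongr
        refine (lintegral_mono_set fun ω hω => ?_).trans hmain
        exact (sq_nonneg r).trans_lt hω
    _ ≤ _ := by
        rw [← ENNReal.ofReal_mul (Real.exp_pos _).le, ← mul_assoc, ← Real.exp_add,
          mul_comm]
        gcongr
        rw [← hq2]
        linarith

end Tail

/-! ### Total variation bounds for perturbed Gaussian densities -/

lemma abs_exp_sub_one_le_mul_exp (x : ℝ) : |Real.exp x - 1| ≤ |x| * Real.exp |x| := by
  have h := Complex.norm_exp_sub_sum_le_norm_mul_exp (x : ℂ) 1
  simp only [Finset.sum_range_one, pow_zero, Nat.factorial_zero, Nat.cast_one, div_one, pow_one,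
    Complex.norm_real, Real.norm_eq_abs] at h
  rwa [← Complex.ofReal_exp, ← Complex.ofReal_one, ← Complex.ofReal_sub, Complex.norm_real] at h

lemma abs_exp_sub_one_sub_le_sq_mul_exp (x : ℝ) :
    |Real.exp x - 1 - x| ≤ x ^ 2 * Real.exp |x| := by
  have h := Complex.norm_exp_sub_sum_le_norm_mul_exp (x : ℂ) 2
  simp only [Finset.sum_range_succ, Finset.sum_range_zero, pow_zero, Nat.factorial, Nat.cast_one,
    div_one, pow_one, zero_add, mul_one, Complex.norm_real, Real.norm_eq_abs, sq_abs,
    ← sub_sub] at h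
  rwa [← Complex.ofReal_exp, ← Complex.ofReal_one, ← Complex.ofReal_sub, ← Complex.ofReal_sub,
    Complex.norm_real] at h

section TV

variable {Ω : Type*} [MeasurableSpace Ω] {μ : Measure Ω} {Y w δ : Ω → ℝ} {lam : Fin p → ℝ}
  {τ τ₄ r t ν : ℝ} {A U : Set Ω}

lemma abs_indicator_sub_le [IsProbabilityMeasure μ] (A : Set Ω) (ω : Ω) :
    |A.indicator (fun _ => (1 : ℝ)) ω - μ.real A| ≤ 1 := by
  have h0 : 0 ≤ μ.real A := measureReal_nonneg
  have h1 : μ.real A ≤ 1 := measureReal_le_one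
  by_cases h : ω ∈ A
  · rw [Set.indicator_of_mem h, abs_le]; constructor <;> linarith
  · rw [Set.indicator_of_notMem h, abs_le]; constructor <;> linarith

lemma measurable_indicator_sub (hA : MeasurableSet A) :
    Measurable fun ω => A.indicator (fun _ => (1 : ℝ)) ω - μ.real A :=
  (measurable_const.indicator hA).sub_const _

/-- Centring the indicator makes its integral vanish, so `w` may be replaced by `w - 1`. The error
of the normalising constant is thereby included, and the centred indicator is still bounded by `1`.
-/
lemma setIntegral_div_sub_eq [IsProbabilityMeasure μ] (hw : Integrable w μ)
    (hA : MeasurableSet A) (hZ : 0 < ∫ ω, w ω ∂μ) :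
    (∫ ω in A, w ω ∂μ) / (∫ ω, w ω ∂μ) - μ.real A =
      (∫ ω, (w ω - 1) * (A.indicator (fun _ => (1 : ℝ)) ω - μ.real A) ∂μ) / ∫ ω, w ω ∂μ := by
  have hi : Integrable (A.indicator fun _ => (1 : ℝ)) μ := (integrable_const _).indicator hA
  have h1 : (fun ω => (w ω - 1) * (A.indicator (fun _ => (1 : ℝ)) ω - μ.real A)) =
      fun ω => (A.indicator w ω - μ.real A * w ω) -
        (A.indicator (fun _ => (1 : ℝ)) ω - μ.real A) := by
    funext ω
    by_cases h : ω ∈ A <;> simp [h] <;> ring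
  have h2 : Integrable (fun ω => A.indicator w ω - μ.real A * w ω) μ :=
    (hw.indicator hA).sub (hw.const_mul _)
  have h3 : Integrable (fun ω => A.indicator (fun _ => (1 : ℝ)) ω - μ.real A) μ :=
    hi.sub (integrable_const _)
  rw [h1, integral_sub h2 h3, integral_sub (hw.indicator hA) (hw.const_mul _),
    integral_sub hi (integrable_const _), integral_indicator hA, integral_indicator hA,
    integral_const_mul]
  simp
  field_simp

lemma abs_setIntegral_div_sub_le [IsProbabilityMeasure μ] (hw : Integrable w μ)
    (hw0 : ∀ ω, 0 ≤ w ω) (hA : MeasurableSet A) (hU : MeasurableSet U) (hZ : 0 < ∫ ω, w ω ∂μ) :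
    |(∫ ω in A, w ω ∂μ) / (∫ ω, w ω ∂μ) - μ.real A| ≤
      (|∫ ω in U, (w ω - 1) * (A.indicator (fun _ => (1 : ℝ)) ω - μ.real A) ∂μ|
        + ((∫ ω in Uᶜ, w ω ∂μ) + μ.real Uᶜ)) / ∫ ω, w ω ∂μ := by
  have hi : Integrable (fun ω => (w ω - 1) * (A.indicator (fun _ => (1 : ℝ)) ω - μ.real A)) μ :=
    (hw.sub (integrable_const 1)).mul_bdd (c := 1) (measurable_indicator_sub hA).aestronglyMeasurable
      (.of_forall fun ω => abs_indicator_sub_le A ω)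
  rw [setIntegral_div_sub_eq hw hA hZ, abs_div, abs_of_pos hZ]
  gcongr
  rw [← integral_add_compl hU hi]
  refine (abs_add_le _ _).trans (add_le_add_right ?_ _)
  have h1 : μ.real Uᶜ = ∫ _ in Uᶜ, (1 : ℝ) ∂μ := by simp
  rw [h1, ← integral_add hw.integrableOn (integrable_const _)]
  refine abs_integral_le_integral_abs.trans (integral_mono hi.abs.integrableOn
    (hw.integrableOn.add (integrable_const _)) fun ω => ?_)
  rw [abs_mul]
  refine (mul_le_of_le_one_right (abs_nonneg _) (abs_indicator_sub_le A ω)).trans ?_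
  rw [abs_le]; constructor <;> linarith [hw0 ω]

lemma abs_setIntegral_div_sub_le_one [IsProbabilityMeasure μ] (hw : Integrable w μ)
    (hw0 : ∀ ω, 0 ≤ w ω) (A : Set Ω) :
    |(∫ ω in A, w ω ∂μ) / (∫ ω, w ω ∂μ) - μ.real A| ≤ 1 := by
  have h0 : 0 ≤ μ.real A := measureReal_nonneg
  have h1 : μ.real A ≤ 1 := measureReal_le_one
  have h2 : (∫ ω in A, w ω ∂μ) ≤ ∫ ω, w ω ∂μ := setIntegral_le_integral hw (.of_forall hw0)
  have h3 : 0 ≤ ∫ ω in A, w ω ∂μ := integral_nonneg hw0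
  have h4 := div_le_one_of_le₀ h2 (integral_nonneg hw0)
  have h5 : 0 ≤ (∫ ω in A, w ω ∂μ) / (∫ ω, w ω ∂μ) := div_nonneg h3 (integral_nonneg hw0)
  rw [abs_le]; constructor <;> linarith

/-- `w` is the density, relative to a Gaussian measure, of a measure which is a perturbation
`exp δ` of it on the ellipsoid `{Y ≤ r²}` and has small tails outside. -/
structure IsLaplaceDensity (μ : Measure Ω) (Y w δ : Ω → ℝ) (lam : Fin p → ℝ) (τ r t ν : ℝ) :
    Prop where
  chiSq : IsWeightedChiSq μ Y lam
  measurable : Measurable δ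
  integrable : Integrable w μ
  nonneg : ∀ ω, 0 ≤ w ω
  t_pos : 0 < t
  ν_pos : 0 < ν
  τ_nonneg : 0 ≤ τ
  r_eq : r = (2 * √(∑ i, lam i) + √(2 * t)) / ν
  ω_le : τ * r / 3 ≤ 1 / 4
  ω_le_sub : τ * r / 3 ≤ 1 - ν
  ω_mul_le : τ * r / 3 * ∑ i, lam i ≤ 2 / 3
  eq_exp : ∀ ω, Y ω ≤ r ^ 2 → w ω = Real.exp (δ ω)
  abs_le : ∀ ω, Y ω ≤ r ^ 2 → |δ ω| ≤ τ / 6 * (Y ω * √(Y ω))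
  tail_le : ∀ ω, r ^ 2 < Y ω → w ω ≤ Real.exp (Y ω / 2 - (1 - τ * r / 3) * r ^ 2 / 2
      - (√(Y ω) - r) * (5 / 4 * √(∑ i, lam i)))

namespace IsLaplaceDensity

lemma r_pos (H : IsLaplaceDensity μ Y w δ lam τ r t ν) : 0 < r := by
  have : 0 < √(2 * t) := Real.sqrt_pos.2 (by linarith [H.t_pos])
  have := Real.sqrt_nonneg (∑ i, lam i)
  rw [H.r_eq]
  exact div_pos (by linarith) H.ν_pos

lemma ω_nonneg (H : IsLaplaceDensity μ Y w δ lam τ r t ν) : 0 ≤ τ * r / 3 := by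
  have := H.r_pos
  have := H.τ_nonneg
  positivity

lemma le_mul_r (H : IsLaplaceDensity μ Y w δ lam τ r t ν) :
    2 * √(∑ i, lam i) + √(2 * t) ≤ (1 - τ * r / 3) * r := by
  have h : ν * r = 2 * √(∑ i, lam i) + √(2 * t) := by
    rw [H.r_eq, mul_div_cancel₀ _ H.ν_pos.ne']
  rw [← h]
  exact mul_le_mul_of_nonneg_right (by linarith [H.ω_le_sub]) H.r_pos.le

lemma le_r (H : IsLaplaceDensity μ Y w δ lam τ r t ν) :
    2 * √(∑ i, lam i) + √(2 * t) ≤ r := by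
  nlinarith [H.le_mul_r, mul_nonneg H.ω_nonneg H.r_pos.le]

lemma measurableSet (H : IsLaplaceDensity μ Y w δ lam τ r t ν) (r : ℝ) :
    MeasurableSet {ω | Y ω ≤ r ^ 2} :=
  measurableSet_le H.chiSq.measurable measurable_const

lemma measure_compl_le [IsProbabilityMeasure μ] (H : IsLaplaceDensity μ Y w δ lam τ r t ν) :
    μ.real {ω | Y ω ≤ r ^ 2}ᶜ ≤ Real.exp (-t) := by
  have e : {ω | Y ω ≤ r ^ 2}ᶜ = {ω | r ^ 2 < Y ω} := by ext; simp
  rw [e]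
  exact H.chiSq.measure_gt_le H.t_pos H.le_r

lemma setIntegral_compl_le [IsProbabilityMeasure μ] (H : IsLaplaceDensity μ Y w δ lam τ r t ν)
    (ht : 1 ≤ t) : ∫ ω in {ω | Y ω ≤ r ^ 2}ᶜ, w ω ∂μ ≤ 5 / 3 * Real.exp (-t) := by
  have e : {ω | Y ω ≤ r ^ 2}ᶜ = {ω | r ^ 2 < Y ω} := by ext; simp
  rw [e, ← ENNReal.ofReal_le_ofReal_iff (by positivity),
    ofReal_integral_eq_lintegral_ofReal H.integrable.integrableOn (.of_forall H.nonneg)]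
  refine le_trans ?_ (H.chiSq.lintegral_tail_le ht H.ω_nonneg H.ω_le H.ω_mul_le H.le_mul_r)
  refine setLIntegral_mono' (measurableSet_lt measurable_const H.chiSq.measurable) fun ω hω => ?_
  exact ENNReal.ofReal_le_ofReal (H.tail_le ω hω)

lemma abs_le_quadratic (H : IsLaplaceDensity μ Y w δ lam τ r t ν) {ω : Ω} (hω : Y ω ≤ r ^ 2) :
    |δ ω| ≤ τ * r / 3 * (Y ω / 2) := by
  refine (H.abs_le ω hω).trans ?_
  have h1 : √(Y ω) ≤ r := Real.sqrt_le_iff.2 ⟨H.r_pos.le, hω⟩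
  have h2 := mul_le_mul_of_nonneg_left h1 (mul_nonneg H.τ_nonneg (H.chiSq.nonneg ω))
  linarith

lemma integrableOn_of_abs_le (H : IsLaplaceDensity μ Y w δ lam τ r t ν) [IsFiniteMeasure μ]
    {F : Ω → ℝ} (hF : Measurable F) {C : ℝ} (hC : ∀ ω, Y ω ≤ r ^ 2 → |F ω| ≤ C) :
    IntegrableOn F {ω | Y ω ≤ r ^ 2} μ :=
  IntegrableOn.of_bound (measure_lt_top _ _) hF.aestronglyMeasurable C
    ((ae_restrict_iff' (H.measurableSet r)).2 (.of_forall hC))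

lemma abs_le_const (H : IsLaplaceDensity μ Y w δ lam τ r t ν) {ω : Ω} (hω : Y ω ≤ r ^ 2) :
    |δ ω| ≤ τ * r / 3 * (r ^ 2 / 2) :=
  (H.abs_le_quadratic hω).trans
    (mul_le_mul_of_nonneg_left (by linarith) H.ω_nonneg)

/-- Bounds on `{Y ≤ r²}` by integrable functions carry over to integrals. -/
lemma abs_setIntegral_le (H : IsLaplaceDensity μ Y w δ lam τ r t ν) {F K : Ω → ℝ}
    (hK : Integrable K μ) (hK0 : ∀ ω, 0 ≤ K ω) (hF : ∀ ω, Y ω ≤ r ^ 2 → |F ω| ≤ K ω) :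
    |∫ ω in {ω | Y ω ≤ r ^ 2}, F ω ∂μ| ≤ ∫ ω, K ω ∂μ := by
  refine le_trans ?_ (setIntegral_le_integral (s := {ω | Y ω ≤ r ^ 2}) hK (.of_forall hK0))
  exact norm_integral_le_of_norm_le (f := F) hK.integrableOn
    ((ae_restrict_iff' (H.measurableSet r)).2 (.of_forall hF))

/-- From `e^δ ≥ 1 + δ` on the ellipsoid. The absolute value stays outside the integral of `δ`, so
that cancellation under `u ↦ -u` can be used for symmetric sets. -/
lemma le_integral [IsProbabilityMeasure μ] (H : IsLaplaceDensity μ Y w δ lam τ r t ν) :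
    1 - Real.exp (-t) - |∫ ω in {ω | Y ω ≤ r ^ 2}, δ ω ∂μ| ≤ ∫ ω, w ω ∂μ := by
  have hδ := H.integrableOn_of_abs_le H.measurable fun ω hω => H.abs_le_const hω
  have h1 : ∫ ω in {ω | Y ω ≤ r ^ 2}, (1 + δ ω) ∂μ ≤ ∫ ω in {ω | Y ω ≤ r ^ 2}, w ω ∂μ := by
    refine setIntegral_mono_on ((integrable_const 1).add hδ) H.integrable.integrableOn
      (H.measurableSet r) fun ω hω => ?_
    rw [H.eq_exp ω hω]
    linarith [Real.add_one_le_exp (δ ω)]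
  rw [integral_add (integrable_const 1) hδ] at h1
  have h2 := setIntegral_le_integral (s := {ω | Y ω ≤ r ^ 2}) H.integrable (.of_forall H.nonneg)
  have h3 := probReal_compl_eq_one_sub (μ := μ) (H.measurableSet r)
  have h4 := H.measure_compl_le
  have h5 : ∫ _ in {ω | Y ω ≤ r ^ 2}, (1 : ℝ) ∂μ = μ.real {ω | Y ω ≤ r ^ 2} := by simp
  have h6 := neg_abs_le (∫ ω in {ω | Y ω ≤ r ^ 2}, δ ω ∂μ)
  linarith

/-- If the claimed bound is at least `1` it is trivial. Otherwise `4 e^{-t} < 1` forces `t ≥ 1`, and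
the normalising constant is at least `1 - (B + 4 e^{-t}) / 4 ≥ 3/4`. The two tails add up to `(5/3 +
1) e^{-t}`, which is at most `3/4 · 4 e^{-t}`. -/
lemma abs_sub_le_of_bounds [IsProbabilityMeasure μ] (H : IsLaplaceDensity μ Y w δ lam τ r t ν)
    (hA : MeasurableSet A) {a b B : ℝ} (hB : 0 ≤ B)
    (ha : |∫ ω in {ω | Y ω ≤ r ^ 2}, (w ω - 1) * (A.indicator (fun _ => (1 : ℝ)) ω - μ.real A) ∂μ|
      ≤ a)
    (hb : |∫ ω in {ω | Y ω ≤ r ^ 2}, δ ω ∂μ| ≤ b) (haB : a ≤ 3 / 4 * B) (hbB : b ≤ B / 4) :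
    |(∫ ω in A, w ω ∂μ) / (∫ ω, w ω ∂μ) - μ.real A| ≤ B + 4 * Real.exp (-t) := by
  rcases le_or_gt 1 (B + 4 * Real.exp (-t)) with h | h
  · exact (abs_setIntegral_div_sub_le_one H.integrable H.nonneg A).trans h
  have ht : 1 ≤ t := by
    by_contra! ht
    have h1 : Real.exp (-1) ≤ Real.exp (-t) := Real.exp_le_exp.2 (by linarith)
    have h2 := Real.exp_neg_one_gt_d9
    linarith
  have hZ : 3 / 4 ≤ ∫ ω, w ω ∂μ := by
    have := H.le_integral
    linarith
  refine (abs_setIntegral_div_sub_le H.integrable H.nonneg hA (H.measurableSet r)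
    (by linarith)).trans ?_
  have h1 := H.setIntegral_compl_le ht
  have h2 := H.measure_compl_le
  have h3 := Real.exp_pos (-t)
  rw [div_le_iff₀ (by linarith)]
  have h4 := mul_le_mul_of_nonneg_left hZ (by linarith : 0 ≤ B + 4 * Real.exp (-t))
  linarith

theorem abs_sub_le [IsProbabilityMeasure μ] (H : IsLaplaceDensity μ Y w δ lam τ r t ν)
    (hA : MeasurableSet A) :
    |(∫ ω in A, w ω ∂μ) / (∫ ω, w ω ∂μ) - μ.real A| ≤
      2 * τ * √((∑ i, lam i + 1) ^ 3) + 4 * Real.exp (-t) := by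
  obtain ⟨hI, hIle⟩ := H.chiSq.integral_mul_sqrt_le H.ω_le H.ω_mul_le
  have hτ := H.τ_nonneg
  set x := √((∑ i, lam i + 1) ^ 3)
  have hx : 0 ≤ x := Real.sqrt_nonneg _
  have hK : Integrable (fun ω => τ / 6 * (Y ω * √(Y ω) * Real.exp (τ * r / 3 * (Y ω / 2)))) μ :=
    hI.const_mul _
  have hK0 : ∀ ω, 0 ≤ τ / 6 * (Y ω * √(Y ω) * Real.exp (τ * r / 3 * (Y ω / 2))) := fun ω => by
    have := H.chiSq.nonneg ω
    positivity
  have hKle : ∫ ω, τ / 6 * (Y ω * √(Y ω) * Real.exp (τ * r / 3 * (Y ω / 2))) ∂μ ≤ τ * x / 2 := by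
    rw [integral_const_mul]
    calc _ ≤ τ / 6 * (3 * x) := by gcongr
      _ = _ := by ring
  -- Here `B = 2 τ x`; the requirement `b ≤ B / 4` is tight and fixes the factor `2` of the final
  -- bound.
  refine H.abs_sub_le_of_bounds hA (a := τ * x / 2) (b := τ * x / 2) (by positivity)
    ((H.abs_setIntegral_le hK hK0 fun ω hω => ?_).trans hKle)
    ((H.abs_setIntegral_le hK hK0 fun ω hω => ?_).trans hKle) (by nlinarith [mul_nonneg hτ hx])
    (by linarith)
  · rw [abs_mul, H.eq_exp ω hω]
    refine (mul_le_of_le_one_right (abs_nonneg _) (abs_indicator_sub_le A ω)).trans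
      ((abs_exp_sub_one_le_mul_exp _).trans ?_)
    have h1 := H.abs_le ω hω
    have h2 := Real.exp_le_exp.2 (H.abs_le_quadratic hω)
    have := H.chiSq.nonneg ω
    rw [← mul_assoc]
    gcongr
  · refine (H.abs_le ω hω).trans ?_
    have := H.chiSq.nonneg ω
    have h1 : 1 ≤ Real.exp (τ * r / 3 * (Y ω / 2)) :=
      Real.one_le_exp (mul_nonneg H.ω_nonneg (by linarith))
    refine mul_le_mul_of_nonneg_left ?_ (by positivity)
    exact le_mul_of_one_le_right (by positivity) h1

lemma setIntegral_mul_eq_of_symm (H : IsLaplaceDensity μ Y w δ lam τ r t ν) {N : Ω ≃ᵐ Ω}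
    (hN : MeasurePreserving N μ μ) (hY : ∀ ω, Y (N ω) = Y ω) {φ : Ω → ℝ}
    (hφ : ∀ ω, φ (N ω) = φ ω)
    (h1 : IntegrableOn (fun ω => δ ω * φ ω) {ω | Y ω ≤ r ^ 2} μ) :
    ∫ ω in {ω | Y ω ≤ r ^ 2}, δ ω * φ ω ∂μ =
      ∫ ω in {ω | Y ω ≤ r ^ 2}, (δ ω + δ (N ω)) / 2 * φ ω ∂μ := by
  have hpre : N ⁻¹' {ω | Y ω ≤ r ^ 2} = {ω | Y ω ≤ r ^ 2} := by ext ω; simp [hY]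
  have hNr : MeasurePreserving N (μ.restrict {ω | Y ω ≤ r ^ 2})
      (μ.restrict {ω | Y ω ≤ r ^ 2}) := by
    have := hN.restrict_preimage (H.measurableSet r)
    rwa [hpre] at this
  have h2 := hNr.integral_comp' (fun ω => δ ω * φ ω)
  have h3 : IntegrableOn (fun ω => δ (N ω) * φ (N ω)) {ω | Y ω ≤ r ^ 2} μ :=
    (hNr.integrable_comp_emb N.measurableEmbedding).2 h1
  simp only [hφ] at h2 h3
  have h4 : ∀ ω, (δ ω + δ (N ω)) / 2 * φ ω = 1 / 2 * (δ ω * φ ω) + 1 / 2 * (δ (N ω) * φ ω) :=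
    fun ω => by ring
  simp only [h4]
  rw [integral_add (h1.const_mul _) (h3.const_mul _), integral_const_mul, integral_const_mul, h2]
  ring

theorem abs_sub_le_of_symm [IsProbabilityMeasure μ] (H : IsLaplaceDensity μ Y w δ lam τ r t ν)
    {N : Ω ≃ᵐ Ω} (hN : MeasurePreserving N μ μ) (hY : ∀ ω, Y (N ω) = Y ω) (hτ₄ : 0 ≤ τ₄)
    (hδ : ∀ ω, Y ω ≤ r ^ 2 → |δ ω + δ (N ω)| ≤ τ₄ / 12 * Y ω ^ 2)
    (hA : MeasurableSet A) (hAN : ∀ ω, N ω ∈ A ↔ ω ∈ A) :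
    |(∫ ω in A, w ω ∂μ) / (∫ ω, w ω ∂μ) - μ.real A| ≤
      τ ^ 2 * (∑ i, lam i + 2) ^ 3 / 2 + τ₄ * (∑ i, lam i + 1) ^ 2 + 4 * Real.exp (-t) := by
  have hτ := H.τ_nonneg
  have hP0 : 0 ≤ ∑ i, lam i := Finset.sum_nonneg fun i _ => H.chiSq.lam_nonneg i
  have hω1 : τ * r / 3 < 1 := by linarith [H.ω_le]
  have hI2 : Integrable (fun ω => τ₄ / 24 * Y ω ^ 2) μ := by
    have := H.chiSq.integrable_pow zero_lt_one 2
    simp only [zero_mul, Real.exp_zero, mul_one] at this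
    exact this.const_mul _
  have hI2le : ∫ ω, τ₄ / 24 * Y ω ^ 2 ∂μ ≤ τ₄ / 8 * (∑ i, lam i + 1) ^ 2 := by
    have := H.chiSq.integral_sq_le (s := 0) (by norm_num) (by norm_num)
    simp only [zero_mul, Real.exp_zero, mul_one] at this
    rw [integral_const_mul]
    calc _ ≤ τ₄ / 24 * (3 * (∑ i, lam i + 1) ^ 2) := by gcongr
      _ = _ := by ring
  have hI3 : Integrable (fun ω => τ ^ 2 / 36 * (Y ω ^ 3 * Real.exp (τ * r / 3 * (Y ω / 2)))) μ :=
    (H.chiSq.integrable_pow hω1 3).const_mul _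
  have hI3le : ∫ ω, τ ^ 2 / 36 * (Y ω ^ 3 * Real.exp (τ * r / 3 * (Y ω / 2))) ∂μ ≤
      τ ^ 2 / 9 * (∑ i, lam i + 2) ^ 3 := by
    have := H.chiSq.integral_cube_le H.ω_le H.ω_mul_le
    rw [integral_const_mul]
    calc _ ≤ τ ^ 2 / 36 * (4 * (∑ i, lam i + 2) ^ 3) := by gcongr
      _ = _ := by ring
  have hδm := H.measurable
  have hNm := N.measurable
  -- Used twice: with the centred indicator for the main term, and with `φ = 1` for the normalising
  -- constant.
  have hlin : ∀ φ : Ω → ℝ, Measurable φ → (∀ ω, |φ ω| ≤ 1) → (∀ ω, φ (N ω) = φ ω) →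
      IntegrableOn (fun ω => δ ω * φ ω) {ω | Y ω ≤ r ^ 2} μ ∧
      |∫ ω in {ω | Y ω ≤ r ^ 2}, δ ω * φ ω ∂μ| ≤ τ₄ / 8 * (∑ i, lam i + 1) ^ 2 := by
    intro φ hφm hφ1 hφN
    have hi : IntegrableOn (fun ω => δ ω * φ ω) {ω | Y ω ≤ r ^ 2} μ :=
      H.integrableOn_of_abs_le (by fun_prop) fun ω hω => by
        rw [abs_mul]
        exact (mul_le_of_le_one_right (abs_nonneg _) (hφ1 ω)).trans (H.abs_le_const hω)
    refine ⟨hi, ?_⟩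
    rw [H.setIntegral_mul_eq_of_symm hN hY hφN hi]
    refine (H.abs_setIntegral_le hI2 (fun ω => by positivity) fun ω hω => ?_).trans hI2le
    rw [abs_mul, abs_div, abs_two]
    refine (mul_le_of_le_one_right (by positivity) (hφ1 ω)).trans ?_
    linarith [hδ ω hω]
  set φ : Ω → ℝ := fun ω => A.indicator (fun _ => (1 : ℝ)) ω - μ.real A with hφ
  have hφm : Measurable φ := measurable_indicator_sub hA
  have hφ1 : ∀ ω, |φ ω| ≤ 1 := abs_indicator_sub_le A
  have hφN : ∀ ω, φ (N ω) = φ ω := fun ω => by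
    by_cases h : ω ∈ A <;> simp [hφ, h, hAN]
  obtain ⟨hi, hle⟩ := hlin φ hφm hφ1 hφN
  obtain ⟨-, hle1⟩ := hlin (fun _ => 1) measurable_const (fun _ => by simp) fun _ => rfl
  simp only [mul_one] at hle1
  -- What remains beyond the linear term in `δ` is bounded by `δ² e^{|δ|}` and needs no
  -- cancellation.
  have hquad : ∀ ω, Y ω ≤ r ^ 2 → |(w ω - 1 - δ ω) * φ ω| ≤
      τ ^ 2 / 36 * (Y ω ^ 3 * Real.exp (τ * r / 3 * (Y ω / 2))) := by
    intro ω hω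
    have hy := H.chiSq.nonneg ω
    rw [abs_mul, H.eq_exp ω hω]
    refine (mul_le_of_le_one_right (abs_nonneg _) (hφ1 ω)).trans
      ((abs_exp_sub_one_sub_le_sq_mul_exp _).trans ?_)
    have h1 := H.abs_le ω hω
    have h2 := Real.exp_le_exp.2 (H.abs_le_quadratic hω)
    calc _ ≤ (τ / 6 * (Y ω * √(Y ω))) ^ 2 * Real.exp (τ * r / 3 * (Y ω / 2)) := by
          rw [← sq_abs (δ ω)]
          gcongr
      _ = _ := by
          rw [mul_pow, mul_pow, Real.sq_sqrt hy]; ring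
  have hi2 : IntegrableOn (fun ω => (w ω - 1 - δ ω) * φ ω) {ω | Y ω ≤ r ^ 2} μ := by
    have h1 : IntegrableOn (fun ω => (w ω - 1) * φ ω) {ω | Y ω ≤ r ^ 2} μ :=
      ((H.integrable.sub (integrable_const 1)).mul_bdd (c := 1) hφm.aestronglyMeasurable
        (.of_forall hφ1)).integrableOn
    refine (h1.sub hi).congr (.of_forall fun ω => ?_)
    simp only [Pi.sub_apply]; ring
  refine H.abs_sub_le_of_bounds hA
    (a := τ₄ / 8 * (∑ i, lam i + 1) ^ 2 + τ ^ 2 / 9 * (∑ i, lam i + 2) ^ 3)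
    (by positivity) ?_ hle1 ?_ ?_
  · have e : ∀ ω, (w ω - 1) * φ ω = δ ω * φ ω + (w ω - 1 - δ ω) * φ ω := fun ω => by ring
    change |∫ ω in {ω | Y ω ≤ r ^ 2}, (w ω - 1) * φ ω ∂μ| ≤ _
    simp only [e]
    rw [integral_add hi hi2]
    refine (abs_add_le _ _).trans (add_le_add hle ?_)
    exact (H.abs_setIntegral_le hI3 (fun ω => by have := H.chiSq.nonneg ω; positivity)
      hquad).trans hI3le
  · have h1 : 0 ≤ τ ^ 2 * (∑ i, lam i + 2) ^ 3 := by positivity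
    have h2 : 0 ≤ τ₄ * (∑ i, lam i + 1) ^ 2 := by positivity
    linarith
  · have h1 : 0 ≤ τ ^ 2 * (∑ i, lam i + 2) ^ 3 := by positivity
    have h2 : 0 ≤ τ₄ * (∑ i, lam i + 1) ^ 2 := by positivity
    linarith

end IsLaplaceDensity

end TV

/-! ### Gibbs measures -/

section Gibbs

variable {g : EuclideanSpace ℝ (Fin p) → ℝ}

lemma gibbs_real (hgm : Measurable g) (hg : Integrable fun x => Real.exp (g x))
    {C : Set (EuclideanSpace ℝ (Fin p))} (hC : MeasurableSet C) :
    (gibbs g).real C = (∫ x, Real.exp (g x))⁻¹ * ∫ x, C.indicator (fun x => Real.exp (g x)) x := by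
  have := isProbabilityMeasure_gibbs hg
  rw [← integral_indicator_one hC, integral_gibbs hgm hg]
  congr 2; funext x
  by_cases h : x ∈ C <;> simp [h]

lemma measurePreserving_neg_gibbs (hgm : Measurable g) (heven : ∀ x, g (-x) = g x) :
    MeasurePreserving (MeasurableEquiv.neg (EuclideanSpace ℝ (Fin p))) (gibbs g) (gibbs g) := by
  refine ⟨(MeasurableEquiv.neg _).measurable, Measure.ext fun C hC => ?_⟩
  have hC' : MeasurableSet (MeasurableEquiv.neg (EuclideanSpace ℝ (Fin p)) ⁻¹' C) :=
    (MeasurableEquiv.neg _).measurable hC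
  rw [Measure.map_apply (MeasurableEquiv.neg _).measurable hC, gibbs_eq, Measure.smul_apply,
    Measure.smul_apply, withDensity_apply _ hC', withDensity_apply _ hC,
    ← lintegral_indicator hC', ← lintegral_indicator hC]
  congr 1
  have hm : Measurable fun x => ENNReal.ofReal (Real.exp (g x)) := by fun_prop
  rw [← (Measure.measurePreserving_neg
    (volume : Measure (EuclideanSpace ℝ (Fin p)))).lintegral_comp (hm.indicator hC)]
  congr 1; funext x
  by_cases h : -x ∈ C <;> simp [Set.indicator, h, heven]

end Gibbs

/-- `P(B) - P(B | S) = P(B \ S) - P(Sᶜ) P(B | S)`, a difference of two numbers in `[0, P(Sᶜ)]`. If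
`P(S) = 0` the conditional measure is zero and `P(Sᶜ) = 1`. -/
lemma abs_real_sub_cond_real_le {Ω : Type*} [MeasurableSpace Ω] (P : Measure Ω)
    [IsProbabilityMeasure P] {S : Set Ω} (hS : MeasurableSet S) (B : Set Ω) :
    |P.real B - (ProbabilityTheory.cond P S).real B| ≤ P.real Sᶜ := by
  have hc : (ProbabilityTheory.cond P S).real B = (P.real S)⁻¹ * P.real (S ∩ B) := by
    rw [measureReal_def, cond_apply hS, ENNReal.toReal_mul, ENNReal.toReal_inv]; rfl
  have h1 : P.real (B ∩ S) + P.real (B \ S) = P.real B := measureReal_inter_add_sdiff hS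
  have h2 : P.real (B \ S) ≤ P.real Sᶜ := measureReal_mono fun x hx => hx.2
  have h3 := probReal_compl_eq_one_sub (μ := P) hS
  have h4 : P.real (S ∩ B) ≤ P.real S := measureReal_mono Set.inter_subset_left
  have h5 : 0 ≤ P.real (S ∩ B) := measureReal_nonneg
  have h6 : 0 ≤ P.real (B \ S) := measureReal_nonneg
  have h7 : P.real S ≤ 1 := measureReal_le_one
  rw [Set.inter_comm] at h1
  rcases (measureReal_nonneg (μ := P) (s := S)).eq_or_lt with h | h
  · rw [hc, ← h, inv_zero, zero_mul, sub_zero, abs_le]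
    constructor <;> linarith
  · have h8 : (P.real S)⁻¹ * P.real (S ∩ B) ≤ 1 := by
      rw [inv_mul_le_iff₀ h]; linarith
    have h9 : P.real (S ∩ B) = P.real S * ((P.real S)⁻¹ * P.real (S ∩ B)) := by
      field_simp
    have h10 : 0 ≤ (P.real S)⁻¹ * P.real (S ∩ B) := by positivity
    rw [hc, abs_le]
    constructor <;> nlinarith

/-! ### The posterior as a perturbed Gaussian -/

section Core

variable {l f : EuclideanSpace ℝ (Fin p) → ℝ} {x₀ xG : EuclideanSpace ℝ (Fin p)}
  {G : EuclideanSpace ℝ (Fin p) →L[ℝ] EuclideanSpace ℝ (Fin p)}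
  {S : Set (EuclideanSpace ℝ (Fin p))}

lemma contDiff_penalized (hl : ContDiff ℝ 3 l) (hf : ∀ x, f x = l x - ‖G (x - x₀)‖ ^ 2 / 2) :
    ContDiff ℝ 3 f := by
  rw [show f = fun x => l x - ‖G (x - x₀)‖ ^ 2 / 2 from funext hf]
  exact hl.sub (((G.contDiff.comp (contDiff_id.sub contDiff_const)).norm_sq ℝ).div_const 2)

lemma dirDeriv_one_penalized (hl : ContDiff ℝ 3 l)
    (hf : ∀ x, f x = l x - ‖G (x - x₀)‖ ^ 2 / 2) (x u : EuclideanSpace ℝ (Fin p)) :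
    dirDeriv 1 f x u = dirDeriv 1 l x u - inner ℝ (G (x - x₀)) (G u) := by
  refine dirDeriv_eq_of_hasDerivAt (k := 0) (N := 3) (contDiff_penalized hl hf) (by norm_num)
    (fun y => hf y) ?_
  have := (hasDerivAt_dirDeriv (k := 0) (N := 3) hl (by norm_num) x u 0).fun_sub
    (hasDerivAt_penalty G x₀ x u 0)
  simpa [dirDeriv_zero] using this

lemma negHessForm_penalized (hl : ContDiff ℝ 3 l)
    (hf : ∀ x, f x = l x - ‖G (x - x₀)‖ ^ 2 / 2) (x u : EuclideanSpace ℝ (Fin p)) :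
    negHessForm f x u = negHessForm l x u + ‖G u‖ ^ 2 := by
  rw [negHessForm_eq (N := 3) (contDiff_penalized hl hf) (by norm_num),
    negHessForm_eq (N := 3) hl (by norm_num)]
  have : dirDeriv 2 f x u = dirDeriv 2 l x u - ‖G u‖ ^ 2 := by
    refine dirDeriv_eq_of_hasDerivAt (k := 1) (N := 3) (contDiff_penalized hl hf) (by norm_num)
      (fun y => dirDeriv_one_penalized hl hf y u) ?_
    have := (hasDerivAt_dirDeriv (k := 1) (N := 3) hl (by norm_num) x u 0).fun_sub
      (hasDerivAt_inner_penalty G x₀ x u 0)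
    simpa using this
  rw [this]; ring

lemma negHessForm_smul (g : EuclideanSpace ℝ (Fin p) → ℝ) (x u : EuclideanSpace ℝ (Fin p)) (c : ℝ) :
    negHessForm g x (c • u) = c ^ 2 * negHessForm g x u := by
  simp only [negHessForm, map_smul, inner_smul_left, inner_smul_right, RCLike.conj_to_real]
  ring

lemma dirDeriv_one_eq_zero (hmax : IsMaxOn f Set.univ xG)
    (u : EuclideanSpace ℝ (Fin p)) : dirDeriv 1 f xG u = 0 := by
  have h : IsLocalMax f xG := hmax.isLocalMax Filter.univ_mem
  rw [dirDeriv_one, h.fderiv_eq_zero]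
  rfl

/-- The remainder of the second order Taylor expansion of `f` at its maximizer. -/
noncomputable def remainder (f : EuclideanSpace ℝ (Fin p) → ℝ) (x u : EuclideanSpace ℝ (Fin p)) : ℝ :=
  f (x + u) - f x + negHessForm f x u / 2

/-- The penalty equals its own second order expansion and `∇f(xG) = 0`, so only the Taylor remainder
of `ℓ` survives. -/
lemma remainder_eq (hl : ContDiff ℝ 3 l) (hf : ∀ x, f x = l x - ‖G (x - x₀)‖ ^ 2 / 2)
    (hmax : IsMaxOn f Set.univ xG) (u : EuclideanSpace ℝ (Fin p)) :
    remainder f xG u = l (xG + u) - l xG - dirDeriv 1 l xG u - dirDeriv 2 l xG u / 2 := by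
  have h1 := dirDeriv_one_eq_zero hmax u
  rw [dirDeriv_one_penalized hl hf] at h1
  have h2 : ‖G (xG + u - x₀)‖ ^ 2 =
      ‖G (xG - x₀)‖ ^ 2 + 2 * inner ℝ (G (xG - x₀)) (G u) + ‖G u‖ ^ 2 := by
    rw [show xG + u - x₀ = (xG - x₀) + u by abel, map_add, norm_add_sq_real]
  rw [remainder, negHessForm_penalized hl hf, negHessForm_eq (N := 3) hl (by norm_num), hf, hf, h2]
  linarith

lemma add_smul_mem_localSet {u : EuclideanSpace ℝ (Fin p)} {r s : ℝ}
    (hs : s ^ 2 * negHessForm l xG u ≤ r ^ 2) : xG + s • u ∈ localSet l xG r := by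
  change negHessForm l xG (xG + s • u - xG) ≤ r ^ 2
  rwa [add_sub_cancel_left, negHessForm_smul]

lemma abs_remainder_le (hl : ContDiff ℝ 3 l) (hf : ∀ x, f x = l x - ‖G (x - x₀)‖ ^ 2 / 2)
    (hmax : IsMaxOn f Set.univ xG) (hD0 : ∀ u, 0 ≤ negHessForm l xG u) {τ r : ℝ}
    (h3 : ∀ x ∈ localSet l xG r, ∀ u,
      |dirDeriv 3 l x u| ≤ τ * (negHessForm l xG u * √(negHessForm l xG u)))
    {u : EuclideanSpace ℝ (Fin p)} (hu : negHessForm l xG u ≤ r ^ 2) :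
    |remainder f xG u| ≤ τ / 6 * (negHessForm l xG u * √(negHessForm l xG u)) := by
  have h := (taylor_two_bounds zero_le_one
    (hasDerivAt_dirDeriv (k := 0) (N := 3) hl (by norm_num) xG u)
    (hasDerivAt_dirDeriv (k := 1) (N := 3) hl (by norm_num) xG u)
    (hasDerivAt_dirDeriv (k := 2) (N := 3) hl (by norm_num) xG u) fun s hs =>
      h3 _ (add_smul_mem_localSet ?_) u).1
  · simp only [dirDeriv_zero, one_smul, zero_smul, add_zero, one_mul, one_pow, mul_one] at h
    rw [remainder_eq hl hf hmax]
    calc _ = |l (xG + u) - l xG - dirDeriv 1 l xG u - 1 / 2 * dirDeriv 2 l xG u| := by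
          congr 1; ring
      _ ≤ _ := h
      _ = _ := by ring
  · have : s ^ 2 ≤ 1 := pow_le_one₀ hs.1 hs.2
    exact (mul_le_of_le_one_left (hD0 u) this).trans hu

lemma abs_remainder_add_neg_le (hl : ContDiff ℝ 4 l)
    (hf : ∀ x, f x = l x - ‖G (x - x₀)‖ ^ 2 / 2)
    (hmax : IsMaxOn f Set.univ xG) (hD0 : ∀ u, 0 ≤ negHessForm l xG u) {τ₄ r : ℝ}
    (h4 : ∀ x ∈ localSet l xG r, ∀ u, |dirDeriv 4 l x u| ≤ τ₄ * negHessForm l xG u ^ 2)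
    {u : EuclideanSpace ℝ (Fin p)} (hu : negHessForm l xG u ≤ r ^ 2) :
    |remainder f xG u + remainder f xG (-u)| ≤ τ₄ / 12 * negHessForm l xG u ^ 2 := by
  have hl3 : ContDiff ℝ 3 l := hl.of_le (by norm_num)
  have h := taylor_even_bound zero_le_one
    (hasDerivAt_dirDeriv (k := 0) (N := 4) hl (by norm_num) xG u)
    (hasDerivAt_dirDeriv (k := 1) (N := 4) hl (by norm_num) xG u)
    (hasDerivAt_dirDeriv (k := 2) (N := 4) hl (by norm_num) xG u)
    (hasDerivAt_dirDeriv (k := 3) (N := 4) hl (by norm_num) xG u) fun s hs =>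
      h4 _ (add_smul_mem_localSet ?_) u
  · simp only [dirDeriv_zero, one_smul, zero_smul, add_zero, one_mul, one_pow, mul_one,
      neg_smul] at h
    rw [remainder_eq hl3 hf hmax, remainder_eq hl3 hf hmax, ← neg_one_smul ℝ u, dirDeriv_smul,
      dirDeriv_smul, neg_one_smul]
    calc _ = |l (xG + u) + l (xG + -u) - 2 * l xG - dirDeriv 2 l xG u| := by
          congr 1; ring
      _ ≤ _ := h
      _ = _ := by ring
  · have : s ^ 2 ≤ 1 := (sq_le_one_iff_abs_le_one s).2 (abs_le.2 hs)
    exact (mul_le_of_le_one_left (hD0 u) this).trans hu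

/-- Along the ray from `xG`, a concave `ℓ` lies below its tangent at the exit point of the
ellipsoid, `s₀ = r / R` with `R = √Y`. Value and slope there come from the third order Taylor
bounds. The derivative bound is therefore needed only inside the ellipsoid. -/
lemma remainder_le_of_concaveOn (hl : ContDiff ℝ 3 l)
    (hf : ∀ x, f x = l x - ‖G (x - x₀)‖ ^ 2 / 2)
    (hmax : IsMaxOn f Set.univ xG) {τ r a : ℝ} (hr : 0 < r) (ha : a ≤ (1 - τ * r / 2) * r)
    (h3 : ∀ x ∈ localSet l xG r, ∀ u,
      |dirDeriv 3 l x u| ≤ τ * (negHessForm l xG u * √(negHessForm l xG u)))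
    (hconc : ConcaveOn ℝ S l) (hxG : xG ∈ S) {u : EuclideanSpace ℝ (Fin p)} (huS : xG + u ∈ S)
    (hu : r ^ 2 < negHessForm l xG u) :
    remainder f xG u ≤ negHessForm l xG u / 2 - (1 - τ * r / 3) * r ^ 2 / 2
      - (√(negHessForm l xG u) - r) * a := by
  have hY : 0 < negHessForm l xG u := (sq_nonneg r).trans_lt hu
  set R := √(negHessForm l xG u) with hR
  have hR0 : 0 < R := Real.sqrt_pos.2 hY
  have hR2 : R ^ 2 = negHessForm l xG u := Real.sq_sqrt hY.le
  have hrR : r < R := Real.lt_sqrt_of_sq_lt hu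
  set s₀ := r / R with hs₀
  have hs0 : 0 < s₀ := by positivity
  have hs1 : s₀ < 1 := (div_lt_one hR0).2 hrR
  have hsR : s₀ * R = r := by rw [hs₀]; field_simp
  have h2 : dirDeriv 2 l xG u = -R ^ 2 := by
    rw [hR2, negHessForm_eq (N := 3) hl (by norm_num), neg_neg]
  obtain ⟨t0, t1⟩ := taylor_two_bounds hs0.le
    (hasDerivAt_dirDeriv (k := 0) (N := 3) hl (by norm_num) xG u)
    (hasDerivAt_dirDeriv (k := 1) (N := 3) hl (by norm_num) xG u)
    (hasDerivAt_dirDeriv (k := 2) (N := 3) hl (by norm_num) xG u)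
    (K := τ * (R ^ 2 * R)) fun s hs => by
      have := h3 _ (add_smul_mem_localSet (u := u) (s := s) (r := r) ?_) u
      · rwa [← hR, ← hR2] at this
      · rw [← hR2, ← hsR, mul_pow]
        have := hs.1
        have := hs.2
        gcongr
  simp only [dirDeriv_zero, zero_smul, add_zero, h2] at t0 t1
  set g : ℝ → ℝ := fun s => l (xG + s • u) with hg
  have hgc : ConcaveOn ℝ (Set.Icc (0 : ℝ) 1) g := by
    have h := hconc.comp_affineMap (AffineMap.lineMap (k := ℝ) xG (xG + u))
    have e : l ∘ AffineMap.lineMap (k := ℝ) xG (xG + u) = g := by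
      funext s
      simp [hg, AffineMap.lineMap_apply, add_comm]
    rw [e] at h
    refine h.subset (fun s hs => ?_) (convex_Icc 0 1)
    exact hconc.1.lineMap_mem hxG huS hs
  have hslope := hgc.slope_le_of_hasDerivAt (Set.mem_Icc.2 ⟨hs0.le, hs1.le⟩)
    (Set.right_mem_Icc.2 zero_le_one) hs1
    (hasDerivAt_dirDeriv (k := 0) (N := 3) hl (by norm_num) xG u s₀)
  rw [slope_def_field, div_le_iff₀ (by linarith)] at hslope
  simp only [hg, one_smul, zero_add] at hslope
  rw [remainder_eq hl hf hmax, h2, ← hR2]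
  have b0 := (abs_le.1 t0).2
  have b1 := (abs_le.1 t1).2
  have e3 : τ * (R ^ 2 * R) / 6 * s₀ ^ 3 = τ / 6 * r ^ 3 := by rw [← hsR]; ring
  have e4 : τ * (R ^ 2 * R) / 2 * s₀ ^ 2 = τ / 2 * r ^ 2 * R := by rw [← hsR]; ring
  have e5 : s₀ ^ 2 / 2 * -R ^ 2 = -(r ^ 2 / 2) := by rw [← hsR]; ring
  have e6 : s₀ * -R ^ 2 = -(r * R) := by rw [← hsR]; ring
  rw [e3, e5] at b0
  rw [e4, e6] at b1
  have b2 : (1 - s₀) * (dirDeriv 1 l (xG + s₀ • u) u - dirDeriv 1 l xG u)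
      ≤ (1 - s₀) * (-(r * R) + τ / 2 * r ^ 2 * R) :=
    mul_le_mul_of_nonneg_left (by linarith) (by linarith)
  have e7 : (1 - s₀) * (-(r * R) + τ / 2 * r ^ 2 * R) = -((R - r) * ((1 - τ * r / 2) * r)) := by
    have : (1 - s₀) * R = R - r := by rw [sub_mul, hsR, one_mul]
    rw [← this]; ring
  have b3 := mul_le_mul_of_nonneg_left ha (sub_nonneg.2 hrR.le)
  rw [e7] at b2
  nlinarith

/-- The density of the posterior, conditioned on `S` and centred at `xG`, relative to the
Laplace approximation, up to a constant factor. -/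
noncomputable def relDensity (f : EuclideanSpace ℝ (Fin p) → ℝ) (x : EuclideanSpace ℝ (Fin p))
    (S : Set (EuclideanSpace ℝ (Fin p))) (u : EuclideanSpace ℝ (Fin p)) : ℝ :=
  ((fun u => x + u) ⁻¹' S).indicator (fun u => Real.exp (remainder f x u)) u

lemma exp_mul_relDensity (f : EuclideanSpace ℝ (Fin p) → ℝ) (x : EuclideanSpace ℝ (Fin p))
    (S : Set (EuclideanSpace ℝ (Fin p))) (u : EuclideanSpace ℝ (Fin p)) :
    Real.exp (-(negHessForm f x u / 2)) * relDensity f x S u =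
      Real.exp (-f x) * S.indicator (fun y => Real.exp (f y)) (x + u) := by
  by_cases h : x + u ∈ S
  · simp only [relDensity, Set.indicator_of_mem h, Set.indicator_of_mem (show u ∈ _ ⁻¹' S from h)]
    rw [← Real.exp_add, ← Real.exp_add, remainder]
    congr 1; ring
  · simp [relDensity, h]

lemma measurable_negHessForm (g : EuclideanSpace ℝ (Fin p) → ℝ) (x : EuclideanSpace ℝ (Fin p)) :
    Measurable fun u => negHessForm g x u := by
  unfold negHessForm
  fun_prop

lemma integrable_relDensity (hfi : Integrable fun x => Real.exp (f x))
    (hS : MeasurableSet S) (x : EuclideanSpace ℝ (Fin p))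
    (hQ : Integrable fun u => Real.exp (-(negHessForm f x u / 2))) :
    Integrable (relDensity f x S) (laplaceGaussian f x) := by
  have hm := measurable_negHessForm f x
  rw [laplaceGaussian, integrable_gibbs_iff (by fun_prop) hQ]
  simp only [exp_mul_relDensity]
  exact ((hfi.indicator hS).comp_add_left x).const_mul _

/-- The constant does not depend on `A`, so it drops out of conditional probabilities. -/
lemma exists_gibbs_real_eq (hfm : Measurable f) (hfi : Integrable fun x => Real.exp (f x))
    (hS : MeasurableSet S) (x : EuclideanSpace ℝ (Fin p))
    (hQ : Integrable fun u => Real.exp (-(negHessForm f x u / 2))) :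
    ∃ c : ℝ, 0 < c ∧ ∀ A, MeasurableSet A →
      (gibbs f).real (S ∩ (fun y => y - x) ⁻¹' A) =
        c * ∫ u in A, relDensity f x S u ∂(laplaceGaussian f x) := by
  have hm := measurable_negHessForm f x
  have h1 := integral_exp_pos hfi
  have h2 := integral_exp_pos hQ
  refine ⟨(∫ x, Real.exp (f x))⁻¹ * Real.exp (f x) *
    ∫ u, Real.exp (-(negHessForm f x u / 2)), by positivity, fun A hA => ?_⟩
  have hB : MeasurableSet ((fun y => y - x) ⁻¹' A) := (measurable_id.sub_const x) hA
  rw [gibbs_real hfm hfi (hS.inter hB), ← integral_indicator hA, laplaceGaussian,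
    integral_gibbs (by fun_prop) hQ,
    ← integral_add_left_eq_self (μ := volume)
      ((S ∩ (fun y => y - x) ⁻¹' A).indicator fun y => Real.exp (f y)) x]
  have e : ∀ u, (S ∩ (fun y => y - x) ⁻¹' A).indicator (fun y => Real.exp (f y)) (x + u) =
      Real.exp (f x) *
        (Real.exp (-(negHessForm f x u / 2)) * A.indicator (relDensity f x S) u) := by
    intro u
    by_cases hu : u ∈ A
    · rw [Set.indicator_of_mem hu, exp_mul_relDensity, ← mul_assoc, ← Real.exp_add]
      by_cases h : x + u ∈ S <;> simp [Set.indicator, h, hu]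
    · simp [Set.indicator, hu]
  simp only [e]
  rw [integral_const_mul]
  field_simp

lemma laplaceError_cond_eq (hfm : Measurable f) (hfi : Integrable fun x => Real.exp (f x))
    (hS : MeasurableSet S) (x : EuclideanSpace ℝ (Fin p))
    (hQ : Integrable fun u => Real.exp (-(negHessForm f x u / 2)))
    {A : Set (EuclideanSpace ℝ (Fin p))} (hA : MeasurableSet A) :
    laplaceError (ProbabilityTheory.cond (gibbs f) S) f x A =
      |(∫ u in A, relDensity f x S u ∂(laplaceGaussian f x)) /
        (∫ u, relDensity f x S u ∂(laplaceGaussian f x)) - (laplaceGaussian f x).real A| := by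
  obtain ⟨c, hc, h⟩ := exists_gibbs_real_eq hfm hfi hS x hQ
  have hu := h Set.univ MeasurableSet.univ
  rw [Set.preimage_univ, Set.inter_univ, setIntegral_univ] at hu
  rw [laplaceError, measureReal_def, cond_apply hS, ENNReal.toReal_mul, ENNReal.toReal_inv]
  change |((gibbs f).real S)⁻¹ * (gibbs f).real (S ∩ (fun y => y - x) ⁻¹' A) - _| = _
  rw [hu, h A hA]
  congr 2
  rw [inv_mul_eq_div, mul_div_mul_left _ _ hc.ne']

/-- Since `ℓ ≤ 0`, the posterior density is dominated by the Gaussian prior density. -/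
lemma integrable_exp_penalized (hlc : Continuous l) (hl0 : ∀ x, l x ≤ 0)
    (hf : ∀ x, f x = l x - ‖G (x - x₀)‖ ^ 2 / 2) (hG : Function.Injective G) :
    Integrable fun x => Real.exp (f x) := by
  obtain ⟨c, -, hc⟩ := integral_comp_linearMap
    (Φ := (G : EuclideanSpace ℝ (Fin p) →ₗ[ℝ] EuclideanSpace ℝ (Fin p))) hG
  have h1 : Integrable fun v : EuclideanSpace ℝ (Fin p) => Real.exp (-(‖v‖ ^ 2 / 2)) := by
    have := (gaussian_integral_diag (p := p) (a := fun _ => 1) fun _ => one_pos).1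
    simpa only [one_mul, ← EuclideanSpace.real_norm_sq_eq, neg_div] using this
  have h2 : Integrable fun x : EuclideanSpace ℝ (Fin p) => Real.exp (-(‖G (x - x₀)‖ ^ 2 / 2)) :=
    ((hc _).1.2 h1).comp_sub_right x₀
  have hfc : Continuous f := by
    rw [show f = fun x => l x - ‖G (x - x₀)‖ ^ 2 / 2 from funext hf]
    fun_prop
  refine h2.mono' (by fun_prop) (.of_forall fun x => ?_)
  rw [Real.norm_of_nonneg (Real.exp_pos _).le, Real.exp_le_exp, hf]
  linarith [hl0 x]

theorem exists_isLaplaceDensity (hl : ContDiff ℝ 3 l) (hl0 : ∀ x, l x ≤ 0)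
    (hf : ∀ x, f x = l x - ‖G (x - x₀)‖ ^ 2 / 2) (hG : Function.Injective G)
    (hmax : IsMaxOn f Set.univ xG) (hD0 : ∀ u, 0 ≤ negHessForm l xG u) {τ t ν r : ℝ}
    (ht : 0 < t) (hν : 0 < ν) (hτ : 0 ≤ τ) (hr : r = effRadius l f xG t / ν)
    (hω : τ * r / 3 ≤ 1 / 4) (hων : τ * r / 3 ≤ 1 - ν) (hωP : τ * r / 3 * effDim l f xG ≤ 2 / 3)
    (h3 : ∀ x ∈ localSet l xG r, ∀ u,
      |dirDeriv 3 l x u| ≤ τ * (negHessForm l xG u * √(negHessForm l xG u)))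
    (hS : MeasurableSet S) (hconc : ConcaveOn ℝ S l) (hUS : localSet l xG r ⊆ S) :
    Integrable (fun u => Real.exp (-(negHessForm f xG u / 2))) ∧
    ∃ lam : Fin p → ℝ, ∑ i, lam i = effDim l f xG ∧
      IsLaplaceDensity (laplaceGaussian f xG) (fun u => negHessForm l xG u) (relDensity f xG S)
        (remainder f xG) lam τ r t ν := by
  have hfc := contDiff_penalized hl hf
  have hHD := negHessForm_penalized hl hf xG
  have hGpos : ∀ u, u ≠ 0 → 0 < ‖G u‖ ^ 2 := fun u hu => by
    have : G u ≠ 0 := fun h => hu (hG (h.trans (map_zero G).symm))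
    positivity
  obtain ⟨hQ, lam, hlam, hchi⟩ := isWeightedChiSq_gibbs (D := negHess l xG) (H := negHess f xG)
    (negHess_symm (N := 3) hl (by norm_num) xG) (negHess_symm (N := 3) hfc (by norm_num) xG) hD0
    (fun u => by have := hHD u; unfold negHessForm at this; rw [this]; linarith [sq_nonneg ‖G u‖])
    (fun u hu => by
      have := hHD u
      have h0 := hD0 u
      unfold negHessForm at this h0; rw [this]; linarith [hGpos u hu])
  have hP0 : 0 ≤ ∑ i, lam i := Finset.sum_nonneg fun i _ => hchi.lam_nonneg i
  have hlam' : ∑ i, lam i = effDim l f xG := hlam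
  have hr' : r = (2 * √(∑ i, lam i) + √(2 * t)) / ν := by rw [hr, effRadius, hlam']
  have hθ : 0 < √(2 * t) := Real.sqrt_pos.2 (by linarith)
  have hq : 0 ≤ √(∑ i, lam i) := Real.sqrt_nonneg _
  have hr0 : 0 < r := by rw [hr']; exact div_pos (by linarith) hν
  have hω0 : 0 ≤ τ * r / 3 := by positivity
  have hrq : 2 * √(∑ i, lam i) ≤ r := by
    have : ν * r = 2 * √(∑ i, lam i) + √(2 * t) := by rw [hr', mul_div_cancel₀ _ hν.ne']
    nlinarith
  have hxG : xG ∈ S := hUS (by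
    have := add_smul_mem_localSet (l := l) (xG := xG) (u := 0) (r := r) (s := 0)
      (by simp [sq_nonneg])
    simpa using this)
  refine ⟨hQ, lam, hlam', ?_⟩
  have hfm : Measurable f := hfc.continuous.measurable
  have hfi := integrable_exp_penalized hl.continuous hl0 hf hG
  have hmem : ∀ u, negHessForm l xG u ≤ r ^ 2 → xG + u ∈ S := fun u hu => hUS (by
    change negHessForm l xG (xG + u - xG) ≤ r ^ 2
    rwa [add_sub_cancel_left])
  exact
    { chiSq := hchi
      measurable := by
        have := measurable_negHessForm f xG
        unfold remainder
        fun_prop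
      integrable := integrable_relDensity hfi hS xG hQ
      nonneg := fun u => Set.indicator_nonneg (fun _ _ => (Real.exp_pos _).le) _
      t_pos := ht
      ν_pos := hν
      τ_nonneg := hτ
      r_eq := hr'
      ω_le := hω
      ω_le_sub := hων
      ω_mul_le := by rwa [hlam']
      eq_exp := fun u hu => Set.indicator_of_mem (show u ∈ _ ⁻¹' S from hmem u hu) _
      abs_le := fun u hu => abs_remainder_le hl hf hmax hD0 h3 hu
      tail_le := fun u hu => by
        by_cases h : xG + u ∈ S
        · rw [relDensity, Set.indicator_of_mem (show u ∈ _ ⁻¹' S from h), Real.exp_le_exp]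
          -- The slope `5/4 √P` is admissible: `τ r / 2 = 3/2 ω ≤ 3/8`, so `(1 - τ r / 2) r ≥ 5/8 r
          -- ≥ 5/4 √P` because `r ≥ 2 √P`.
          exact remainder_le_of_concaveOn hl hf hmax hr0 (by nlinarith) h3 hconc hxG h hu
        · rw [relDensity, Set.indicator_of_notMem (show u ∉ _ ⁻¹' S from h)]
          exact (Real.exp_pos _).le }

end Core

/-! ### Laplace approximation of the posterior -/

section Posterior

variable {l f : EuclideanSpace ℝ (Fin p) → ℝ} {x₀ xG : EuclideanSpace ℝ (Fin p)}
  {G : EuclideanSpace ℝ (Fin p) →L[ℝ] EuclideanSpace ℝ (Fin p)}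
  {S : Set (EuclideanSpace ℝ (Fin p))}

theorem laplaceError_cond_le (hl : ContDiff ℝ 3 l) (hl0 : ∀ x, l x ≤ 0)
    (hf : ∀ x, f x = l x - ‖G (x - x₀)‖ ^ 2 / 2) (hG : Function.Injective G)
    (hmax : IsMaxOn f Set.univ xG) (hD0 : ∀ u, 0 ≤ negHessForm l xG u) {τ t ν r : ℝ}
    (ht : 0 < t) (hν : 0 < ν) (hτ : 0 ≤ τ) (hr : r = effRadius l f xG t / ν)
    (hω : τ * r / 3 ≤ 1 / 4) (hων : τ * r / 3 ≤ 1 - ν) (hωP : τ * r / 3 * effDim l f xG ≤ 2 / 3)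
    (h3 : ∀ x ∈ localSet l xG r, ∀ u,
      |dirDeriv 3 l x u| ≤ τ * (negHessForm l xG u * √(negHessForm l xG u)))
    (hS : MeasurableSet S) (hconc : ConcaveOn ℝ S l) (hUS : localSet l xG r ⊆ S)
    {A : Set (EuclideanSpace ℝ (Fin p))} (hA : MeasurableSet A) :
    laplaceError (ProbabilityTheory.cond (gibbs f) S) f xG A ≤
        2 * τ * √((effDim l f xG + 1) ^ 3) + 4 * Real.exp (-t) ∧
    ∀ τ₄, 0 ≤ τ₄ → ContDiff ℝ 4 l →
      (∀ x ∈ localSet l xG r, ∀ u, |dirDeriv 4 l x u| ≤ τ₄ * negHessForm l xG u ^ 2) →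
      (∀ u, u ∈ A ↔ -u ∈ A) →
      laplaceError (ProbabilityTheory.cond (gibbs f) S) f xG A ≤
        τ ^ 2 * (effDim l f xG + 2) ^ 3 / 2 + τ₄ * (effDim l f xG + 1) ^ 2 +
          4 * Real.exp (-t) := by
  obtain ⟨hQ, lam, hlam, H⟩ := exists_isLaplaceDensity hl hl0 hf hG hmax hD0 ht hν hτ hr hω hων
    hωP h3 hS hconc hUS
  have hfm : Measurable f := (contDiff_penalized hl hf).continuous.measurable
  have hfi := integrable_exp_penalized hl.continuous hl0 hf hG
  have hprob : IsProbabilityMeasure (laplaceGaussian f xG) := isProbabilityMeasure_gibbs hQ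
  rw [laplaceError_cond_eq hfm hfi hS xG hQ hA, ← hlam]
  refine ⟨H.abs_sub_le hA, fun τ₄ hτ₄ hl4 h4 hAs => ?_⟩
  have hm := measurable_negHessForm f xG
  have heven : ∀ (g : EuclideanSpace ℝ (Fin p) → ℝ) u, negHessForm g xG (-u) = negHessForm g xG u :=
    fun g u => by simpa using negHessForm_smul g xG u (-1)
  exact H.abs_sub_le_of_symm
    (measurePreserving_neg_gibbs (g := fun u => -(negHessForm f xG u / 2)) (by fun_prop)
      fun u => by simp only [heven])
    (fun u => heven l u) hτ₄ (fun u hu => abs_remainder_add_neg_le hl4 hf hmax hD0 h4 hu) hA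
    fun u => (hAs u).symm

lemma laplaceError_le_add (P : Measure (EuclideanSpace ℝ (Fin p))) [IsProbabilityMeasure P]
    (hS : MeasurableSet S) (f : EuclideanSpace ℝ (Fin p) → ℝ) (x : EuclideanSpace ℝ (Fin p))
    (A : Set (EuclideanSpace ℝ (Fin p))) :
    laplaceError P f x A ≤ laplaceError (ProbabilityTheory.cond P S) f x A + P.real Sᶜ := by
  have h1 := abs_real_sub_cond_real_le P hS ((fun y => y - x) ⁻¹' A)
  have h2 := abs_sub_le (P.real ((fun y => y - x) ⁻¹' A))
    ((ProbabilityTheory.cond P S).real ((fun y => y - x) ⁻¹' A)) ((laplaceGaussian f x).real A)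
  unfold laplaceError
  linarith

end Posterior

end NonlinearLaplace

theorem mainTheorem6 {p n : ℕ} (hn : 0 < n)
    (m : EuclideanSpace ℝ (Fin p) → EuclideanSpace ℝ (Fin n)) (hm : ContDiff ℝ 3 m)
    (z : EuclideanSpace ℝ (Fin n)) (x₀ : EuclideanSpace ℝ (Fin p))
    (G : EuclideanSpace ℝ (Fin p) →L[ℝ] EuclideanSpace ℝ (Fin p)) (hG : Function.Injective G)
    (r₀ ρ₀ C₀ C₂ Cn : ℝ) (hr₀ : 0 ≤ r₀) (hρ₀ : 0 ≤ ρ₀) (hC₀ : 0 ≤ C₀) (hC₂ : 0 ≤ C₂)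
    (hCn : 0 ≤ Cn)
    -- first and second order smoothness on the prior concentration set
    (hS2 : Smooth2On m (priorSet m x₀ r₀) C₂ Cn)
    (hD₀ : ∀ x ∈ priorSet m x₀ r₀, ∀ u, breveSq m x u ≤ C₀ ^ 2 * breveSq m x₀ u)
    (hG₀ : ∀ u, breveSq m x₀ u ≤ n * ‖G u‖ ^ 2)
    -- the initial guess condition
    (xs : EuclideanSpace ℝ (Fin p)) (hxs : xs ∈ priorSet m x₀ r₀)
    (hxsz : ∀ i, |m xs i - z i| ≤ ρ₀)
    (hδ : C₂ * (ρ₀ + 2 * r₀ * Cn * C₀ / √n) ≤ 3 / 4) :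
    -- strong concavity on the prior concentration set
    ((∀ x ∈ priorSet m x₀ r₀, ∀ u,
        (1 - C₂ * (ρ₀ + 2 * r₀ * Cn * C₀ / √n)) * breveSq m x u
          ≤ negHessForm (logLik m z) x u) ∧
      ∃ μ : ℝ, 0 < μ ∧ (∀ u, μ * ‖u‖ ^ 2 ≤ ‖G u‖ ^ 2) ∧
        StrongConcaveOn (priorSet m x₀ r₀) μ (objective m z x₀ G)) ∧
    -- the penalized solution exists, is unique, and lies in the prior concentration set
    (n * (‖G (xs - x₀)‖ ^ 2 + ‖m xs - z‖ ^ 2) ≤ r₀ ^ 2 →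
      ∃ xG ∈ priorSet m x₀ r₀, IsMaxOn (objective m z x₀ G) Set.univ xG ∧
        ∀ y, IsMaxOn (objective m z x₀ G) Set.univ y → y = xG) ∧
    -- the Laplace approximation bounds
    (∀ xG : EuclideanSpace ℝ (Fin p), IsMaxOn (objective m z x₀ G) Set.univ xG →
      ∀ t ν CG C₃ c₃ pG r : ℝ, 0 < t → 0 < ν → ν < 1 → 0 ≤ CG → 0 ≤ C₃ →
      c₃ = 4 * CG ^ (3 / 2 : ℝ) * C₃ * Cn →
      pG = effDim (logLik m z) (objective m z x₀ G) xG →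
      r = effRadius (logLik m z) (objective m z x₀ G) xG t / ν →
      localSet (logLik m z) xG r ⊆ priorSet m x₀ r₀ →
      ρ₀ + 2 * r₀ * Cn * C₀ / √n ≤ 1 →
      (∀ x ∈ localSet (logLik m z) xG r, ∀ u,
        breveSq m x u ≤ CG * negHessForm (logLik m z) xG u) →
      Smooth3On m (localSet (logLik m z) xG r) C₃ →
      c₃ * r / √n ≤ 3 / 4 → c₃ * r / √n / 3 ≤ 1 - ν → c₃ * r / √n / 3 * pG ≤ 2 / 3 →
      (∀ A : Set (EuclideanSpace ℝ (Fin p)), MeasurableSet A →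
        laplaceError (ProbabilityTheory.cond (gibbs (objective m z x₀ G)) (priorSet m x₀ r₀))
            (objective m z x₀ G) xG A
          ≤ 2 * c₃ * √((pG + 1) ^ 3 / n) + 4 * Real.exp (-t) ∧
        laplaceError (gibbs (objective m z x₀ G)) (objective m z x₀ G) xG A
          ≤ 2 * c₃ * √((pG + 1) ^ 3 / n) + 4 * Real.exp (-t)
            + (gibbs (objective m z x₀ G)).real (priorSet m x₀ r₀)ᶜ ∧
        (ConcaveOn ℝ Set.univ (logLik m z) →
          laplaceError (gibbs (objective m z x₀ G)) (objective m z x₀ G) xG A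
            ≤ 2 * c₃ * √((pG + 1) ^ 3 / n) + 4 * Real.exp (-t))) ∧
      (∀ C₄ c₄ : ℝ, 0 ≤ C₄ → c₄ = 8 * CG ^ 2 * C₄ * Cn ^ 2 → ContDiff ℝ 4 m →
        Smooth4On m (localSet (logLik m z) xG r) C₄ →
        ∀ A : Set (EuclideanSpace ℝ (Fin p)), MeasurableSet A → (∀ u, u ∈ A ↔ -u ∈ A) →
        laplaceError (ProbabilityTheory.cond (gibbs (objective m z x₀ G)) (priorSet m x₀ r₀))
            (objective m z x₀ G) xG A
          ≤ (c₃ ^ 2 * (pG + 2) ^ 3 + 2 * c₄ * (pG + 1) ^ 2) / (2 * n) + 4 * Real.exp (-t) ∧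
        laplaceError (gibbs (objective m z x₀ G)) (objective m z x₀ G) xG A
          ≤ (c₃ ^ 2 * (pG + 2) ^ 3 + 2 * c₄ * (pG + 1) ^ 2) / (2 * n) + 4 * Real.exp (-t)
            + (gibbs (objective m z x₀ G)).real (priorSet m x₀ r₀)ᶜ ∧
        (ConcaveOn ℝ Set.univ (logLik m z) →
          laplaceError (gibbs (objective m z x₀ G)) (objective m z x₀ G) xG A
            ≤ (c₃ ^ 2 * (pG + 2) ^ 3 + 2 * c₄ * (pG + 1) ^ 2) / (2 * n)
              + 4 * Real.exp (-t)))) := by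
  have hmd : Differentiable ℝ m := hm.differentiable (by norm_num)
  have hl : ContDiff ℝ 3 (logLik m z) := contDiff_logLik (N := 3) hm z
  set K := ρ₀ + 2 * r₀ * Cn * C₀ / √n with hK
  have hK0 : 0 ≤ K := by positivity
  have hX : Convex ℝ (priorSet m x₀ r₀) := convex_priorSet hmd hr₀
  have hXm : MeasurableSet (priorSet m x₀ r₀) := measurableSet_priorSet hmd hr₀
  have hres : ∀ x ∈ priorSet m x₀ r₀, ∀ i, |m x i - z i| ≤ K := fun x hx i =>
    abs_residual_le hm hr₀ hC₀ hCn hS2 hD₀ hxs hxsz hx i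
  have hcurv : ∀ x ∈ priorSet m x₀ r₀, ∀ u,
      (1 - C₂ * K) * breveSq m x u ≤ negHessForm (logLik m z) x u := fun x hx u =>
    breveSq_le_negHessForm hm hS2 hx hK0 (hres x hx) u
  have hD0 : ∀ x ∈ priorSet m x₀ r₀, ∀ u, 0 ≤ negHessForm (logLik m z) x u := fun x hx u =>
    (mul_nonneg (by linarith) (breveSq_nonneg m x u)).trans (hcurv x hx u)
  obtain ⟨μ, hμ0, hμ⟩ := exists_pos_mul_norm_sq_le hG
  have hstrong : StrongConcaveOn (priorSet m x₀ r₀) μ (objective m z x₀ G) :=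
    strongConcaveOn_objective hm hX hD0 hμ
  refine ⟨⟨hcurv, μ, hμ0, hμ, hstrong⟩, fun hguess => ?_, ?_⟩
  · obtain ⟨xG, hxG⟩ := exists_isMaxOn_objective (z := z) (x₀ := x₀) hm.continuous hG
    have hmem : ∀ y, IsMaxOn (objective m z x₀ G) Set.univ y → y ∈ priorSet m x₀ r₀ := fun y hy =>
      mem_priorSet_of_le_objective hG₀ hguess (hy (Set.mem_univ xs))
    refine ⟨xG, hmem xG hxG, hxG, fun y hy => ?_⟩
    exact (hstrong.strictConcaveOn hμ0).eq_of_isMaxOn (hy.on_subset (Set.subset_univ _))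
      (hxG.on_subset (Set.subset_univ _)) (hmem y hy) (hmem xG hxG)
  · intro xG hmax t ν CG C₃ c₃ pG r ht hν hν1 hCG hC₃ hc₃ hpG hr hUX hK1 hbreve hS3 hω hων hωP
    have hn' : (0 : ℝ) < n := Nat.cast_pos.2 hn
    have hsn : 0 < √(n : ℝ) := Real.sqrt_pos.2 hn'
    have hsn2 : √(n : ℝ) ^ 2 = n := Real.sq_sqrt hn'.le
    have hf : ∀ x, objective m z x₀ G x = logLik m z x - ‖G (x - x₀)‖ ^ 2 / 2 := fun _ => rfl
    have hl0 : ∀ x, logLik m z x ≤ 0 := fun x => by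
      unfold logLik; linarith [sq_nonneg ‖m x - z‖]
    have hxG : xG ∈ priorSet m x₀ r₀ := hUX (by
      have := add_smul_mem_localSet (l := logLik m z) (xG := xG) (u := 0) (r := r) (s := 0)
        (by simp [sq_nonneg])
      simpa using this)
    have hD := hD0 xG hxG
    have hc₃0 : 0 ≤ c₃ := by rw [hc₃]; positivity
    have hτ : 0 ≤ c₃ / √n := by positivity
    have hτr : c₃ / √n * r / 3 = c₃ * r / √n / 3 := by ring
    have h3 : ∀ x ∈ localSet (logLik m z) xG r, ∀ u, |dirDeriv 3 (logLik m z) x u| ≤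
        c₃ / √n * (negHessForm (logLik m z) xG u * √(negHessForm (logLik m z) xG u)) := by
      intro x hx u
      rw [hc₃]
      exact abs_dirDeriv_three_logLik_le hm hCn hC₃ hCG (hUX hx) hx
        (fun i => (hres x (hUX hx) i).trans hK1) hS2 hS3 (hbreve x hx u)
    have hprob : IsProbabilityMeasure (gibbs (objective m z x₀ G)) :=
      isProbabilityMeasure_gibbs (integrable_exp_penalized hl.continuous hl0 hf hG)
    -- The conditioning set is kept free: `priorSet` gives the conditional bounds, and the whole
    -- space gives the unconditional ones when `ℓ` is globally concave.
    have core := fun (S : Set (EuclideanSpace ℝ (Fin p))) (hS : MeasurableSet S)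
        (hconc : ConcaveOn ℝ S (logLik m z)) (hUS : localSet (logLik m z) xG r ⊆ S)
        (A : Set (EuclideanSpace ℝ (Fin p))) (hA : MeasurableSet A) =>
      laplaceError_cond_le hl hl0 hf hG hmax hD ht hν hτ hr (by rw [hτr]; linarith)
        (by rw [hτr]; exact hων) (by rw [hτr, ← hpG]; exact hωP) h3 hS hconc hUS hA
    rw [← hpG] at core
    have coreX := core _ hXm (concaveOn_logLik hm hX hD0) hUX
    have coreU : ConcaveOn ℝ Set.univ (logLik m z) → _ := fun h =>
      core _ MeasurableSet.univ h (Set.subset_univ _)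
    rw [cond_univ] at coreU
    refine ⟨fun A hA => ?_, fun C₄ c₄ hC₄ hc₄ hm4 hS4 A hA hAs => ?_⟩
    · have e : 2 * (c₃ / √n) * √((pG + 1) ^ 3) = 2 * c₃ * √((pG + 1) ^ 3 / n) := by
        rw [Real.sqrt_div' _ hn'.le]; ring
      have h1 := (coreX A hA).1
      rw [e] at h1
      refine ⟨h1, (laplaceError_le_add _ hXm _ _ A).trans (by linarith), fun hc => ?_⟩
      have h2 := (coreU hc A hA).1
      rwa [e] at h2
    · have e : (c₃ / √n) ^ 2 * (pG + 2) ^ 3 / 2 + c₄ / n * (pG + 1) ^ 2 =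
          (c₃ ^ 2 * (pG + 2) ^ 3 + 2 * c₄ * (pG + 1) ^ 2) / (2 * n) := by
        rw [div_pow, hsn2]
        field_simp
      have hτ₄ : 0 ≤ c₄ / n := by rw [hc₄]; positivity
      have hl4 : ContDiff ℝ 4 (logLik m z) := contDiff_logLik (N := 4) hm4 z
      have h4 : ∀ x ∈ localSet (logLik m z) xG r, ∀ u, |dirDeriv 4 (logLik m z) x u| ≤
          c₄ / n * negHessForm (logLik m z) xG u ^ 2 := by
        intro x hx u
        rw [hc₄]
        exact abs_dirDeriv_four_logLik_le hm4 hC₄ (hUX hx) hx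
          (fun i => (hres x (hUX hx) i).trans hK1) hS2 hS4 (hbreve x hx u)
      have h1 := (coreX A hA).2 _ hτ₄ hl4 h4 hAs
      rw [e] at h1
      refine ⟨h1, (laplaceError_le_add _ hXm _ _ A).trans (by linarith), fun hc => ?_⟩
      have h2 := (coreU hc A hA).2 _ hτ₄ hl4 h4 hAs
      rwa [e] at h2
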